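/- **Setting.** Let $q\ge 0$ be an integer, let $\mathcal T=\mathcal T_{q+1}$ be the $(q+1)$-regular tree, and let $\Gamma\le\mathrm{Aut}(\mathcal T)$ be a subgroup acting without inversions of edges and with finite vertex stabilizers. An element $\gamma$ of a group $G$ acting on a tree without inversions is *hyperbolic* if it fixes no vertex; its translation length is $\ell(\gamma)=\min_x d(x,\gamma x)$, and $\mathrm{Axis}(\gamma)=\{x: d(x,\gamma x)=\ell(\gamma)\}$. It is *primitive* if moreover $\gamma\neq h^r$ for all $h\in G$, $r>1$. Write $\Gamma_{\mathrm{Axis}(\gamma)}$ for the pointwise stabilizer of $\mathrm{Axis}(\gamma)$ in $\Gamma$, and $\mathrm{Cent}(\gamma,\Gamma_{\mathrm{Axis}(\gamma)})$ for the group of its elements commuting with $\gamma$. Assume that $\Gamma$ is *centrally rigid*: there is $c_\Gamma\in\mathbb N$ with $|\mathrm{Cent}(\gamma,\Gamma_{\mathrm{Axis}(\gamma)})|=c_\Gamma$ for every primitive hyperbolic $\gamma\in\Gamma$. Assume also that $\Gamma$ is a tree lattice, i.e. $\sum_{x\in\Gamma\backslash\mathcal T}1/|\Gamma_x|<\infty$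 (sum over vertices), or that $c_\Gamma=1$. **The graph of groups.** Let $X=\Gamma\backslash\mathcal T$, with a maximal subtree $R$, and let $\mathbf X=(X,\mathcal G)$ be a quotient graph of groups of $\Gamma$: choose lifts $y_x$ of the vertices $x$ and $f_e$ of the oriented edges $e$ of $X$ with $f_{\bar e}=\overline{f_e}$, and $\gamma_e\in\Gamma$ with $\gamma_e t(f_e)=y_{t(e)}$, such that $\gamma_e=1$ for $e\in R$ and $\gamma_e=1$ or $\gamma_{\bar e}=1$ for every $e$; put $G_x=\Gamma_{y_x}$, $G_e=\Gamma_{f_e}$ and $\phi_e\colon G_e\to G_{t(e)}$, $g\mapsto\gamma_e g\gamma_e^{-1}$. The group $\pi_1=\pi_1(\mathbf X,R)$ is generated by the groups $G_x$ and elements $g_e$ subject to $g_e\phi_e(g)g_e^{-1}=\phi_{\bar e}(g)$ for $g\in G_e=G_{\bar e}$, $g_{\bar e}=g_e^{-1}$, and $g_e=1$ for $e\in R$. It acts on the universal covering tree of $\mathbf X$, whose vertices are the cosets $\gamma G_x$ and whose edges join $\gamma G_{s(e)}$ to $\gamma g_eG_{t(e)}$. **The two zeta functions.** The Selberg zeta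 function of $\mathbf X$ is $$Z_{\mathbf X}(u)=\prod_{[\gamma]}\frac1{1-u^{\ell(\gamma)}},$$ over the conjugacy classes of primitive hyperbolic elements of $\pi_1$, with respect to the action on the universal covering tree. The associated weighted graph is $\mathbf A=(X,w)$ with $w(e)=|G_{s(e)}|/|G_e|$, $w(e,e')=w(e')$ if $e'\ne\bar e$ and $w(e,\bar e)=w(\bar e)-1$. A cycle is a closed path $C=(e_1,\dots,e_n)$, $n\ge 1$, up to cyclic rotation (backtracking allowed), with $\ell(C)=n$ and $w(C)=\prod_{j\in\mathbb Z/n}w(e_j,e_{j+1})$; it is primitive if it is not $D^f$ for a closed path $D$ and $f>1$. The Bass–Ihara zeta function of $\mathbf A$ is $$Z_{\mathbf A}(u)=\prod_{[C]}\frac1{1-w(C)u^{\ell(C)}},$$ over the primitive cycles of $X$. **Theorem.** $$Z_{\mathbf X}(u)=Z_{\mathbf A}(u)^{c_\Gamma}$$ in both of the following senses. (1) As formal power series in $\mathbb Q[[u]]$: one of the two Euler products converges coefficientwise if and only if the other does, and then the identity holds. (2) As functions: say that a product $\prod_i(1-a_i)^{-1}$ of complex numbers converges absolutely if $|a_i|<1$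 for all $i$ and $\sum_i|a_i|<\infty$. For every $u\in\mathbb C$, one of the two Euler products converges absolutely at $u$ if and only if the other does, and then the identity holds at $u$. -/

import Mathlib

open scoped PowerSeries.WithPiTopology

noncomputable section

namespace TreeZeta

universe u v w

/-! ### Graphs with oriented edges -/

/-- A graph: vertices `V`, oriented edges `E`, source, target, and a fixed-point-free edge
inversion exchanging source and target. -/
structure OrientedGraph (V : Type u) (E : Type v) where
  src : E → V
  tgt : E → V
  inv : E → E
  inv_inv : ∀ e, inv (inv e) = e
  inv_ne : ∀ e, inv e ≠ e
  src_eq : ∀ e, src e = tgt (inv e)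

namespace OrientedGraph

variable {V : Type u} {E : Type v} (X : OrientedGraph V E)

/-- The list of edges `l` is a path from `x` to `y`. -/
def IsPath : V → List E → V → Prop
  | x, [], y => x = y
  | x, e :: l, y => X.src e = x ∧ IsPath (X.tgt e) l y

/-- A list of edges has no backtracking. -/
def IsReduced (l : List E) : Prop := l.IsChain (fun e f => f ≠ X.inv e)

/-- `R` is the set of oriented edges of a subtree of `X` containing all vertices (that is, of a
maximal subtree, when `X` is connected): any two vertices are joined by exactly one path without
backtracking with edges in `R`. -/
def IsMaximalSubtree (R : Set E) : Prop :=
  (∀ e ∈ R, X.inv e ∈ R) ∧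
    ∀ x y : V, ∃! l : List E, X.IsPath x l y ∧ X.IsReduced l ∧ ∀ e ∈ l, e ∈ R

/-- A cyclic sequence of edges is (the class, up to cyclic rotation, of) a closed path. -/
def IsClosedPath (C : Cycle E) : Prop :=
  C ≠ Cycle.nil ∧ C.Chain (fun e f => X.tgt e = X.src f)

/-- `C` is a primitive cycle: it is not `D ^ f` for a closed path `D` and `f > 1`. -/
def IsPrimitiveCycle (C : Cycle E) : Prop :=
  X.IsClosedPath C ∧
    ¬ ∃ (D : List E) (f : ℕ), X.IsClosedPath (D : Cycle E) ∧ 1 < f ∧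
      C = (((List.replicate f D).flatten : List E) : Cycle E)

end OrientedGraph

/-! ### Graphs of groups -/

/-- A graph of groups on the graph `X`. The equality `G_e = G_{ē}` is recorded by an involutive
system of identifications `flip` between the groups of an edge and of its inverse. -/
structure GraphOfGroups {V : Type u} {E : Type v} (X : OrientedGraph V E) where
  Gv : V → Type w
  Ge : E → Type w
  [groupV : ∀ x, Group (Gv x)]
  [groupE : ∀ e, Group (Ge e)]
  flip : ∀ {e e' : E}, e' = X.inv e → (Ge e ≃* Ge e')
  flip_flip : ∀ {e e' : E} (h : e' = X.inv e) (h' : e = X.inv e') (g : Ge e),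
    flip h' (flip h g) = g
  φ : ∀ e : E, Ge e →* Gv (X.tgt e)
  φ_injective : ∀ e, Function.Injective (φ e)

namespace GraphOfGroups

attribute [instance] groupV groupE

variable {V : Type u} {E : Type v} {X : OrientedGraph V E} (𝒢 : GraphOfGroups.{u, v, w} X) (R : Set E)

/-- Generators of the fundamental group: the elements of the vertex groups, and a letter `g_e`
for every oriented edge `e`. -/
abbrev Gen : Type (max u v w) := (Σ x : V, 𝒢.Gv x) ⊕ E

/-- A vertex group element as a letter. -/
def vLetter (x : V) (a : 𝒢.Gv x) : FreeGroup 𝒢.Gen := FreeGroup.of (Sum.inl ⟨x, a⟩)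

/-- The letter `g_e`. -/
def eLetter (e : E) : FreeGroup 𝒢.Gen := FreeGroup.of (Sum.inr e)

/-- The relations of the fundamental group: the multiplication of the vertex groups,
`g_e φ_e(g) g_e⁻¹ = φ_{ē}(g)`, `g_{ē} = g_e⁻¹`, and `g_e = 1` for `e` in the maximal subtree. -/
def rels : Set (FreeGroup 𝒢.Gen) :=
  {r | ∃ (x : V) (a b : 𝒢.Gv x),
      r = 𝒢.vLetter x (a * b) * (𝒢.vLetter x a * 𝒢.vLetter x b)⁻¹} ∪
  {r | ∃ (e : E) (g : 𝒢.Ge e),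
      r = 𝒢.eLetter e * 𝒢.vLetter (X.tgt e) (𝒢.φ e g) * (𝒢.eLetter e)⁻¹ *
        (𝒢.vLetter (X.tgt (X.inv e)) (𝒢.φ (X.inv e) (𝒢.flip rfl g)))⁻¹} ∪
  {r | ∃ e : E, r = 𝒢.eLetter (X.inv e) * 𝒢.eLetter e} ∪
  {r | ∃ e ∈ R, r = 𝒢.eLetter e}

/-- The fundamental group `π₁(𝐗, R)` of a graph of groups. -/
abbrev Pi1 : Type (max u v w) := PresentedGroup (𝒢.rels R)

/-- The canonical homomorphism from a vertex group to the fundamental group. -/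
def vertexHom (x : V) : 𝒢.Gv x →* 𝒢.Pi1 R :=
  MonoidHom.mk' (fun a => PresentedGroup.mk (𝒢.rels R) (𝒢.vLetter x a)) (by
    intro a b
    rw [← map_mul]
    exact PresentedGroup.mk_eq_mk_of_mul_inv_mem (Or.inl (Or.inl (Or.inl ⟨x, a, b, rfl⟩))))

/-- The element `g_e` of the fundamental group. -/
def edgeElt (e : E) : 𝒢.Pi1 R := PresentedGroup.mk (𝒢.rels R) (𝒢.eLetter e)

/-- Vertices of the universal covering tree: the cosets `γ G_x`. -/
abbrev CoverVertex : Type (max u v w) := Σ x : V, 𝒢.Pi1 R ⧸ (𝒢.vertexHom R x).range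

/-- The universal covering (Bass–Serre) tree of a graph of groups: the vertices are the cosets
`γ G_x`, and each edge `e` and `γ ∈ π₁` give an edge from `γ G_{s(e)}` to `γ g_e G_{t(e)}`. -/
def coverTree : SimpleGraph (𝒢.CoverVertex R) :=
  SimpleGraph.fromRel fun a b => ∃ (e : E) (γ : 𝒢.Pi1 R),
    a = ⟨X.src e, (γ : 𝒢.Pi1 R ⧸ (𝒢.vertexHom R (X.src e)).range)⟩ ∧
    b = ⟨X.tgt e, ((γ * 𝒢.edgeElt R e : 𝒢.Pi1 R) : 𝒢.Pi1 R ⧸ (𝒢.vertexHom R (X.tgt e)).range)⟩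

end GraphOfGroups

/-! ### Hyperbolic elements of a group acting on a tree without inversions -/

section Hyperbolic

variable {V : Type u} {G : Type v} [Group G] [MulAction G V] (T : SimpleGraph V)

/-- Translation length: the minimum of `d(x, g x)` over all vertices `x`. -/
def translationLength (g : G) : ℕ := sInf (Set.range fun x : V => T.dist x (g • x))

/-- The axis of `g`: the vertices moved by exactly the translation length. -/
def axis (g : G) : Set V := {x | T.dist x (g • x) = translationLength T g}

variable (V) in
/-- An element is hyperbolic if it fixes no vertex. -/
def IsHyperbolic (g : G) : Prop := ∀ x : V, g • x ≠ x

variable (V) in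
/-- A primitive hyperbolic element: it is not `h ^ r` with `r > 1`. -/
def IsPrimitiveHyperbolic (g : G) : Prop :=
  IsHyperbolic V g ∧ ¬ ∃ (h : G) (r : ℕ), 1 < r ∧ g = h ^ r

variable (G V) in
/-- Conjugacy classes of primitive hyperbolic elements. -/
abbrev PrimitiveClass : Type v :=
  {c : ConjClasses G // ∃ g : G, ConjClasses.mk g = c ∧ IsPrimitiveHyperbolic V g}

/-- The length of a class is the translation length of any of its elements. -/
def PrimitiveClass.length (c : PrimitiveClass V G) : ℕ :=
  translationLength T (Quotient.out c.1 : G)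

/-- `Cent(g, G_{Axis(g)})`: the elements of the pointwise stabilizer of the axis of `g` that
commute with `g`. -/
def axisCentralizer (g : G) : Subgroup G :=
  fixingSubgroup G (axis T g) ⊓ Subgroup.centralizer {g}

variable (G) in
/-- The action is centrally rigid with constant `c`: the centralizer `Cent(γ, G_{Axis(γ)})` has
`c` elements for every primitive hyperbolic `γ`. -/
def IsCentrallyRigid (c : ℕ) : Prop :=
  ∀ g : G, IsPrimitiveHyperbolic V g → Nat.card (axisCentralizer T g) = c

end Hyperbolic

/-! ### The weighted graph of a graph of finite groups -/

namespace GraphOfGroups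

variable {V : Type u} {E : Type v} {X : OrientedGraph V E} (𝒢 : GraphOfGroups.{u, v, w} X) (R : Set E)

/-- The weight `w(e) = |G_{s(e)}| / |G_e|`. -/
def weight (e : E) : ℚ := (Nat.card (𝒢.Gv (X.src e)) : ℚ) / (Nat.card (𝒢.Ge e) : ℚ)

open Classical in
/-- The weight `w(e, e')` of a pair of edges: `w(e')`, diminished by one if `e' = ē`. -/
def weight₂ (e e' : E) : ℚ :=
  if e' = X.inv e then 𝒢.weight e' - 1 else 𝒢.weight e'

/-- The weight `∏_{j ∈ ℤ/n} w(e_j, e_{j+1})` of `(e_1, …, e_n)`. -/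
def listWeight (l : List E) : ℚ := (List.zipWith 𝒢.weight₂ l (l.rotate 1)).prod

theorem listWeight_eq_of_isRotated {l l' : List E} (h : l ~r l') :
    𝒢.listWeight l = 𝒢.listWeight l' := by
  obtain ⟨n, rfl⟩ := h
  unfold listWeight
  rw [List.rotate_rotate, Nat.add_comm, ← List.rotate_rotate,
    ← List.zipWith_rotate_distrib _ _ _ _ (by simp)]
  exact (List.rotate_perm _ n).prod_eq.symm

/-- The weight of a cycle. -/
def cycleWeight (C : Cycle E) : ℚ :=
  Quotient.liftOn' C 𝒢.listWeight fun _ _ h => 𝒢.listWeight_eq_of_isRotated h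

end GraphOfGroups

/-! ### Euler products -/

section Euler

variable {ι : Type u} (a : ι → ℚ) (ℓ : ι → ℕ)

/-- The Euler product `∏ (1 - a_i u^{ℓ_i})⁻¹` converges coefficientwise as a formal power
series in `u`. -/
def FormalConverges : Prop :=
  Multipliable fun i => (1 - PowerSeries.C (a i) * (PowerSeries.X : PowerSeries ℚ) ^ ℓ i)⁻¹

/-- The Euler product `∏ (1 - a_i u^{ℓ_i})⁻¹` as a formal power series in `u`. -/
def formalEuler : PowerSeries ℚ :=
  ∏' i, (1 - PowerSeries.C (a i) * (PowerSeries.X : PowerSeries ℚ) ^ ℓ i)⁻¹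

/-- The complex number `u` lies in the domain of absolute convergence of the Euler product
`∏ (1 - a_i u^{ℓ_i})⁻¹`, where every factor is the sum of a convergent geometric series. -/
def AbsConverges (u : ℂ) : Prop :=
  (∀ i, ‖(a i : ℂ) * u ^ ℓ i‖ < 1) ∧ Summable fun i => ‖(a i : ℂ) * u ^ ℓ i‖

/-- The value of the Euler product `∏ (1 - a_i u^{ℓ_i})⁻¹` at a complex number `u`. -/
def eulerValue (u : ℂ) : ℂ := ∏' i, (1 - (a i : ℂ) * u ^ ℓ i)⁻¹

end Euler

namespace GraphOfGroups

variable {V : Type u} {E : Type v} {X : OrientedGraph V E} (𝒢 : GraphOfGroups.{u, v, w} X) (R : Set E)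

/-- The index set of the Selberg zeta function: the conjugacy classes of primitive hyperbolic
elements of `π₁(𝐗, R)`. -/
abbrev PrimePi1 : Type (max u v w) := PrimitiveClass (𝒢.CoverVertex R) (𝒢.Pi1 R)

/-- The translation length on the universal covering tree of a prime of `π₁(𝐗, R)`. -/
def primeLength (c : 𝒢.PrimePi1 R) : ℕ := c.length (𝒢.coverTree R)

def SelbergFormalConverges : Prop :=
  FormalConverges (fun _ : 𝒢.PrimePi1 R => 1) (𝒢.primeLength R)

def SelbergAbsConverges (u : ℂ) : Prop :=
  AbsConverges (fun _ : 𝒢.PrimePi1 R => 1) (𝒢.primeLength R) u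

/-- The Selberg zeta function `∏_{[γ]} (1 - u^{ℓ(γ)})⁻¹` as a formal power series. -/
def selbergZetaFormal : PowerSeries ℚ :=
  formalEuler (fun _ : 𝒢.PrimePi1 R => 1) (𝒢.primeLength R)

/-- The Selberg zeta function `∏_{[γ]} (1 - u^{ℓ(γ)})⁻¹` at a complex number. -/
def selbergZeta (u : ℂ) : ℂ :=
  eulerValue (fun _ : 𝒢.PrimePi1 R => 1) (𝒢.primeLength R) u

variable (X) in
/-- The primitive cycles of the underlying graph; backtracking is allowed. -/
abbrev PrimeCycle : Type v := {C : Cycle E // X.IsPrimitiveCycle C}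

def BassIharaFormalConverges : Prop :=
  FormalConverges (fun C : PrimeCycle X => 𝒢.cycleWeight C.1) (fun C => C.1.length)

def BassIharaAbsConverges (u : ℂ) : Prop :=
  AbsConverges (fun C : PrimeCycle X => 𝒢.cycleWeight C.1) (fun C => C.1.length) u

/-- The Bass–Ihara zeta function `∏_{[C]} (1 - w(C) u^{ℓ(C)})⁻¹` of the weighted graph of a
graph of finite groups, as a formal power series. -/
def bassIharaZetaFormal : PowerSeries ℚ :=
  formalEuler (fun C : PrimeCycle X => 𝒢.cycleWeight C.1) (fun C => C.1.length)

/-- The Bass–Ihara zeta function `∏_{[C]} (1 - w(C) u^{ℓ(C)})⁻¹` of the weighted graph of a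
graph of finite groups, at a complex number. -/
def bassIharaZeta (u : ℂ) : ℂ :=
  eulerValue (fun C : PrimeCycle X => 𝒢.cycleWeight C.1) (fun C => C.1.length) u

end GraphOfGroups

/-! ### The quotient graph of groups of a group acting on a tree -/

section Quotient

variable {V : Type u} {T : SimpleGraph V}

/-- Automorphisms of a simple graph act on its oriented edges. -/
instance dartAction : MulAction (T ≃g T) T.Dart where
  smul g d := ⟨(g d.fst, g d.snd), g.map_rel_iff.2 d.adj⟩
  one_smul _ := rfl
  mul_smul _ _ _ := rfl

theorem smul_dart_fst (g : T ≃g T) (d : T.Dart) : (g • d).fst = g • d.fst := rfl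

theorem smul_dart_snd (g : T ≃g T) (d : T.Dart) : (g • d).snd = g • d.snd := rfl

theorem smul_dart_symm (g : T ≃g T) (d : T.Dart) : (g • d).symm = g • d.symm := rfl

variable (Γ : Subgroup (T ≃g T))

/-- `Γ` acts without inversions of edges. -/
def ActsWithoutInversions : Prop := ∀ (γ : Γ) (d : T.Dart), γ • d ≠ d.symm

/-- Every vertex stabilizer is finite, that is, `Γ` is discrete in the automorphism group of a
locally finite tree. -/
def HasFiniteStabilizers : Prop := ∀ x : V, Finite (MulAction.stabilizer Γ x)

/-- `Γ` is a tree lattice: all vertex stabilizers are finite, and the sum of `1 / |Γ_x|` over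
representatives `x` of the vertices of the quotient is finite. -/
def IsTreeLattice : Prop :=
  HasFiniteStabilizers Γ ∧
    Summable fun x : MulAction.orbitRel.Quotient Γ V =>
      (1 : ℝ) / (Nat.card (MulAction.stabilizer Γ (Quotient.out x : V)) : ℝ)

/-- Vertices of the quotient graph `Γ \ T`. -/
abbrev QVertex : Type u := MulAction.orbitRel.Quotient Γ V

/-- Oriented edges of the quotient graph `Γ \ T`. -/
abbrev QEdge : Type u := MulAction.orbitRel.Quotient Γ T.Dart

/-- The orbit of a vertex. -/
def qVertex (x : V) : QVertex Γ := Quotient.mk _ x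

/-- The orbit of an oriented edge. -/
def qEdge (d : T.Dart) : QEdge Γ := Quotient.mk _ d

/-- The quotient graph `Γ \ T` of an action without inversions. -/
def quotientGraph (hΓ : ActsWithoutInversions Γ) : OrientedGraph (QVertex Γ) (QEdge Γ) where
  src := Quotient.map (fun d : T.Dart => d.fst) (by
    rintro _ d ⟨γ, rfl⟩
    exact ⟨γ, rfl⟩)
  tgt := Quotient.map (fun d : T.Dart => d.snd) (by
    rintro _ d ⟨γ, rfl⟩
    exact ⟨γ, rfl⟩)
  inv := Quotient.map (fun d : T.Dart => d.symm) (by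
    rintro _ d ⟨γ, rfl⟩
    exact ⟨γ, rfl⟩)
  inv_inv := by
    rintro ⟨d⟩
    exact congrArg (Quotient.mk _) d.symm_symm
  inv_ne := by
    rintro ⟨d⟩ h
    obtain ⟨γ, hγ⟩ := Quotient.exact h
    exact hΓ γ d hγ
  src_eq := by
    rintro ⟨d⟩
    rfl

/-- The choices in the construction of the quotient graph of groups: a maximal subtree `R` of the
quotient graph `X`, lifts `y_x` of the vertices and `f_e` of the edges of `X` to the tree, and
elements `γ_e ∈ Γ` that move `t(f_e)` to the lift `y_{t(e)}`. The edges of `R` are lifted to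
edges between the chosen vertices, so that these span a lift of the subtree `R`; any other edge
has, for one of its two orientations, a lift starting at a chosen vertex. -/
structure QuotientChoice (hΓ : ActsWithoutInversions Γ) where
  R : Set (QEdge Γ)
  isMaximalSubtree : (quotientGraph Γ hΓ).IsMaximalSubtree R
  y : QVertex Γ → V
  y_spec : ∀ x, qVertex Γ (y x) = x
  f : QEdge Γ → T.Dart
  f_spec : ∀ e, qEdge Γ (f e) = e
  f_inv : ∀ e, f ((quotientGraph Γ hΓ).inv e) = (f e).symm
  k : QEdge Γ → Γ
  k_spec : ∀ e, k e • (f e).snd = y ((quotientGraph Γ hΓ).tgt e)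
  k_eq_one : ∀ e ∈ R, k e = 1
  k_eq_one_or : ∀ e, k e = 1 ∨ k ((quotientGraph Γ hΓ).inv e) = 1

namespace QuotientChoice

variable {Γ} {hΓ : ActsWithoutInversions Γ} (D : QuotientChoice Γ hΓ)

/-- The quotient graph of groups of `Γ` acting on a tree: the groups are the stabilizers
`Γ_{y_x}` and `Γ_{f_e}`, and `Γ_{f_e} → Γ_{y_{t(e)}}` is conjugation by `γ_e`. -/
def graphOfGroups : GraphOfGroups.{u, u, u} (quotientGraph Γ hΓ) where
  Gv x := MulAction.stabilizer Γ (D.y x)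
  Ge e := MulAction.stabilizer Γ (D.f e)
  flip {e e'} h := MulEquiv.subgroupCongr (by
    subst h
    ext γ
    simp only [MulAction.mem_stabilizer_iff, D.f_inv]
    exact ⟨fun h => congrArg SimpleGraph.Dart.symm h,
      fun h => SimpleGraph.Dart.symm_involutive.injective h⟩)
  flip_flip _ _ _ := rfl
  φ e := MonoidHom.mk' (fun g => ⟨D.k e * g.1 * (D.k e)⁻¹, by
      have h : g.1 • (D.f e).snd = (D.f e).snd := congrArg (fun d : T.Dart => d.snd) g.2
      rw [MulAction.mem_stabilizer_iff, ← D.k_spec e, smul_smul, inv_mul_cancel_right,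
        mul_smul, h]⟩) (by
    intro a b
    apply Subtype.ext
    simp [mul_assoc])
  φ_injective e := by
    intro a b h
    have h' := congrArg Subtype.val h
    exact Subtype.ext (by simpa using h')

end QuotientChoice

end Quotient

end TreeZeta

end

/-!
The proof has four ingredients.

*The constant.* For a bi-infinite geodesic ("line") `L` translated by a hyperbolic element, let `F`
be its pointwise stabilizer. If `c_Γ = 1`, then `F` is trivial: with `t` a translation of smallest
length, all elements `t ^ k f` (`f ∈ F`) are conjugate to `t ^ k` by elements of `F`, and if `t ^ k`
centralizes `F` this leaves only `f = 1` (`axisFree_of_isCentrallyRigid_one`). If `Γ` is a tree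
lattice and has a hyperbolic element, then `c_Γ = 1`: the finite covolume makes reachability of
oriented edges modulo `Γ` a symmetric relation (`mass_transport`), so every finite geodesic is part
of an axis; a geodesic with the smallest possible stabilizer then has trivial stabilizer, and so
does an axis through it (`IsTreeLattice.exists_trivial_fixator`, `eq_one_of_trivial_fixator`). Thus
either `c_Γ = 1` and pointwise stabilizers of axes are trivial, or there are no hyperbolic elements
and both zeta functions are `1`.

*Bass–Serre theory.* The group `π₁(𝐗, R)` with its action on the universal covering tree is
isomorphic to `Γ` acting on `T` (`QuotientChoice.groupEquiv`, `QuotientChoice.coverIso`), so the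
Selberg zeta function may be computed from the primes of `Γ`.

*Counting.* The axis of a prime `c` of `Γ` projects to a periodic path of the quotient graph, which
winds `f c ≥ 1` times around a unique primitive cycle `C` (`primesEquiv`). Fix `C` and an edge `d`
of `T` over its first edge. The weight `w(C)` is the number of geodesics that start with `d` and
lift one turn around `C`, so there are `|Γ_d| w(C) ^ n` elements of `Γ` that translate `d` along a
lift of `n` turns. Each of these is a power of an element of exactly one prime `c` over `C`, where
`f c ∣ n`, and `|Γ_d| f c` of them belong to a given `c`. Hence `∑_{f c ∣ n} f c = w(C) ^ n`
(`QuotientChoice.sum_length_over`).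

*Euler products.* This identity says that `∏_c (1 - u ^ {f c ℓ(C)})⁻¹` and
`(1 - w(C) u ^ ℓ(C))⁻¹` have the same logarithmic derivative (`hasProd_geomFactor`,
`hasProd_one_sub_pow_inv`); taking the product over `C` gives the theorem. Since weights are
nonnegative integers, formal convergence means that there are finitely many factors of each degree
(`formalConverges_natCast_iff`), and absolute convergence can be tested on the double series
`∑ f c |u| ^ n / n` of nonnegative terms.
-/

open scoped PowerSeries.WithPiTopology

noncomputable section

namespace TreeZeta

universe u v w

/-! ### Geodesics in trees -/

section Tree

variable {V : Type*} {T : SimpleGraph V}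

theorem exists_adj_dist_add_one (hT : T.IsTree) {a z : V} (h : a ≠ z) :
    ∃ b, T.Adj a b ∧ T.dist b z + 1 = T.dist a z := by
  obtain ⟨p, hp⟩ := hT.connected.exists_walk_length_eq_dist a z
  cases p with
  | nil => exact absurd rfl h
  | @cons _ b _ hab q =>
    refine ⟨b, hab, ?_⟩
    have h1 := SimpleGraph.dist_le q
    rw [SimpleGraph.Walk.length_cons] at hp
    have h2 : T.dist a z ≤ T.dist a b + T.dist b z := hT.connected.dist_triangle
    rw [SimpleGraph.dist_eq_one_iff_adj.2 hab] at h2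
    omega

theorem eq_of_adj_of_dist_add_one (hT : T.IsTree) {r v a b : V} (ha : T.Adj a v) (hb : T.Adj b v)
    (hda : T.dist r a + 1 = T.dist r v) (hdb : T.dist r b + 1 = T.dist r v) : a = b := by
  obtain ⟨p, hp⟩ := hT.connected.exists_walk_length_eq_dist r a
  obtain ⟨q, hq⟩ := hT.connected.exists_walk_length_eq_dist r b
  have hp' : (p.concat ha).IsPath :=
    SimpleGraph.Walk.isPath_of_length_eq_dist _ (by rw [SimpleGraph.Walk.length_concat, hp, hda])
  have hq' : (q.concat hb).IsPath :=
    SimpleGraph.Walk.isPath_of_length_eq_dist _ (by rw [SimpleGraph.Walk.length_concat, hq, hdb])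
  have h := congrArg Subtype.val ((hT.isAcyclic.subsingleton_path r v).elim ⟨_, hp'⟩ ⟨_, hq'⟩)
  have h2 := congrArg SimpleGraph.Walk.penultimate h
  simpa using h2

/-- A vertex of a tree has at most one neighbour closer to a given root. -/
theorem dist_eq_add_one_of_ne (hT : T.IsTree) {r v a b : V} (ha : T.Adj a v) (hb : T.Adj v b)
    (hda : T.dist r v = T.dist r a + 1) (hab : a ≠ b) : T.dist r b = T.dist r v + 1 := by
  rcases hT.dist_eq_dist_add_one_of_adj r hb with h | h
  · exact absurd (eq_of_adj_of_dist_add_one hT ha hb.symm hda.symm h.symm) hab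
  · exact h

/-- An edge `ab` separates the vertices nearer to `a` from those nearer to `b`. -/
theorem dist_eq_add_of_separated (hT : T.IsTree) {v z : V} {a b : V} (hab : T.Adj a b)
    (hv : T.dist v b = T.dist v a + 1) (hz : T.dist a z = T.dist b z + 1) :
    T.dist v z = T.dist v b + T.dist b z := by
  induction hn : T.dist b z generalizing a b with
  | zero =>
    rw [hT.connected.dist_eq_zero_iff] at hn
    rw [hn, add_zero]
  | succ n ih =>
    have hbz : b ≠ z := by
      rintro rfl
      simp at hn
    obtain ⟨c, hbc, hc⟩ := exists_adj_dist_add_one hT hbz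
    have hac : a ≠ c := by
      rintro rfl
      omega
    have h1 := dist_eq_add_one_of_ne hT hab hbc hv hac
    have h2 := ih hbc h1 hc.symm (by omega)
    omega

end Tree

/-! ### Lines -/

section Lines

variable {V : Type*} {T : SimpleGraph V}

/-- The oriented edge `d'` continues `d` without backtracking. -/
def Succ (d d' : T.Dart) : Prop := d.snd = d'.fst ∧ d.fst ≠ d'.snd

/-- A bi-infinite path without backtracking, given by its oriented edges. -/
def IsLine (D : ℤ → T.Dart) : Prop := ∀ i, Succ (D i) (D (i + 1))

theorem succ_iff_ne_symm {d d' : T.Dart} : Succ d d' ↔ d.snd = d'.fst ∧ d' ≠ d.symm := by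
  constructor
  · rintro ⟨h, h'⟩
    refine ⟨h, ?_⟩
    rintro rfl
    exact h' rfl
  · rintro ⟨h, h'⟩
    refine ⟨h, fun h2 => h' (SimpleGraph.Dart.ext _ _ (Prod.ext h.symm h2.symm))⟩

theorem Succ.smul {d d' : T.Dart} (h : Succ d d') (g : T ≃g T) : Succ (g • d) (g • d') :=
  ⟨congrArg g h.1, fun h2 => h.2 (g.injective h2)⟩

theorem dist_of_chain (hT : T.IsTree) (D : ℕ → T.Dart) (n : ℕ)
    (hD : ∀ i < n, Succ (D i) (D (i + 1))) :
    T.dist (D 0).fst (D n).fst = n ∧ T.dist (D 0).fst (D n).snd = n + 1 := by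
  induction n with
  | zero => simp
  | succ n ih =>
    obtain ⟨h1, h2⟩ := ih fun i hi => hD i (by omega)
    obtain ⟨h3, h4⟩ := hD n (by omega)
    have h5 : T.dist (D 0).fst (D (n + 1)).fst = n + 1 := by rw [← h3, h2]
    refine ⟨h5, ?_⟩
    have := dist_eq_add_one_of_ne hT (r := (D 0).fst) (v := (D (n + 1)).fst) (a := (D n).fst)
      (h3 ▸ (D n).adj) (D (n + 1)).adj (by omega) h4
    omega

theorem IsLine.dist_add (hT : T.IsTree) {D : ℤ → T.Dart} (hD : IsLine D) (i : ℤ) (n : ℕ) :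
    T.dist (D i).fst (D (i + n)).fst = n := by
  have := (dist_of_chain hT (fun k : ℕ => D (i + k)) n fun k _ => by
    have := hD (i + k)
    simpa [add_assoc] using this).1
  simpa using this

theorem IsLine.dist_eq (hT : T.IsTree) {D : ℤ → T.Dart} (hD : IsLine D) (i j : ℤ) :
    (T.dist (D i).fst (D j).fst : ℤ) = |j - i| := by
  rcases le_total i j with h | h
  · obtain ⟨n, rfl⟩ := Int.le.dest h
    rw [hD.dist_add hT]
    simp
  · obtain ⟨n, rfl⟩ := Int.le.dest h
    rw [SimpleGraph.dist_comm, hD.dist_add hT]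
    simp

theorem IsLine.fst_injective (hT : T.IsTree) {D : ℤ → T.Dart} (hD : IsLine D) {i j : ℤ}
    (h : (D i).fst = (D j).fst) : i = j := by
  have := hD.dist_eq hT i j
  rw [h, SimpleGraph.dist_self] at this
  have := abs_eq_zero.1 this.symm
  omega

theorem IsLine.snd_eq {D : ℤ → T.Dart} (hD : IsLine D) (i : ℤ) : (D i).snd = (D (i + 1)).fst :=
  (hD i).1

theorem IsLine.shift {D : ℤ → T.Dart} (hD : IsLine D) (j : ℤ) : IsLine fun i => D (i + j) := by
  intro i
  have := hD (i + j)
  rwa [add_right_comm] at this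

theorem IsLine.smul {D : ℤ → T.Dart} (hD : IsLine D) (g : T ≃g T) : IsLine fun i => g • D i :=
  fun i => (hD i).smul g

/-- A shift of a line is determined by one of its edges. -/
theorem IsLine.ext_fst {D : ℤ → T.Dart} {D' : ℤ → T.Dart} (hD : IsLine D) (hD' : IsLine D')
    (h : ∀ i, (D i).fst = (D' i).fst) : D = D' := by
  funext i
  refine SimpleGraph.Dart.ext _ _ (Prod.ext (h i) ?_)
  rw [hD.snd_eq, hD'.snd_eq, h]

end Lines

/-! ### Axes of hyperbolic elements -/

section Axes

variable {V : Type*} {T : SimpleGraph V}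

theorem edist_iso_le {V' : Type*} {T' : SimpleGraph V'} (ψ : T ≃g T') (a b : V) :
    T'.edist (ψ a) (ψ b) ≤ T.edist a b := by
  rw [SimpleGraph.edist_eq_sInf (u := a)]
  refine le_sInf ?_
  rintro _ ⟨p, rfl⟩
  have := SimpleGraph.edist_le (p.map ψ.toHom)
  rwa [SimpleGraph.Walk.length_map] at this

theorem dist_iso {V' : Type*} {T' : SimpleGraph V'} (ψ : T ≃g T') (a b : V) :
    T'.dist (ψ a) (ψ b) = T.dist a b := by
  refine congrArg ENat.toNat (le_antisymm (edist_iso_le ψ a b) ?_)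
  have := edist_iso_le ψ.symm (ψ a) (ψ b)
  rwa [ψ.symm_apply_apply, ψ.symm_apply_apply] at this

theorem dist_smul (g : T ≃g T) (a b : V) : T.dist (g • a) (g • b) = T.dist a b := dist_iso g a b

variable {Γ : Subgroup (T ≃g T)}

theorem dist_smul_subgroup (g : Γ) (a b : V) : T.dist (g • a) (g • b) = T.dist a b :=
  dist_smul (g : T ≃g T) a b

theorem smul_fst (g : Γ) (d : T.Dart) : (g • d).fst = g • d.fst := rfl

theorem smul_snd (g : Γ) (d : T.Dart) : (g • d).snd = g • d.snd := rfl

theorem Succ.smul_subgroup {d d' : T.Dart} (h : Succ d d') (g : Γ) : Succ (g • d) (g • d') :=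
  h.smul (g : T ≃g T)

/-- The group element `g` translates the line `D` by `n`. -/
def Translates (g : Γ) (D : ℤ → T.Dart) (n : ℤ) : Prop := ∀ i, g • D i = D (i + n)

theorem Translates.mul {g h : Γ} {D : ℤ → T.Dart} {m n : ℤ} (hg : Translates g D m)
    (hh : Translates h D n) : Translates (g * h) D (m + n) := by
  intro i
  rw [mul_smul, hh, hg]
  congr 1
  ring

theorem Translates.one (D : ℤ → T.Dart) : Translates (1 : Γ) D 0 := by
  intro i
  simp

theorem Translates.inv {g : Γ} {D : ℤ → T.Dart} {m : ℤ} (hg : Translates g D m) :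
    Translates g⁻¹ D (-m) := by
  intro i
  rw [inv_smul_eq_iff, hg]
  congr 1
  ring

theorem Translates.pow {g : Γ} {D : ℤ → T.Dart} {m : ℤ} (hg : Translates g D m) (k : ℕ) :
    Translates (g ^ k) D (k * m) := by
  induction k with
  | zero => simpa using Translates.one D
  | succ k ih =>
    rw [pow_succ]
    convert ih.mul hg using 1
    push_cast
    ring

theorem Translates.zpow {g : Γ} {D : ℤ → T.Dart} {m : ℤ} (hg : Translates g D m) (k : ℤ) :
    Translates (g ^ k) D (k * m) := by
  obtain ⟨n, rfl | rfl⟩ := k.eq_nat_or_neg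
  · simpa using hg.pow n
  · simpa using (hg.pow n).inv

theorem Translates.conj {g : Γ} {D : ℤ → T.Dart} {m : ℤ} (hg : Translates g D m) (h : Γ) :
    Translates (h * g * h⁻¹) (fun i => h • D i) m := by
  intro i
  simp only
  rw [smul_smul, inv_mul_cancel_right, mul_smul, hg]

theorem Translates.shift {g : Γ} {D : ℤ → T.Dart} {m : ℤ} (hg : Translates g D m) (j : ℤ) :
    Translates g (fun i => D (i + j)) m := by
  intro i
  simp only
  rw [hg]
  congr 1
  ring

theorem IsLine.smul_subgroup {D : ℤ → T.Dart} (hD : IsLine D) (g : Γ) :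
    IsLine fun i => g • D i := hD.smul (g : T ≃g T)

theorem Translates.unique (hT : T.IsTree) {D : ℤ → T.Dart} (hD : IsLine D) {g : Γ} {m n : ℤ}
    (hm : Translates g D m) (hn : Translates g D n) : m = n := by
  have h := (hm 0).symm.trans (hn 0)
  have := hD.fst_injective hT (congrArg (fun d : T.Dart => d.fst) h)
  omega

/-- The displacement of a vertex under a translation of a line: twice its distance to the line
plus the translation length. -/
theorem Translates.exists_dist_eq (hT : T.IsTree) {D : ℤ → T.Dart} (hD : IsLine D) {g : Γ} {n : ℕ}
    (hn : 1 ≤ n) (hg : Translates g D n) (v : V) :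
    ∃ i, T.dist v (g • v) = n + 2 * T.dist v (D i).fst := by
  obtain ⟨d, ⟨i, hi⟩, hmin⟩ := WellFounded.has_min (wellFounded_lt (α := ℕ))
    (Set.range fun i => T.dist v (D i).fst) ⟨_, 0, rfl⟩
  have hmin' : ∀ j, d ≤ T.dist v (D j).fst := fun j => not_lt.1 (hmin _ ⟨j, rfl⟩)
  simp only at hi
  refine ⟨i, ?_⟩
  rw [hi]
  have hg' : ∀ j, (D (j + n)).fst = g • (D j).fst := fun j =>
    (congrArg (fun d : T.Dart => d.fst) (hg j)).symm
  have e1 : T.dist v (D (i + 1)).fst = d + 1 := by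
    have hadj : T.Adj (D i).fst (D (i + 1)).fst := by
      rw [← hD.snd_eq]; exact (D i).adj
    have := hmin' (i + 1)
    rcases hT.dist_eq_dist_add_one_of_adj v hadj with h | h <;> omega
  have e2 : T.dist (g • v) (D (i + n)).fst = d := by
    rw [hg', dist_smul_subgroup, hi]
  have e3 : T.dist (g • v) (D (i + n - 1)).fst = d + 1 := by
    have hadj : T.Adj (D (i + n - 1)).fst (D (i + n)).fst := by
      have := (D (i + n - 1)).adj
      rw [hD.snd_eq, sub_add_cancel] at this
      exact this
    have h4 : (D (i + n - 1)).fst = g • (D (i - 1)).fst := by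
      rw [← hg', show i - 1 + n = i + n - 1 by ring]
    have := hmin' (i - 1)
    rw [← dist_smul_subgroup g, ← h4] at this
    rcases hT.dist_eq_dist_add_one_of_adj (g • v) hadj with h | h <;> omega
  have hd : ∀ j k : ℤ, T.dist (D j).fst (D k).fst = (k - j).natAbs := by
    intro j k
    have := hD.dist_eq hT j k
    rw [Int.abs_eq_natAbs] at this
    exact_mod_cast this
  have hadj1 : T.Adj (D (i + n)).fst (D (i + n - 1)).fst := by
    have := (D (i + n - 1)).adj
    rw [hD.snd_eq, sub_add_cancel] at this
    exact this.symm
  have hadj2 : T.Adj (D i).fst (D (i + 1)).fst := by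
    rw [← hD.snd_eq]; exact (D i).adj
  have e4 : T.dist (g • v) (D i).fst = d + n := by
    rw [dist_eq_add_of_separated hT hadj1 (by omega) (by rw [hd, hd]; omega), e3, hd]
    omega
  have e5 : T.dist (g • v) (D (i + 1)).fst = d + n - 1 := by
    rcases Nat.lt_or_ge 1 n with h1 | h1
    · rw [dist_eq_add_of_separated hT hadj1 (by omega) (by rw [hd, hd]; omega), e3, hd]
      omega
    · have : (i + 1 : ℤ) = i + n := by omega
      rw [this, e2]
      omega
  rw [dist_eq_add_of_separated hT hadj2 (by omega)
    (by rw [SimpleGraph.dist_comm, e4, SimpleGraph.dist_comm, e5]; omega), e1,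
    SimpleGraph.dist_comm, e5]
  omega

theorem Translates.le_dist (hT : T.IsTree) {D : ℤ → T.Dart} (hD : IsLine D) {g : Γ} {n : ℕ}
    (hn : 1 ≤ n) (hg : Translates g D n) (v : V) : n ≤ T.dist v (g • v) := by
  obtain ⟨i, hi⟩ := hg.exists_dist_eq hT hD hn v
  omega

theorem Translates.dist_fst (hT : T.IsTree) {D : ℤ → T.Dart} (hD : IsLine D) {g : Γ} {n : ℕ}
    (hg : Translates g D n) (i : ℤ) : T.dist (D i).fst (g • (D i).fst) = n := by
  rw [← smul_fst, hg, hD.dist_add hT]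

theorem Translates.isHyperbolic (hT : T.IsTree) {D : ℤ → T.Dart} (hD : IsLine D) {g : Γ} {n : ℕ}
    (hn : 1 ≤ n) (hg : Translates g D n) : IsHyperbolic V g := by
  intro v hv
  have := hg.le_dist hT hD hn v
  rw [hv, SimpleGraph.dist_self] at this
  omega

theorem Translates.translationLength_eq (hT : T.IsTree) {D : ℤ → T.Dart} (hD : IsLine D) {g : Γ}
    {n : ℕ} (hn : 1 ≤ n) (hg : Translates g D n) : translationLength T g = n := by
  refine le_antisymm (Nat.sInf_le ⟨(D 0).fst, hg.dist_fst hT hD 0⟩) ?_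
  refine le_csInf ⟨_, (D 0).fst, rfl⟩ ?_
  rintro _ ⟨v, rfl⟩
  exact hg.le_dist hT hD hn v

theorem Translates.axis_eq (hT : T.IsTree) {D : ℤ → T.Dart} (hD : IsLine D) {g : Γ}
    {n : ℕ} (hn : 1 ≤ n) (hg : Translates g D n) : axis T g = Set.range fun i => (D i).fst := by
  ext v
  rw [axis, Set.mem_ofPred_eq, hg.translationLength_eq hT hD hn]
  constructor
  · intro hv
    obtain ⟨i, hi⟩ := hg.exists_dist_eq hT hD hn v
    have : T.dist v (D i).fst = 0 := by omega
    rw [hT.connected.dist_eq_zero_iff] at this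
    exact ⟨i, this.symm⟩
  · rintro ⟨i, rfl⟩
    exact hg.dist_fst hT hD i

/-- A positive translation has only one line of translation, up to a shift. -/
theorem Translates.exists_shift (hT : T.IsTree) {D D' : ℤ → T.Dart} (hD : IsLine D)
    (hD' : IsLine D') {g : Γ} {n n' : ℕ} (hn : 1 ≤ n) (hg : Translates g D n) (hn' : 1 ≤ n')
    (hg' : Translates g D' n') : ∃ j, ∀ i, D' i = D (i + j) := by
  have hnn : n = n' :=
    (hg.translationLength_eq hT hD hn).symm.trans (hg'.translationLength_eq hT hD' hn')
  subst hnn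
  have hax : ∀ i, ∃ k, (D k).fst = (D' i).fst := by
    intro i
    have : (D' i).fst ∈ axis T g := by
      rw [hg'.axis_eq hT hD' hn']
      exact ⟨i, rfl⟩
    rwa [hg.axis_eq hT hD hn] at this
  choose k hk using hax
  have hstep : ∀ i, k (i + 1) = k i + 1 := by
    intro i
    have h1 : |k (i + 1) - k i| = 1 := by
      rw [← hD.dist_eq hT, hk, hk, ← hD'.snd_eq]
      simp
    have h2 : (T.dist (D' (i + 1)).fst (D' (i + n)).fst : ℤ) = |(i + n) - (i + 1)| :=
      hD'.dist_eq hT _ _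
    have h3 : (D' (i + n)).fst = (D (k i + n)).fst := by
      rw [← hg', smul_fst, ← hk, ← smul_fst, hg]
    rw [h3, ← hk (i + 1), hD.dist_eq hT] at h2
    rcases abs_eq (zero_le_one) |>.1 h1 with h | h
    · omega
    · rw [show k i + n - k (i + 1) = n + 1 by omega, show i + n - (i + 1) = (n : ℤ) - 1 by ring,
        abs_of_nonneg (by omega), abs_of_nonneg (by omega)] at h2
      omega
  have hall : ∀ i, k i = i + k 0 := by
    intro i
    induction i using Int.induction_on with
    | zero => simp
    | succ i ih => rw [hstep, ih]; ring
    | pred i ih =>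
      have := hstep (-i - 1)
      rw [sub_add_cancel] at this
      omega
  refine ⟨k 0, fun i => ?_⟩
  refine congrFun (hD'.ext_fst (hD.shift (k 0)) fun i => ?_) i
  rw [← hk, hall]

/-- A periodic continuation: a path without backtracking from an oriented edge `d` to `g • d`
extends to a line translated by `g`. -/
theorem exists_line_of_chain {g : Γ} {n : ℕ} (hn : 1 ≤ n) (L : ℕ → T.Dart)
    (hL : ∀ i < n, Succ (L i) (L (i + 1))) (hend : L n = g • L 0) :
    ∃ D : ℤ → T.Dart, IsLine D ∧ Translates g D n ∧ ∀ i ≤ n, D i = L i := by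
  have hn0 : (n : ℤ) ≠ 0 := by omega
  let D : ℤ → T.Dart := fun i => g ^ (i / n) • L (i % n).toNat
  have htr : Translates g D n := by
    intro i
    simp only [D]
    rw [Int.add_emod_right, Int.add_ediv_of_dvd_right (dvd_refl _), Int.ediv_self hn0,
      smul_smul, ← zpow_one_add, add_comm]
  have hlt : ∀ i : ℕ, i < n → D i = L i := by
    intro i hi
    simp only [D]
    rw [Int.ediv_eq_zero_of_lt (by omega) (by omega), Int.emod_eq_of_lt (by omega) (by omega)]
    simp
  have hle : ∀ i : ℕ, i ≤ n → D i = L i := by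
    intro i hi
    rcases hi.lt_or_eq with h | rfl
    · exact hlt i h
    · have := htr 0
      rw [zero_add] at this
      rw [← this, hend]
      congr 1
      exact hlt 0 (by omega)
  refine ⟨D, fun i => ?_, htr, hle⟩
  have h1 : ∀ j : ℤ, D j = g ^ (i / n) • D (j - n * (i / n)) := by
    intro j
    rw [htr.zpow]
    congr 1
    ring
  have h2 : i - n * (i / n) = (i % n).toNat := by
    rw [Int.toNat_of_nonneg (Int.emod_nonneg _ hn0), Int.emod_def]
  have h3 : (i % n).toNat < n := by
    have := Int.emod_lt_of_pos i (show (0 : ℤ) < n by omega)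
    omega
  rw [h1 i, h1 (i + 1), add_sub_right_comm, h2, hlt _ h3]
  have := hle ((i % n).toNat + 1) h3
  rw [Nat.cast_add, Nat.cast_one] at this
  rw [this]
  exact (hL _ h3).smul_subgroup _

theorem exists_geodesic (hT : T.IsTree) (a b : V) : ∃ x : ℕ → V, x 0 = a ∧ x (T.dist a b) = b ∧
    ∀ j ≤ T.dist a b, ∀ i ≤ j, T.dist (x i) (x j) = j - i := by
  obtain ⟨p, hp⟩ := hT.connected.exists_walk_length_eq_dist a b
  set n := T.dist a b with hn
  obtain ⟨x, hx0, hxn, hadj⟩ : ∃ x : ℕ → V, x 0 = a ∧ x n = b ∧ ∀ i < n, T.Adj (x i) (x (i + 1)) :=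
    ⟨p.getVert, by simp, by rw [← hp]; simp, fun i hi => p.adj_getVert_succ (by omega)⟩
  refine ⟨x, hx0, hxn, ?_⟩
  have hd : ∀ j ≤ n, ∀ i ≤ j, T.dist (x i) (x j) ≤ j - i := by
    intro j hj i hij
    induction j, hij using Nat.le_induction with
    | base => simp
    | succ j hij ih =>
      have h1 := ih (by omega)
      have h2 : T.dist (x i) (x (j + 1)) ≤ T.dist (x i) (x j) + T.dist (x j) (x (j + 1)) :=
        hT.connected.dist_triangle
      rw [SimpleGraph.dist_eq_one_iff_adj.2 (hadj j (by omega))] at h2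
      omega
  intro j hj i hij
  refine le_antisymm (hd j hj i hij) ?_
  have h1 : T.dist (x 0) (x n) ≤ T.dist (x 0) (x i) + T.dist (x i) (x n) :=
    hT.connected.dist_triangle
  have h2 : T.dist (x i) (x n) ≤ T.dist (x i) (x j) + T.dist (x j) (x n) :=
    hT.connected.dist_triangle
  have h3 := hd i (by omega) 0 (by omega)
  have h4 := hd n le_rfl j hj
  rw [hx0, hxn, ← hn] at h1
  rw [hx0] at h3
  rw [hxn] at h2 h4
  omega

/-- Tits' dichotomy: a fixed-point-free element of a group acting without inversions translates a
line, by its translation length. -/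
theorem IsHyperbolic.exists_line (hT : T.IsTree) (hΓ : ActsWithoutInversions Γ) {g : Γ}
    (hg : IsHyperbolic V g) :
    1 ≤ translationLength T g ∧ ∃ D : ℤ → T.Dart, IsLine D ∧
      Translates g D (translationLength T g) := by
  have : Nonempty V := hT.connected.nonempty
  obtain ⟨v, hv⟩ : ∃ v, T.dist v (g • v) = translationLength T g :=
    Nat.sInf_mem (s := Set.range fun x : V => T.dist x (g • x)) (Set.range_nonempty _)
  have hmin : ∀ x, translationLength T g ≤ T.dist x (g • x) := fun x => Nat.sInf_le ⟨x, rfl⟩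
  set n := translationLength T g with hn
  have hn1 : 1 ≤ n := by
    rw [← hv]
    exact hT.connected.pos_dist_of_ne (hg v).symm
  refine ⟨hn1, ?_⟩
  obtain ⟨x, hx0, hxn, hd'⟩ := exists_geodesic hT v (g • v)
  rw [hv] at hxn hd'
  have hadj : ∀ i < n, T.Adj (x i) (x (i + 1)) := fun i hi => by
    rw [← SimpleGraph.dist_eq_one_iff_adj, hd' (i + 1) hi i (Nat.le_succ i),
      Nat.add_sub_cancel_left]
  classical
  let L : ℕ → T.Dart := fun i =>
    if h : i < n then ⟨(x i, x (i + 1)), hadj i h⟩ else g • ⟨(x 0, x 1), hadj 0 (by omega)⟩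
  have hLlt : ∀ i (h : i < n), L i = ⟨(x i, x (i + 1)), hadj i h⟩ := fun i h => dif_pos h
  have hLn : L n = g • L 0 := by
    rw [hLlt 0 (by omega)]
    exact dif_neg (lt_irrefl n)
  obtain ⟨D, hD, hgD, -⟩ := exists_line_of_chain (g := g) hn1 L (by
    intro i hi
    rcases (show i + 1 ≤ n from hi).lt_or_eq with h | h
    · rw [hLlt i hi, hLlt (i + 1) h]
      refine ⟨rfl, fun h2 => ?_⟩
      have h3 := hd' (i + 2) h i (by omega)
      have h2 : x i = x (i + 2) := h2
      rw [← h2, SimpleGraph.dist_self] at h3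
      omega
    · rw [h, hLn, hLlt i hi, hLlt 0 (by omega)]
      refine ⟨by change x (i + 1) = g • x 0; rw [h, hxn, hx0], fun h2 => ?_⟩
      have h2 : x i = g • x 1 := h2
      rcases Nat.lt_or_ge 1 n with h1 | h1
      · have h4 := hmin (x 1)
        rw [← h2, hd' i (by omega) 1 (by omega)] at h4
        omega
      · have hi0 : i = 0 := by omega
        have hn' : n = 1 := by omega
        subst hi0
        apply hΓ g ⟨(x 0, x 1), hadj 0 (by omega)⟩
        refine SimpleGraph.Dart.ext _ _ (Prod.ext ?_ h2.symm)
        change g • x 0 = x 1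
        rw [hx0, ← hxn, hn']) hLn
  exact ⟨D, hD, hgD⟩

end Axes

/-! ### The group of translations of a line -/

section LineGroup

variable {V : Type*} {T : SimpleGraph V} {Γ : Subgroup (T ≃g T)}

theorem Translates.of_commute (hT : T.IsTree) {D : ℤ → T.Dart} (hD : IsLine D) {g h : Γ} {n : ℕ}
    (hn : 1 ≤ n) (hg : Translates g D n) (hgh : Commute g h) : ∃ j, Translates h D j := by
  have h1 := hg.conj h
  rw [← hgh.eq, mul_inv_cancel_right] at h1
  obtain ⟨j, hj⟩ := Translates.exists_shift hT hD (hD.smul_subgroup h) hn hg hn h1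
  exact ⟨j, hj⟩

theorem Translates.of_pow (hT : T.IsTree) {D : ℤ → T.Dart} (hD : IsLine D) {h : Γ} {n r : ℕ}
    (hn : 1 ≤ n) (hg : Translates (h ^ r) D n) : ∃ j : ℕ, Translates h D j ∧ r * j = n := by
  obtain ⟨j, hj⟩ := hg.of_commute hT hD hn (Commute.pow_self h r)
  have h1 := Translates.unique hT hD (hj.pow r) hg
  have h2 : 0 ≤ j := by
    by_contra h3
    have : (r : ℤ) * j ≤ 0 := mul_nonpos_of_nonneg_of_nonpos (by omega) (by omega)
    omega
  lift j to ℕ using h2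
  exact ⟨j, hj, by exact_mod_cast h1⟩

theorem Translates.fixes_iff {D : ℤ → T.Dart} (hD : IsLine D) {f : Γ} :
    Translates f D 0 ↔ ∀ i, f • (D i).fst = (D i).fst := by
  constructor
  · intro h i
    rw [← smul_fst, h, add_zero]
  · intro h i
    rw [add_zero]
    refine SimpleGraph.Dart.ext _ _ (Prod.ext (h i) ?_)
    have := h (i + 1)
    rw [← hD.snd_eq] at this
    exact this

theorem Translates.mem_axisCentralizer (hT : T.IsTree) {D : ℤ → T.Dart} (hD : IsLine D) {g : Γ}
    {n : ℕ} (hn : 1 ≤ n) (hg : Translates g D n) {f : Γ} :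
    f ∈ axisCentralizer T g ↔ Translates f D 0 ∧ Commute g f := by
  rw [axisCentralizer, Subgroup.mem_inf, hg.axis_eq hT hD hn,
    Subgroup.mem_centralizer_singleton_iff,
    mem_fixingSubgroup_iff, Translates.fixes_iff hD, Set.forall_mem_range]
  exact and_congr Iff.rfl ⟨fun h => h.symm, fun h => h.symm⟩

/-- The translations of a line form a group with a smallest positive translation. -/
theorem exists_minimal_translation {D : ℤ → T.Dart} {g : Γ} {n : ℕ}
    (hn : 1 ≤ n) (hg : Translates g D n) :
    ∃ (t : Γ) (m : ℕ), 1 ≤ m ∧ Translates t D m ∧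
      ∀ (h : Γ) (j : ℤ), Translates h D j → (m : ℤ) ∣ j := by
  classical
  have hex : ∃ m : ℕ, 1 ≤ m ∧ ∃ t : Γ, Translates t D m := ⟨n, hn, g, hg⟩
  obtain ⟨hm, t, ht⟩ := Nat.find_spec hex
  refine ⟨t, Nat.find hex, hm, ht, fun h j hj => ?_⟩
  set m := Nat.find hex with hmdef
  have h1 := (ht.zpow (-(j / m))).mul hj
  rw [show -(j / (m : ℤ)) * m + j = j % m by rw [Int.emod_def]; ring] at h1
  by_contra hdvd
  have h2 : 0 ≤ j % (m : ℤ) := Int.emod_nonneg _ (by omega)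
  have h3 : j % (m : ℤ) < m := Int.emod_lt_of_pos _ (by omega)
  have h4 : j % (m : ℤ) ≠ 0 := fun h => hdvd (Int.dvd_of_emod_eq_zero h)
  obtain ⟨r, hr⟩ : ∃ r : ℕ, j % (m : ℤ) = r := ⟨(j % (m : ℤ)).toNat, by omega⟩
  rw [hr] at h1 h2 h3 h4
  exact Nat.find_min hex (m := r) (by omega) ⟨by omega, _, h1⟩

theorem isPrimitiveHyperbolic_of_minimal (hT : T.IsTree) {D : ℤ → T.Dart} (hD : IsLine D) {t : Γ}
    {m : ℕ} (hm : 1 ≤ m) (ht : Translates t D m)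
    (hmin : ∀ (h : Γ) (j : ℤ), Translates h D j → (m : ℤ) ∣ j) : IsPrimitiveHyperbolic V t := by
  refine ⟨ht.isHyperbolic hT hD hm, ?_⟩
  rintro ⟨h, r, hr, rfl⟩
  obtain ⟨j, hj, hrj⟩ := Translates.of_pow hT hD hm ht
  have h1 := hmin h j hj
  rw [Int.natCast_dvd_natCast] at h1
  rcases Nat.eq_zero_or_pos j with rfl | hj0
  · omega
  · have := Nat.le_of_dvd hj0 h1
    nlinarith

variable (Γ) in
/-- Only the identity fixes an axis of `Γ` pointwise. -/
def AxisFree : Prop :=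
  ∀ (D : ℤ → T.Dart), IsLine D → ∀ (g : Γ) (n : ℕ), 1 ≤ n → Translates g D n →
    ∀ f : Γ, Translates f D 0 → f = 1

theorem finite_fixator (hfin : HasFiniteStabilizers Γ) (D : ℤ → T.Dart) :
    {f : Γ | Translates f D 0}.Finite := by
  have : Finite (MulAction.stabilizer Γ (D 0).fst) := hfin _
  refine Set.Finite.subset (Set.toFinite (MulAction.stabilizer Γ (D 0).fst : Set Γ)) ?_
  intro f hf
  have := congrArg (fun d : T.Dart => d.fst) (hf 0)
  rw [add_zero] at this
  exact this

/-- If the constant of central rigidity is one, then no nontrivial element fixes an axis. Let `F`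
be the fixator of the axis and `t` a smallest translation. By central rigidity, `F` acts on each
coset `t ^ k F` transitively by conjugation, hence freely, whereas some power of `t` commutes with
any given element of the finite group `F`. -/
theorem axisFree_of_isCentrallyRigid_one (hT : T.IsTree) (hfin : HasFiniteStabilizers Γ)
    (hc : IsCentrallyRigid Γ T 1) : AxisFree Γ := by
  intro D hD g n hn hg f₀ hf₀
  obtain ⟨t, m, hm, ht, hmin⟩ := exists_minimal_translation hn hg
  set F : Set Γ := {f : Γ | Translates f D 0} with hF
  have hFfin : F.Finite := finite_fixator hfin D
  have : Finite F := hFfin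
  have hFmul : ∀ {a b : Γ}, a ∈ F → b ∈ F → a * b ∈ F := fun ha hb => by
    have := Translates.mul ha hb
    rwa [add_zero] at this
  have hFinv : ∀ {a : Γ}, a ∈ F → a⁻¹ ∈ F := fun ha => by
    have := Translates.inv ha
    rwa [neg_zero] at this
  have hcomm : ∀ {a : Γ} {k : ℤ}, Translates a D k → ∀ f ∈ F, f * a * f⁻¹ * a⁻¹ ∈ F := by
    intro a k ha f hf
    have := ((Translates.mul hf ha).mul (Translates.inv hf)).mul ha.inv
    rwa [show (0 : ℤ) + k + -0 + -k = 0 by ring] at this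
  -- every element of the coset `t ^ k F` is conjugate to `t ^ k` under `F`
  have key : ∀ k : ℕ, 1 ≤ k → ∀ a : Γ, Translates a D (k * m : ℕ) →
      ∃ f ∈ F, a = f * t ^ k * f⁻¹ := by
    intro k
    induction k using Nat.strong_induction_on with
    | _ k ih =>
      intro hk a ha
      have hkm : 1 ≤ k * m := Nat.mul_pos hk hm
      by_cases hprim : IsPrimitiveHyperbolic V a
      · have htriv : ∀ f ∈ F, Commute a f → f = 1 := by
          intro f hf haf
          have h1 := hc a hprim
          rw [Nat.card_eq_one_iff_unique] at h1
          obtain ⟨h1, -⟩ := h1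
          have h2 := (ha.mem_axisCentralizer hT hD hkm).2 ⟨hf, haf⟩
          exact congrArg Subtype.val
            (h1.elim ⟨f, h2⟩ ⟨1, (axisCentralizer T a).one_mem⟩)
        let σ : F → F := fun f => ⟨(f : Γ) * a * (f : Γ)⁻¹ * a⁻¹, hcomm ha f f.2⟩
        have hinj : Function.Injective σ := by
          intro f f' h
          have h2 : (f : Γ) * a * (f : Γ)⁻¹ * a⁻¹ = f' * a * (f' : Γ)⁻¹ * a⁻¹ :=
            congrArg Subtype.val h
          have h3 : (f : Γ) * a * (f : Γ)⁻¹ = f' * a * (f' : Γ)⁻¹ := mul_right_cancel h2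
          have h4 : Commute a ((f' : Γ)⁻¹ * f) := by
            have : a * (f : Γ)⁻¹ = (f : Γ)⁻¹ * f' * a * (f' : Γ)⁻¹ := by
              rw [mul_assoc, mul_assoc, ← mul_assoc (f' : Γ), ← h3]
              group
            have h5 : a * ((f' : Γ)⁻¹ * f) = ((f' : Γ)⁻¹ * (f' * a * (f' : Γ)⁻¹)) * f := by group
            change a * ((f' : Γ)⁻¹ * f) = ((f' : Γ)⁻¹ * f) * a
            rw [h5, ← h3]
            group
          have h5 := htriv _ (hFmul (hFinv f'.2) f.2) h4
          exact Subtype.ext (inv_mul_eq_one.1 h5).symm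
        have hsurj := Finite.injective_iff_surjective.1 hinj
        have h1 : t ^ k * a⁻¹ ∈ F := by
          have := (ht.pow k).mul ha.inv
          rwa [show (k : ℤ) * m + -((k * m : ℕ) : ℤ) = 0 by push_cast; ring] at this
        obtain ⟨f, hf⟩ := hsurj ⟨_, h1⟩
        have h2 : (f : Γ) * a * (f : Γ)⁻¹ * a⁻¹ = t ^ k * a⁻¹ := congrArg Subtype.val hf
        refine ⟨(f : Γ)⁻¹, hFinv f.2, ?_⟩
        rw [← mul_right_cancel h2]
        group
      · have hex : ∃ (h : Γ) (r : ℕ), 1 < r ∧ a = h ^ r := by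
          by_contra h
          exact hprim ⟨ha.isHyperbolic hT hD hkm, h⟩
        obtain ⟨h, r, hr, rfl⟩ := hex
        obtain ⟨j, hj, hrj⟩ := Translates.of_pow hT hD hkm ha
        obtain ⟨j', rfl⟩ := Int.natCast_dvd_natCast.1 (hmin h j hj)
        have hrk : r * j' = k := by
          have : m * (r * j') = m * k := by rw [mul_comm m k, ← hrj]; ring
          exact Nat.eq_of_mul_eq_mul_left hm this
        have hj'0 : 1 ≤ j' := by
          rcases Nat.eq_zero_or_pos j' with rfl | h0
          · omega
          · exact h0
        rw [mul_comm m j'] at hj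
        obtain ⟨f, hf, hfe⟩ := ih j' (by nlinarith) hj'0 h hj
        refine ⟨f, hf, ?_⟩
        rw [hfe, conj_pow, ← pow_mul, mul_comm j', hrk]
  -- hence no nontrivial element of `F` commutes with `t ^ k`
  have hfree : ∀ k : ℕ, 1 ≤ k → ∀ f ∈ F, Commute (t ^ k) f → f = 1 := by
    intro k hk f hf hcf
    have htk : Translates (t ^ k) D (k * m : ℕ) := by
      have := ht.pow k
      rwa [← Nat.cast_mul] at this
    let σ : F → F := fun f => ⟨(f : Γ) * t ^ k * (f : Γ)⁻¹ * (t ^ k)⁻¹, hcomm htk f f.2⟩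
    have hsurj : Function.Surjective σ := by
      intro f'
      obtain ⟨f, hf, hfe⟩ := key k hk (f' * t ^ k) (by
        have := Translates.mul f'.2 htk
        rwa [zero_add] at this)
      refine ⟨⟨f, hf⟩, Subtype.ext ?_⟩
      change f * t ^ k * f⁻¹ * (t ^ k)⁻¹ = f'
      rw [← hfe, mul_inv_cancel_right]
    have hinj := Finite.injective_iff_surjective.2 hsurj
    have h1F : (1 : Γ) ∈ F := Translates.one D
    have : σ ⟨f, hf⟩ = σ ⟨1, h1F⟩ := by
      apply Subtype.ext
      change f * t ^ k * f⁻¹ * (t ^ k)⁻¹ = 1 * t ^ k * 1⁻¹ * (t ^ k)⁻¹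
      rw [← hcf.eq]
      group
    exact congrArg Subtype.val (hinj this)
  obtain ⟨i, j, hij, hcoll⟩ := Finite.exists_ne_map_eq_of_infinite (fun i : ℕ =>
    (⟨t ^ i * f₀ * (t ^ i)⁻¹, by
      have := ((ht.pow i).mul hf₀).mul (ht.pow i).inv
      rwa [show (i : ℤ) * m + 0 + -(i * m) = 0 by ring] at this⟩ : F))
  have hcoll' : t ^ i * f₀ * (t ^ i)⁻¹ = t ^ j * f₀ * (t ^ j)⁻¹ := congrArg Subtype.val hcoll
  have main : ∀ i j : ℕ, i < j → t ^ i * f₀ * (t ^ i)⁻¹ = t ^ j * f₀ * (t ^ j)⁻¹ → f₀ = 1 := by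
    intro i j hij h
    obtain ⟨k, rfl⟩ := Nat.exists_eq_add_of_lt hij
    refine hfree (k + 1) (by omega) f₀ hf₀ ?_
    rw [add_assoc, pow_add] at h
    have h2 : f₀ = t ^ (k + 1) * f₀ * (t ^ (k + 1))⁻¹ := by
      have h3 : t ^ i * f₀ * (t ^ i)⁻¹ =
          t ^ i * (t ^ (k + 1) * f₀ * (t ^ (k + 1))⁻¹) * (t ^ i)⁻¹ := by
        rw [h]; group
      exact mul_left_cancel (mul_right_cancel h3)
    change t ^ (k + 1) * f₀ = f₀ * t ^ (k + 1)
    nth_rewrite 2 [h2]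
    rw [inv_mul_cancel_right]
  rcases lt_or_gt_of_ne hij with h | h
  · exact main i j h hcoll'
  · exact main j i h hcoll'.symm

/-- An axis that is fixed by the identity only forces the constant of central rigidity to be
one. -/
theorem eq_one_of_trivial_fixator (hT : T.IsTree) {c : ℕ} (hc : IsCentrallyRigid Γ T c)
    {D : ℤ → T.Dart} (hD : IsLine D) {g : Γ} {n : ℕ} (hn : 1 ≤ n) (hg : Translates g D n)
    (htriv : ∀ f : Γ, Translates f D 0 → f = 1) : c = 1 := by
  obtain ⟨t, m, hm, ht, hmin⟩ := exists_minimal_translation hn hg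
  rw [← hc t (isPrimitiveHyperbolic_of_minimal hT hD hm ht hmin), Nat.card_eq_one_iff_unique]
  refine ⟨⟨fun a b => Subtype.ext ?_⟩, ⟨1⟩⟩
  rw [htriv _ ((ht.mem_axisCentralizer hT hD hm).1 a.2).1,
    htriv _ ((ht.mem_axisCentralizer hT hD hm).1 b.2).1]

end LineGroup

/-! ### Recurrence for tree lattices -/

section MassTransport

open scoped ENNReal

variable {G A B : Type*} [Group G] [MulAction G A] [MulAction G B]

theorem tsum_eq_tsum_orbits (hB : ∀ b : B, Finite (MulAction.stabilizer G b)) (F : B → ℝ≥0∞) :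
    ∑' b, F b = ∑' y : MulAction.orbitRel.Quotient G B,
      (Nat.card (MulAction.stabilizer G (Quotient.out y)) : ℝ≥0∞)⁻¹ *
        ∑' g : G, F (g • Quotient.out y) := by
  rw [← (MulAction.selfEquivSigmaOrbitsQuotientStabilizer G B).symm.tsum_eq F, ENNReal.tsum_sigma']
  refine tsum_congr fun y => ?_
  set b := Quotient.out y
  have : Finite (MulAction.stabilizer G b) := hB b
  rw [← (Subgroup.groupEquivQuotientProdSubgroup (s := MulAction.stabilizer G b)).symm.tsum_eq,
    ENNReal.tsum_prod']
  have h : ∀ (x : G ⧸ MulAction.stabilizer G b),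
      ∑' h : MulAction.stabilizer G b,
        F ((Subgroup.groupEquivQuotientProdSubgroup.symm (x, h) : G) • b) =
      Nat.card (MulAction.stabilizer G b) *
        F ((MulAction.selfEquivSigmaOrbitsQuotientStabilizer G B).symm ⟨y, x⟩) := by
    intro x
    have h1 : ∀ h : MulAction.stabilizer G b,
        F ((Subgroup.groupEquivQuotientProdSubgroup.symm (x, h) : G) • b) =
        F ((MulAction.selfEquivSigmaOrbitsQuotientStabilizer G B).symm ⟨y, x⟩) := by
      intro h
      congr 1
      set g := (Subgroup.groupEquivQuotientProdSubgroup.symm (x, h) : G) with hg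
      have h2 : x = (g : G ⧸ MulAction.stabilizer G b) := by
        have := Subgroup.groupEquivQuotientProdSubgroup.apply_symm_apply (x, h)
        rw [← hg] at this
        exact (congrArg Prod.fst this).symm
      rw [h2]
      rfl
    rw [tsum_congr h1, ENNReal.tsum_const, ENat.card_eq_coe_natCard]
    rfl
  rw [tsum_congr h, ENNReal.tsum_mul_left, ← mul_assoc, ENNReal.inv_mul_cancel, one_mul]
  · exact Nat.cast_ne_zero.2 Nat.card_pos.ne'
  · exact ENNReal.natCast_ne_top _

/-- The mass transport principle: an invariant transport of mass between two sets, counted per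
orbit with the inverse orders of the stabilizers, sends out as much as it brings in. -/
theorem mass_transport (hA : ∀ a : A, Finite (MulAction.stabilizer G a))
    (hB : ∀ b : B, Finite (MulAction.stabilizer G b)) (f : A → B → ℝ≥0∞)
    (hf : ∀ (g : G) a b, f (g • a) (g • b) = f a b) :
    ∑' x : MulAction.orbitRel.Quotient G A,
      (Nat.card (MulAction.stabilizer G (Quotient.out x)) : ℝ≥0∞)⁻¹ *
        ∑' b, f (Quotient.out x) b =
    ∑' y : MulAction.orbitRel.Quotient G B,
      (Nat.card (MulAction.stabilizer G (Quotient.out y)) : ℝ≥0∞)⁻¹ *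
        ∑' a, f a (Quotient.out y) := by
  simp_rw [tsum_eq_tsum_orbits (G := G) hB, tsum_eq_tsum_orbits (G := G) hA,
    ← ENNReal.tsum_mul_left]
  rw [ENNReal.tsum_comm]
  refine tsum_congr fun y => tsum_congr fun x => ?_
  rw [← (Equiv.inv G).tsum_eq]
  refine tsum_congr fun g => ?_
  rw [← hf g]
  simp only [Equiv.inv_apply, smul_smul, mul_inv_cancel, one_smul]
  ring

end MassTransport

section Recurrence

open scoped ENNReal

variable {V : Type*} {T : SimpleGraph V} {Γ : Subgroup (T ≃g T)}

theorem encard_setOf_succ [T.LocallyFinite] {q : ℕ} (hreg : T.IsRegularOfDegree (q + 1))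
    (d : T.Dart) : {d' | Succ d d'}.encard = q := by
  classical
  have hinj : Set.InjOn (fun d' : T.Dart => d'.snd) {d' | Succ d d'} := by
    intro a ha b hb h
    exact SimpleGraph.Dart.ext _ _ (Prod.ext (ha.1.symm.trans hb.1) h)
  rw [← hinj.encard_image]
  have : (fun d' : T.Dart => d'.snd) '' {d' | Succ d d'} =
      ((T.neighborFinset d.snd).erase d.fst : Finset V) := by
    ext v
    simp only [Set.mem_image, Finset.coe_erase, Set.mem_sdiff, Finset.mem_coe,
      SimpleGraph.mem_neighborFinset, Set.mem_singleton_iff]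
    constructor
    · rintro ⟨d', h, rfl⟩
      refine ⟨?_, fun h2 => h.2 h2.symm⟩
      rw [h.1]
      exact d'.adj
    · rintro ⟨h1, h2⟩
      exact ⟨⟨(d.snd, v), h1⟩, ⟨rfl, fun h => h2 h.symm⟩, rfl⟩
  rw [this, Set.encard_coe_eq_coe_finsetCard, Finset.card_erase_of_mem (by simpa using d.adj.symm),
    SimpleGraph.card_neighborFinset_eq_degree, hreg.degree_eq]
  simp

theorem encard_setOf_succ' [T.LocallyFinite] {q : ℕ} (hreg : T.IsRegularOfDegree (q + 1))
    (d : T.Dart) : {d' | Succ d' d}.encard = q := by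
  have hs : ∀ a b : T.Dart, Succ a b ↔ Succ b.symm a.symm := fun a b =>
    ⟨fun h => ⟨h.1.symm, h.2.symm⟩, fun h => ⟨h.1.symm, h.2.symm⟩⟩
  rw [← encard_setOf_succ hreg d.symm, ← SimpleGraph.Dart.symm_involutive.injective.encard_image]
  congr 1
  ext a
  constructor
  · rintro ⟨b, hb, rfl⟩
    exact (hs _ _).1 hb
  · intro ha
    exact ⟨a.symm, (hs _ _).2 (by simpa using ha), a.symm_symm⟩

theorem tsum_ite_eq_encard {α : Type*} (p : α → Prop) [DecidablePred p] :
    ∑' a, (if p a then (1 : ℝ≥0∞) else 0) = ({a | p a}.encard : ℝ≥0∞) := by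
  rw [← ENNReal.tsum_set_one, tsum_subtype {a | p a} (fun _ => (1 : ℝ≥0∞))]
  refine tsum_congr fun a => ?_
  simp [Set.indicator_apply]

theorem finite_dart_stabilizer (hfin : HasFiniteStabilizers Γ) (d : T.Dart) :
    Finite (MulAction.stabilizer Γ d) := by
  have : Finite (MulAction.stabilizer Γ d.fst) := hfin _
  have hle : MulAction.stabilizer Γ d ≤ MulAction.stabilizer Γ d.fst := fun g hg =>
    congrArg (fun d : T.Dart => d.fst) hg
  exact Finite.of_injective _ (Subgroup.inclusion_injective hle)

/-- The edges of the quotient of a tree by a tree lattice have finite total mass. -/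
theorem IsTreeLattice.tsum_edge_ne_top [T.LocallyFinite] {q : ℕ}
    (hreg : T.IsRegularOfDegree (q + 1)) (hlat : IsTreeLattice Γ) :
    ∑' x : QEdge Γ, (Nat.card (MulAction.stabilizer Γ (Quotient.out x)) : ℝ≥0∞)⁻¹ ≠ ∞ := by
  classical
  have h := mass_transport (G := Γ) (finite_dart_stabilizer hlat.1) hlat.1
    (fun (d : T.Dart) (v : V) => if d.fst = v then 1 else 0) (by
      intro g d v
      simp [smul_fst])
  have h1 : ∀ v : V, ∑' d : T.Dart, (if d.fst = v then (1 : ℝ≥0∞) else 0) = (q + 1 : ℕ) := by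
    intro v
    rw [tsum_ite_eq_encard]
    have hinj : Set.InjOn (fun d' : T.Dart => d'.snd) {d | d.fst = v} := by
      intro a ha b hb h
      exact SimpleGraph.Dart.ext _ _ (Prod.ext (Eq.trans ha (Eq.symm hb)) h)
    rw [← hinj.encard_image]
    have : (fun d' : T.Dart => d'.snd) '' {d | d.fst = v} = (T.neighborFinset v : Finset V) := by
      ext w
      simp only [Set.mem_image, Finset.mem_coe, SimpleGraph.mem_neighborFinset]
      constructor
      · rintro ⟨d', rfl, rfl⟩
        exact d'.adj
      · intro h
        exact ⟨⟨(v, w), h⟩, rfl, rfl⟩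
    rw [this, Set.encard_coe_eq_coe_finsetCard, SimpleGraph.card_neighborFinset_eq_degree,
      hreg.degree_eq]
    rfl
  have h3 : ∀ d : T.Dart, ∑' v : V, (if d.fst = v then (1 : ℝ≥0∞) else 0) = 1 := by
    intro d
    simp_rw [eq_comm (a := d.fst)]
    exact tsum_ite_eq _ _
  simp_rw [h1, h3, ENNReal.tsum_mul_right, mul_one] at h
  change ∑' x : MulAction.orbitRel.Quotient Γ T.Dart, _ ≠ ∞
  rw [h]
  refine ENNReal.mul_ne_top ?_ (ENNReal.natCast_ne_top _)
  have h2 := hlat.2.tsum_ofReal_ne_top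
  convert h2 using 4 with x
  have : Finite (MulAction.stabilizer Γ (Quotient.out x : V)) := hlat.1 _
  rw [one_div, ENNReal.ofReal_inv_of_pos (Nat.cast_pos.2 Nat.card_pos), ENNReal.ofReal_natCast]

/-- A set of oriented edges that is invariant under a tree lattice and closed under successors is
closed under predecessors: the two fluxes of its finite mass are equal. -/
theorem IsTreeLattice.mem_of_succ [T.LocallyFinite] {q : ℕ}
    (hreg : T.IsRegularOfDegree (q + 1)) (hlat : IsTreeLattice Γ) (S : Set T.Dart)
    (hS : ∀ (g : Γ) d, g • d ∈ S ↔ d ∈ S) (hsucc : ∀ d d', d ∈ S → Succ d d' → d' ∈ S)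
    {y y' : T.Dart} (hyy' : Succ y y') (hy' : y' ∈ S) : y ∈ S := by
  classical
  by_contra hy
  have h := mass_transport (G := Γ) (finite_dart_stabilizer hlat.1) (finite_dart_stabilizer hlat.1)
    (fun (a b : T.Dart) => if Succ a b ∧ b ∈ S then 1 else 0) (by
      intro g a b
      have h1 : Succ (g • a) (g • b) ↔ Succ a b := by
        refine ⟨fun h => ?_, fun h => h.smul_subgroup g⟩
        have := h.smul_subgroup g⁻¹
        rwa [inv_smul_smul, inv_smul_smul] at this
      simp only [h1, hS])
  have hin : ∀ b : T.Dart, ∑' a : T.Dart, (if Succ a b ∧ b ∈ S then (1 : ℝ≥0∞) else 0) =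
      if b ∈ S then (q : ℝ≥0∞) else 0 := by
    intro b
    split_ifs with hb
    · simp only [hb, and_true]
      rw [tsum_ite_eq_encard, encard_setOf_succ' hreg]
      rfl
    · simp [hb]
  have hout : ∀ a : T.Dart, (if a ∈ S then (q : ℝ≥0∞) else 0) +
      (if qEdge Γ a = qEdge Γ y then 1 else 0) ≤
        ∑' b : T.Dart, (if Succ a b ∧ b ∈ S then (1 : ℝ≥0∞) else 0) := by
    intro a
    split_ifs with ha hay hay
    · obtain ⟨g, rfl⟩ : ∃ g : Γ, g • y = a := Quotient.exact hay
      exact absurd ((hS g y).1 ha) hy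
    · have : ∀ b, (Succ a b ∧ b ∈ S) ↔ Succ a b := fun b =>
        ⟨fun h => h.1, fun h => ⟨h, hsucc a b ha h⟩⟩
      simp only [this]
      rw [tsum_ite_eq_encard, encard_setOf_succ hreg, add_zero]
      exact le_of_eq rfl
    · obtain ⟨g, rfl⟩ : ∃ g : Γ, g • y = a := Quotient.exact hay
      refine le_trans ?_ (ENNReal.le_tsum (g • y'))
      rw [if_pos ⟨hyy'.smul_subgroup g, (hS g y').2 hy'⟩, zero_add]
    · simp
  simp_rw [hin] at h
  have hle : ∑' x : QEdge Γ, (Nat.card (MulAction.stabilizer Γ (Quotient.out x)) : ℝ≥0∞)⁻¹ *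
      ((if Quotient.out x ∈ S then (q : ℝ≥0∞) else 0) +
        (if qEdge Γ (Quotient.out x) = qEdge Γ y then 1 else 0)) ≤
      ∑' x : QEdge Γ, (Nat.card (MulAction.stabilizer Γ (Quotient.out x)) : ℝ≥0∞)⁻¹ *
        (if Quotient.out x ∈ S then (q : ℝ≥0∞) else 0) := by
    refine le_trans (ENNReal.tsum_le_tsum fun x => ?_) (le_of_eq h)
    gcongr
    exact hout _
  simp_rw [mul_add] at hle
  rw [ENNReal.tsum_add] at hle
  have hfin : ∑' x : QEdge Γ, (Nat.card (MulAction.stabilizer Γ (Quotient.out x)) : ℝ≥0∞)⁻¹ *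
      (if Quotient.out x ∈ S then (q : ℝ≥0∞) else 0) ≠ ∞ := by
    refine ne_top_of_le_ne_top
      (ENNReal.mul_ne_top (hlat.tsum_edge_ne_top hreg) (ENNReal.natCast_ne_top q)) ?_
    rw [← ENNReal.tsum_mul_right]
    refine ENNReal.tsum_le_tsum fun x => ?_
    gcongr
    split_ifs <;> simp
  have hpos : ∑' x : QEdge Γ, (Nat.card (MulAction.stabilizer Γ (Quotient.out x)) : ℝ≥0∞)⁻¹ *
      (if qEdge Γ (Quotient.out x) = qEdge Γ y then 1 else 0) ≠ 0 := by
    intro h0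
    have := ENNReal.tsum_eq_zero.1 h0 (qEdge Γ y)
    have hq : qEdge Γ (Quotient.out (qEdge Γ y)) = qEdge Γ y := Quotient.out_eq _
    rw [if_pos hq, mul_one, ENNReal.inv_eq_zero] at this
    exact ENNReal.natCast_ne_top _ this
  exact absurd hle (not_le.2 (ENNReal.lt_add_right hfin hpos))

/-- Recurrence: for a tree lattice, every path without backtracking can be continued until it
meets a translate of its first edge. -/
theorem IsTreeLattice.recurrent [T.LocallyFinite] {q : ℕ}
    (hreg : T.IsRegularOfDegree (q + 1)) (hlat : IsTreeLattice Γ) {a b : T.Dart}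
    (hab : Relation.ReflTransGen Succ a b) : ∃ g : Γ, Relation.ReflTransGen Succ b (g • a) := by
  have hsmul : ∀ (g : Γ) {a b : T.Dart}, Relation.ReflTransGen Succ a b →
      Relation.ReflTransGen Succ (g • a) (g • b) := fun g a b h => by
    induction h with
    | refl => exact .refl
    | tail _ h2 ih => exact ih.tail (h2.smul_subgroup g)
  induction hab with
  | refl => exact ⟨1, by rw [one_smul]⟩
  | @tail b c _ hbc ih =>
    obtain ⟨g, hg⟩ := ih
    obtain ⟨h, hh⟩ : b ∈ {z | ∃ g : Γ, Relation.ReflTransGen Succ c (g • z)} := by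
      refine hlat.mem_of_succ hreg _ ?_ ?_ hbc ⟨1, by rw [one_smul]⟩
      · intro g d
        constructor
        · rintro ⟨h, hh⟩
          exact ⟨h * g, by rwa [mul_smul]⟩
        · rintro ⟨h, hh⟩
          exact ⟨h * g⁻¹, by rwa [mul_smul, inv_smul_smul]⟩
      · rintro d d' ⟨g, hg⟩ hd
        exact ⟨g, hg.tail (hd.smul_subgroup g)⟩
    exact ⟨h * g, by rw [mul_smul]; exact hh.trans (hsmul h hg)⟩

theorem exists_seq_of_reflTransGen {α : Type*} {r : α → α → Prop} {a b : α}
    (h : Relation.ReflTransGen r a b) :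
    ∃ (k : ℕ) (s : ℕ → α), s 0 = a ∧ s k = b ∧ ∀ i < k, r (s i) (s (i + 1)) := by
  classical
  induction h with
  | refl => exact ⟨0, fun _ => a, rfl, rfl, by simp⟩
  | @tail b c _ hbc ih =>
    obtain ⟨k, s, h0, hk, hs⟩ := ih
    refine ⟨k + 1, fun i => if i ≤ k then s i else c, by simp [h0], by simp, fun i hi => ?_⟩
    rcases Nat.lt_succ_iff_lt_or_eq.1 hi with h | rfl
    · simp only [if_pos h.le, if_pos (Nat.succ_le_of_lt h)]
      exact hs i h
    · simpa [hk] using hbc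

theorem reflTransGen_of_seq {α : Type*} {r : α → α → Prop} {s : ℕ → α} (n : ℕ)
    (hs : ∀ i < n, r (s i) (s (i + 1))) : Relation.ReflTransGen r (s 0) (s n) := by
  induction n with
  | zero => exact .refl
  | succ n ih => exact (ih fun i hi => hs i (by omega)).tail (hs n (by omega))

/-- For a tree lattice, every finite path without backtracking lies on an axis. -/
theorem IsTreeLattice.exists_line_extending [T.LocallyFinite] {q : ℕ}
    (hreg : T.IsRegularOfDegree (q + 1)) (hlat : IsTreeLattice Γ) {n : ℕ} (hn : 1 ≤ n)
    (L : ℕ → T.Dart) (hL : ∀ i < n, Succ (L i) (L (i + 1))) :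
    ∃ (D : ℤ → T.Dart) (g : Γ) (N : ℕ), IsLine D ∧ 1 ≤ N ∧ Translates g D N ∧
      ∀ i : ℕ, i ≤ n → D i = L i := by
  classical
  obtain ⟨g, hg⟩ := hlat.recurrent hreg (reflTransGen_of_seq n hL)
  obtain ⟨k, s, hs0, hsk, hs⟩ := exists_seq_of_reflTransGen hg
  let L' : ℕ → T.Dart := fun i => if i ≤ n then L i else s (i - n)
  have hL'1 : ∀ i ≤ n, L' i = L i := fun i hi => if_pos hi
  have hL'2 : ∀ i, L' (n + i) = s i := by
    intro i
    rcases Nat.eq_zero_or_pos i with rfl | h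
    · rw [hs0]
      exact hL'1 n le_rfl
    · simp only [L']
      rw [if_neg (by omega), Nat.add_sub_cancel_left]
  obtain ⟨D, hD, hgD, hDL⟩ := exists_line_of_chain (g := g) (n := n + k) (by omega) L' (by
    intro i hi
    rcases Nat.lt_or_ge i n with h | h
    · rw [hL'1 i h.le, hL'1 (i + 1) h]
      exact hL i h
    · obtain ⟨j, rfl⟩ := Nat.exists_eq_add_of_le h
      rw [add_assoc, hL'2, hL'2]
      exact hs j (by omega)) (by rw [hL'2, hsk, hL'1 0 (by omega)])
  exact ⟨D, g, n + k, hD, by omega, hgD, fun i hi => by rw [hDL i (by omega), hL'1 i hi]⟩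

/-- A path without backtracking that ends far out on a line can be prolonged backwards to start
at any given vertex. -/
theorem IsLine.exists_chain_from (hT : T.IsTree) {D : ℤ → T.Dart} (hD : IsLine D) (v : V) :
    ∃ (a j : ℕ), ∃ C : ℕ → T.Dart, (∀ i, Succ (C i) (C (i + 1))) ∧ (C 0).fst = v ∧
      ∀ i, C (a + i) = D (j + i : ℕ) := by
  classical
  obtain ⟨j, hj⟩ : ∃ j : ℕ, T.dist v (D j).snd = T.dist v (D j).fst + 1 := by
    by_contra hcon
    push Not at hcon
    have : ∀ j : ℕ, T.dist v (D j).fst + j ≤ T.dist v (D 0).fst := by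
      intro j
      induction j with
      | zero => simp
      | succ j ih =>
        have h1 := hcon j
        rcases hT.dist_eq_dist_add_one_of_adj v (D j).adj with h | h
        · rw [hD.snd_eq] at h
          push_cast
          omega
        · exact absurd h h1
    have := this (T.dist v (D 0).fst + 1)
    omega
  obtain ⟨x, hx0, hxa, hx⟩ := exists_geodesic hT v (D j).fst
  set a := T.dist v (D j).fst with ha
  have hadj : ∀ i < a, T.Adj (x i) (x (i + 1)) := fun i hi => by
    rw [← SimpleGraph.dist_eq_one_iff_adj, hx (i + 1) hi i (Nat.le_succ i), Nat.add_sub_cancel_left]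
  let C : ℕ → T.Dart := fun i =>
    if h : i < a then ⟨(x i, x (i + 1)), hadj i h⟩ else D (j + (i - a) : ℕ)
  have hC1 : ∀ i (h : i < a), C i = ⟨(x i, x (i + 1)), hadj i h⟩ := fun i h => dif_pos h
  have hC2 : ∀ i, C (a + i) = D (j + i : ℕ) := by
    intro i
    simp only [C]
    rw [dif_neg (by omega), Nat.add_sub_cancel_left]
  refine ⟨a, j, C, fun i => ?_, ?_, hC2⟩
  · rcases Nat.lt_or_ge i a with h | h
    · rcases (show i + 1 ≤ a from h).lt_or_eq with h' | h'
      · rw [hC1 i h, hC1 (i + 1) h']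
        refine ⟨rfl, fun h2 => ?_⟩
        have h3 := hx (i + 2) h' i (by omega)
        have h2 : x i = x (i + 2) := h2
        rw [← h2, SimpleGraph.dist_self] at h3
        omega
      · have h4 := hC2 0
        rw [add_zero, add_zero] at h4
        have h5 : C (i + 1) = D j := by rw [h', h4]
        rw [hC1 i h, h5]
        refine ⟨by change x (i + 1) = _; rw [h', hxa], fun h2 => ?_⟩
        have h2 : x i = (D j).snd := h2
        have h3 := hx i h.le 0 (by omega)
        rw [hx0, h2, hj] at h3
        omega
    · obtain ⟨k, rfl⟩ := Nat.exists_eq_add_of_le h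
      rw [add_assoc, hC2, hC2]
      exact_mod_cast hD (j + k)
  · rcases Nat.eq_zero_or_pos a with h | h
    · have h4 := hC2 0
      rw [h, add_zero, add_zero] at h4
      rw [h4]
      rw [h] at ha
      exact ((hT.connected.dist_eq_zero_iff).1 ha.symm).symm
    · rw [hC1 0 h]
      exact hx0

/-- If a tree lattice has an axis, then it has an axis that only the identity fixes pointwise:
a finite path whose fixator is as small as possible has a trivial fixator. -/
theorem IsTreeLattice.exists_trivial_fixator (hT : T.IsTree) [T.LocallyFinite] {q : ℕ}
    (hreg : T.IsRegularOfDegree (q + 1)) (hlat : IsTreeLattice Γ) {D₀ : ℤ → T.Dart}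
    (hD₀ : IsLine D₀) :
    ∃ (D : ℤ → T.Dart) (g : Γ) (N : ℕ), IsLine D ∧ 1 ≤ N ∧ Translates g D N ∧
      ∀ f : Γ, Translates f D 0 → f = 1 := by
  classical
  let Fix : (ℕ → T.Dart) → ℕ → Set Γ := fun L n => {f | ∀ i ≤ n, f • L i = L i}
  have hFixfin : ∀ L n, (Fix L n).Finite := by
    intro L n
    have : Finite (MulAction.stabilizer Γ (L 0)) := finite_dart_stabilizer hlat.1 _
    refine Set.Finite.subset (Set.toFinite (MulAction.stabilizer Γ (L 0) : Set Γ)) ?_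
    intro f hf
    exact hf 0 (Nat.zero_le n)
  obtain ⟨_, ⟨L, n, hn, hL, rfl⟩, hmin⟩ := WellFounded.has_min (wellFounded_lt (α := ℕ))
    {k | ∃ (L : ℕ → T.Dart) (n : ℕ), 1 ≤ n ∧ (∀ i < n, Succ (L i) (L (i + 1))) ∧
      (Fix L n).ncard = k}
    ⟨_, fun i => D₀ i, 1, le_rfl, fun i _ => by simpa using hD₀ i, rfl⟩
  have hmin' : ∀ (L' : ℕ → T.Dart) (n' : ℕ), 1 ≤ n' → (∀ i < n', Succ (L' i) (L' (i + 1))) →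
      (Fix L n).ncard ≤ (Fix L' n').ncard := fun L' n' h1 h2 =>
    not_lt.1 (hmin _ ⟨L', n', h1, h2, rfl⟩)
  obtain ⟨D, g, N, hD, hN, hgD, hDL⟩ := hlat.exists_line_extending hreg hn L hL
  refine ⟨D, g, N, hD, hN, hgD, ?_⟩
  have hDchain : ∀ (j : ℕ) (i : ℕ), Succ (D (j + i : ℕ)) (D (j + (i + 1) : ℕ)) := by
    intro j i
    exact_mod_cast hD (j + i : ℕ)
  have hsub : ∀ f : Γ, f ∈ Fix L n → f = 1 := by
    intro f hf
    by_contra hf1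
    obtain ⟨v, hv⟩ : ∃ v : V, f • v ≠ v := by
      by_contra hcon
      push Not at hcon
      exact hf1 (Subtype.ext (RelIso.ext fun v => hcon v))
    obtain ⟨a, j, C, hC, hC0, hCD⟩ := hD.exists_chain_from hT v
    -- the translate of the path by `g ^ j` has the same fixator, since both contain the fixator
    -- of a longer path, which is no smaller
    have hsame : Fix (fun i => D (j * N + i : ℕ)) n ⊆ Fix L n := by
      have hconj : ∀ h : Γ, h ∈ Fix (fun i => D (j * N + i : ℕ)) n ↔
          (g ^ j)⁻¹ * h * g ^ j ∈ Fix L n := by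
        intro h
        refine forall_congr' fun i => forall_congr' fun hi => ?_
        rw [← hDL i hi, mul_smul, mul_smul, inv_smul_eq_iff, hgD.pow j]
        have : (i : ℤ) + j * N = (j * N + i : ℕ) := by push_cast; ring
        rw [this]
      have hcard : (Fix (fun i => D (j * N + i : ℕ)) n).ncard = (Fix L n).ncard := by
        have : Fix L n =
            (fun h => (g ^ j)⁻¹ * h * g ^ j) '' Fix (fun i => D (j * N + i : ℕ)) n := by
          ext h
          constructor
          · intro hh
            refine ⟨g ^ j * h * (g ^ j)⁻¹, (hconj _).2 ?_, ?_⟩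
            · convert hh using 1
              group
            · simp only
              group
          · rintro ⟨h', hh', rfl⟩
            exact (hconj _).1 hh'
        rw [this, Set.ncard_image_of_injective]
        intro x y hxy
        simpa using hxy
      have hbig1 : Fix (fun i => D (i : ℕ)) (j * N + n) ⊆ Fix L n := by
        intro h hh i hi
        rw [← hDL i hi]
        exact hh i (by omega)
      have hbig2 : Fix (fun i => D (i : ℕ)) (j * N + n) ⊆ Fix (fun i => D (j * N + i : ℕ)) n := by
        intro h hh i hi
        exact hh (j * N + i) (by omega)
      have hbig := hmin' (fun i => D (i : ℕ)) (j * N + n) (by omega) fun i _ => by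
        simpa using hDchain 0 i
      rw [← Set.eq_of_subset_of_ncard_le hbig2 (hcard.trans_le hbig) (hFixfin _ _)]
      exact hbig1
    have hCsub : Fix C (a + j * N + n) ⊆ Fix L n := by
      refine Set.Subset.trans ?_ hsame
      intro h hh i hi
      have h1 : j ≤ j * N := Nat.le_mul_of_pos_right j hN
      have h2 := hh (a + (j * N - j + i)) (by omega)
      rw [hCD] at h2
      have h3 : j + (j * N - j + i) = j * N + i := by omega
      rwa [h3] at h2
    have hCeq := Set.eq_of_subset_of_ncard_le hCsub
      (hmin' C (a + j * N + n) (by omega) fun i _ => hC i) (hFixfin _ _)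
    rw [← hCeq] at hf
    have := congrArg (fun d : T.Dart => d.fst) (hf 0 (Nat.zero_le _))
    apply hv
    rw [← hC0]
    exact this
  intro f hf
  refine hsub f fun i hi => ?_
  rw [← hDL i hi, hf, add_zero]

end Recurrence

/-! ### The structure theorem of Bass and Serre -/

namespace QuotientChoice

variable {V : Type u} {T : SimpleGraph V} {Γ : Subgroup (T ≃g T)} {hΓ : ActsWithoutInversions Γ}
  (D : QuotientChoice Γ hΓ)

/-- The quotient graph. -/
abbrev graph (_ : QuotientChoice Γ hΓ) : OrientedGraph (QVertex Γ) (QEdge Γ) := quotientGraph Γ hΓ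

/-- The fundamental group of the quotient graph of groups. -/
abbrev Pi : Type u := D.graphOfGroups.Pi1 D.R

/-- The values of the homomorphism to `Γ` on the generators of the fundamental group. -/
def genVal : D.graphOfGroups.Gen → Γ
  | Sum.inl ⟨x, a⟩ => (show MulAction.stabilizer Γ (D.y x) from a).1
  | Sum.inr e => D.k (D.graph.inv e) * (D.k e)⁻¹

theorem lift_vLetter (x : QVertex Γ) (a : D.graphOfGroups.Gv x) :
    FreeGroup.lift D.genVal (D.graphOfGroups.vLetter x a) =
      (show MulAction.stabilizer Γ (D.y x) from a).1 := FreeGroup.lift_apply_of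

theorem lift_eLetter (e : QEdge Γ) : FreeGroup.lift D.genVal (D.graphOfGroups.eLetter e) =
    D.k (D.graph.inv e) * (D.k e)⁻¹ := FreeGroup.lift_apply_of

theorem lift_rels : ∀ r ∈ D.graphOfGroups.rels D.R, FreeGroup.lift D.genVal r = 1 := by
  rintro r (((⟨x, a, b, rfl⟩ | ⟨e, g, rfl⟩) | ⟨e, rfl⟩) | ⟨e, he, rfl⟩)
  · rw [map_mul, map_inv, map_mul, lift_vLetter, lift_vLetter, lift_vLetter, mul_inv_eq_one]
    rfl
  · rw [map_mul, map_inv, map_mul, map_mul, map_inv, lift_vLetter, lift_vLetter, lift_eLetter]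
    obtain ⟨g, hg⟩ := (show MulAction.stabilizer Γ (D.f e) from g)
    change D.k (D.graph.inv e) * (D.k e)⁻¹ * (D.k e * g * (D.k e)⁻¹) *
      (D.k (D.graph.inv e) * (D.k e)⁻¹)⁻¹ *
      (D.k (D.graph.inv e) * g * (D.k (D.graph.inv e))⁻¹)⁻¹ = 1
    group
  · rw [map_mul, lift_eLetter, lift_eLetter, D.graph.inv_inv]
    group
  · rw [lift_eLetter, D.k_eq_one e he, D.k_eq_one _ (D.isMaximalSubtree.1 e he)]
    group

/-- The canonical homomorphism from the fundamental group of the quotient graph of groups. -/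
def toGroup : D.Pi →* Γ := PresentedGroup.toGroup D.lift_rels

theorem toGroup_vertexHom (x : QVertex Γ) (a : D.graphOfGroups.Gv x) :
    D.toGroup (D.graphOfGroups.vertexHom D.R x a) =
      (show MulAction.stabilizer Γ (D.y x) from a).1 := D.lift_vLetter x a

theorem exists_toGroup_vertexHom_eq {x : QVertex Γ} {g : Γ}
    (hg : g ∈ MulAction.stabilizer Γ (D.y x)) :
    ∃ a, D.toGroup (D.graphOfGroups.vertexHom D.R x a) = g :=
  ⟨(show D.graphOfGroups.Gv x from ⟨g, hg⟩), D.toGroup_vertexHom _ _⟩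

theorem toGroup_edgeElt (e : QEdge Γ) : D.toGroup (D.graphOfGroups.edgeElt D.R e) =
    D.k (D.graph.inv e) * (D.k e)⁻¹ := D.lift_eLetter e

theorem k_spec' (e : QEdge Γ) : D.k (D.graph.inv e) • (D.f e).fst = D.y (D.graph.src e) := by
  have := D.k_spec (D.graph.inv e)
  rw [D.f_inv, ← D.graph.src_eq] at this
  exact this

theorem edgeElt_inv (e : QEdge Γ) : D.graphOfGroups.edgeElt D.R (D.graph.inv e) =
    (D.graphOfGroups.edgeElt D.R e)⁻¹ := by
  have h : D.graphOfGroups.edgeElt D.R (D.graph.inv e) * D.graphOfGroups.edgeElt D.R e = 1 := by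
    unfold GraphOfGroups.edgeElt
    rw [← map_mul]
    exact PresentedGroup.one_of_mem (Or.inl (Or.inr ⟨e, rfl⟩))
  exact eq_inv_of_mul_eq_one_left h

theorem edgeElt_of_mem {e : QEdge Γ} (he : e ∈ D.R) : D.graphOfGroups.edgeElt D.R e = 1 :=
  PresentedGroup.one_of_mem (Or.inr ⟨e, he, rfl⟩)

theorem edgeElt_rel (e : QEdge Γ) (g : D.graphOfGroups.Ge e) :
    D.graphOfGroups.vertexHom D.R _ (D.graphOfGroups.φ (D.graph.inv e)
      (D.graphOfGroups.flip rfl g)) * D.graphOfGroups.edgeElt D.R e =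
    D.graphOfGroups.edgeElt D.R e * D.graphOfGroups.vertexHom D.R _ (D.graphOfGroups.φ e g) := by
  have h : D.graphOfGroups.edgeElt D.R e *
      D.graphOfGroups.vertexHom D.R _ (D.graphOfGroups.φ e g) *
      (D.graphOfGroups.edgeElt D.R e)⁻¹ * (D.graphOfGroups.vertexHom D.R _
        (D.graphOfGroups.φ (D.graph.inv e) (D.graphOfGroups.flip rfl g)))⁻¹ = 1 :=
    PresentedGroup.one_of_mem (rels := D.graphOfGroups.rels D.R)
      (Or.inl (Or.inl (Or.inr ⟨e, g, rfl⟩)))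
  rw [mul_inv_eq_one] at h
  rw [← h, inv_mul_cancel_right]

/-- The vertices of the universal covering tree. -/
abbrev Cover : Type u := D.graphOfGroups.CoverVertex D.R

/-- The coset `γ G_x`. -/
def coset (x : QVertex Γ) (γ : D.Pi) : D.Cover :=
  ⟨x, (γ : D.Pi ⧸ (D.graphOfGroups.vertexHom D.R x).range)⟩

theorem exists_coset (a : D.Cover) : ∃ x γ, a = D.coset x γ := by
  obtain ⟨x, γ⟩ := a
  obtain ⟨γ, rfl⟩ := Quotient.exists_rep γ
  exact ⟨x, γ, rfl⟩

theorem coset_eq (x : QVertex Γ) (γ γ' : D.Pi) : D.coset x γ = D.coset x γ' ↔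
    ∃ a : D.graphOfGroups.Gv x, γ' = γ * D.graphOfGroups.vertexHom D.R x a := by
  unfold coset
  rw [Sigma.mk.injEq]
  simp only [heq_eq_eq, true_and]
  rw [QuotientGroup.eq]
  constructor
  · rintro ⟨a, ha⟩
    exact ⟨a, by rw [ha, mul_inv_cancel_left]⟩
  · rintro ⟨a, rfl⟩
    exact ⟨a, by rw [inv_mul_cancel_left]⟩

theorem smul_coset (g : D.Pi) (x : QVertex Γ) (γ : D.Pi) : g • D.coset x γ = D.coset x (g * γ) :=
  rfl

/-- The projection of the universal covering tree to the tree on which `Γ` acts. -/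
def proj (a : D.Cover) : V :=
  Quotient.liftOn' a.2 (fun γ => D.toGroup γ • D.y a.1) (by
    intro γ γ' h
    rw [QuotientGroup.leftRel_apply] at h
    obtain ⟨b, hb⟩ := h
    have hb' : γ' = γ * D.graphOfGroups.vertexHom D.R a.1 b := by rw [hb, mul_inv_cancel_left]
    rw [hb', map_mul, toGroup_vertexHom, mul_smul]
    congr 1
    exact (show MulAction.stabilizer Γ (D.y a.1) from b).2.symm)

theorem proj_coset (x : QVertex Γ) (γ : D.Pi) : D.proj (D.coset x γ) = D.toGroup γ • D.y x := rfl

theorem proj_smul (g : D.Pi) (a : D.Cover) : D.proj (g • a) = D.toGroup g • D.proj a := by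
  obtain ⟨x, γ, rfl⟩ := D.exists_coset a
  rw [smul_coset, proj_coset, proj_coset, map_mul, mul_smul]

/-- `b` is the end of an edge of the universal cover with origin `a`. -/
def EdgeRel (a b : D.Cover) : Prop := ∃ (e : QEdge Γ) (γ : D.Pi),
  a = D.coset (D.graph.src e) γ ∧
    b = D.coset (D.graph.tgt e) (γ * D.graphOfGroups.edgeElt D.R e)

theorem EdgeRel.symm {D : QuotientChoice Γ hΓ} {a b : D.Cover} (h : D.EdgeRel a b) :
    D.EdgeRel b a := by
  obtain ⟨e, γ, rfl, rfl⟩ := h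
  refine ⟨D.graph.inv e, γ * D.graphOfGroups.edgeElt D.R e, ?_, ?_⟩
  · rw [D.graph.src_eq, D.graph.inv_inv]
  · rw [edgeElt_inv, mul_inv_cancel_right, D.graph.src_eq]

theorem coverTree_adj (a b : D.Cover) :
    (D.graphOfGroups.coverTree D.R).Adj a b ↔ a ≠ b ∧ D.EdgeRel a b := by
  unfold GraphOfGroups.coverTree
  rw [SimpleGraph.fromRel_adj]
  exact and_congr_right fun _ => ⟨fun h => h.elim id EdgeRel.symm, Or.inl⟩

theorem EdgeRel.proj_eq {D : QuotientChoice Γ hΓ} {a b : D.Cover} (e : QEdge Γ) (γ : D.Pi)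
    (ha : a = D.coset (D.graph.src e) γ)
    (hb : b = D.coset (D.graph.tgt e) (γ * D.graphOfGroups.edgeElt D.R e)) :
    D.proj a = ((D.toGroup γ * D.k (D.graph.inv e)) • D.f e).fst ∧
      D.proj b = ((D.toGroup γ * D.k (D.graph.inv e)) • D.f e).snd := by
  subst ha hb
  rw [proj_coset, proj_coset, map_mul, toGroup_edgeElt, smul_fst, smul_snd]
  constructor
  · rw [mul_smul, k_spec']
  · rw [← D.k_spec e, smul_smul]
    congr 1
    group

theorem EdgeRel.adj {D : QuotientChoice Γ hΓ} {a b : D.Cover} (h : D.EdgeRel a b) :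
    T.Adj (D.proj a) (D.proj b) := by
  obtain ⟨e, γ, ha, hb⟩ := h
  obtain ⟨h1, h2⟩ := EdgeRel.proj_eq e γ ha hb
  rw [h1, h2]
  exact (_ : T.Dart).adj

theorem EdgeRel.coverTree_adj {D : QuotientChoice Γ hΓ} {a b : D.Cover} (h : D.EdgeRel a b) :
    (D.graphOfGroups.coverTree D.R).Adj a b := by
  rw [QuotientChoice.coverTree_adj]
  refine ⟨?_, h⟩
  rintro rfl
  exact h.adj.ne rfl

/-- The projection is injective on the neighbours of a vertex. -/
theorem EdgeRel.eq_of_proj_eq {D : QuotientChoice Γ hΓ} {a b b' : D.Cover} (h : D.EdgeRel a b)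
    (h' : D.EdgeRel a b') (hbb' : D.proj b = D.proj b') : b = b' := by
  obtain ⟨e, γ, ha, hb⟩ := h
  obtain ⟨e', γ', ha', hb'⟩ := h'
  obtain ⟨h1, h2⟩ := EdgeRel.proj_eq e γ ha hb
  obtain ⟨h1', h2'⟩ := EdgeRel.proj_eq e' γ' ha' hb'
  have hd : (D.toGroup γ * D.k (D.graph.inv e)) • D.f e =
      (D.toGroup γ' * D.k (D.graph.inv e')) • D.f e' :=
    SimpleGraph.Dart.ext _ _ (Prod.ext (h1.symm.trans h1') (h2.symm.trans (hbb'.trans h2')))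
  have hee' : e = e' := by
    rw [← D.f_spec e, ← D.f_spec e']
    refine Quotient.sound ⟨(D.toGroup γ * D.k (D.graph.inv e))⁻¹ *
      (D.toGroup γ' * D.k (D.graph.inv e')), ?_⟩
    simp only
    rw [mul_smul, ← hd, inv_smul_smul]
  subst hee'
  rw [ha, coset_eq] at ha'
  obtain ⟨c, hc⟩ := ha'
  let g : Γ := (D.toGroup γ * D.k (D.graph.inv e))⁻¹ * (D.toGroup γ' * D.k (D.graph.inv e))
  have hg : g ∈ MulAction.stabilizer Γ (D.f e) := by
    rw [MulAction.mem_stabilizer_iff, mul_smul, ← hd, inv_smul_smul]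
  have hval : (show MulAction.stabilizer Γ (D.y (D.graph.src e)) from c).1 =
      D.k (D.graph.inv e) * g * (D.k (D.graph.inv e))⁻¹ := by
    rw [← D.toGroup_vertexHom, ← mul_right_inj (D.toGroup γ), ← map_mul, ← hc]
    simp only [g]
    group
  have hγ' : γ' = γ * D.graphOfGroups.vertexHom D.R _ (D.graphOfGroups.φ (D.graph.inv e)
      (D.graphOfGroups.flip rfl (show D.graphOfGroups.Ge e from ⟨g, hg⟩))) := by
    rw [hc]
    congr 1
    have key : ∀ (x x' : QVertex Γ) (hx : x = x') (c : D.graphOfGroups.Gv x)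
        (c' : D.graphOfGroups.Gv x')
        (_ : (show MulAction.stabilizer Γ (D.y x) from c).1 =
          (show MulAction.stabilizer Γ (D.y x') from c').1),
        D.graphOfGroups.vertexHom D.R x c = D.graphOfGroups.vertexHom D.R x' c' := by
      rintro x _ rfl c c' h
      exact congrArg _ (Subtype.ext h)
    exact key _ _ (D.graph.src_eq e) _ _ hval
  rw [hb, hb', coset_eq]
  refine ⟨D.graphOfGroups.φ e ⟨g, hg⟩, ?_⟩
  rw [hγ', mul_assoc, edgeElt_rel, mul_assoc]

theorem coverTree_reachable_base (x x' : QVertex Γ) (γ : D.Pi) :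
    (D.graphOfGroups.coverTree D.R).Reachable (D.coset x γ) (D.coset x' γ) := by
  obtain ⟨l, ⟨hl, -, hlR⟩, -⟩ := D.isMaximalSubtree.2 x x'
  induction l generalizing x with
  | nil =>
    obtain rfl : x = x' := hl
    exact .refl _
  | cons e l ih =>
    obtain ⟨rfl, hl⟩ := hl
    refine SimpleGraph.Reachable.trans (SimpleGraph.Adj.reachable (EdgeRel.coverTree_adj
      ⟨e, γ, rfl, ?_⟩)) (ih _ hl fun e he => hlR e (List.mem_cons_of_mem _ he))
    rw [D.edgeElt_of_mem (hlR e List.mem_cons_self), mul_one]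

theorem coverTree_reachable_mul (x : QVertex Γ) (g γ : D.Pi) :
    (D.graphOfGroups.coverTree D.R).Reachable (D.coset x γ) (D.coset x (γ * g)) := by
  have hbase := D.coverTree_reachable_base
  let K : Subgroup D.Pi :=
    { carrier := {g | ∀ γ, (D.graphOfGroups.coverTree D.R).Reachable (D.coset x γ)
        (D.coset x (γ * g))}
      mul_mem' := fun {a b} ha hb γ => by
        rw [← mul_assoc]
        exact (ha γ).trans (hb (γ * a))
      one_mem' := fun γ => by rw [mul_one]
      inv_mem' := fun {a} ha γ => by
        have := ha (γ * a⁻¹)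
        rw [inv_mul_cancel_right] at this
        exact this.symm }
  have hK : K = ⊤ := by
    rw [eq_top_iff, ← PresentedGroup.closure_range_of (D.graphOfGroups.rels D.R),
      Subgroup.closure_le]
    rintro _ ⟨⟨x', a⟩ | e, rfl⟩ γ
    · refine ((hbase x x' γ).trans ?_).trans (hbase x' x _)
      have : D.coset x' γ = D.coset x' (γ * D.graphOfGroups.vertexHom D.R x' a) :=
        (D.coset_eq _ _ _).2 ⟨a, rfl⟩
      rw [this]
      exact .refl _
    · refine ((hbase x (D.graph.src e) γ).trans ?_).trans (hbase (D.graph.tgt e) x _)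
      exact (EdgeRel.coverTree_adj ⟨e, γ, rfl, rfl⟩).reachable
  have : g ∈ K := hK ▸ Subgroup.mem_top g
  exact this γ

theorem coverTree_preconnected : (D.graphOfGroups.coverTree D.R).Preconnected := by
  intro a b
  obtain ⟨x, γ, rfl⟩ := D.exists_coset a
  obtain ⟨x', γ', rfl⟩ := D.exists_coset b
  have := D.coverTree_reachable_mul x (γ⁻¹ * γ') γ
  rw [mul_inv_cancel_left] at this
  exact this.trans (D.coverTree_reachable_base x x' γ')

/-- The projection of the universal cover maps a geodesic to a path without backtracking, hence to
a geodesic. -/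
theorem proj_injective (hT : T.IsTree) : Function.Injective D.proj := by
  intro a b hab
  obtain ⟨p, hp⟩ := (D.coverTree_preconnected a b).exists_walk_length_eq_dist
  set n := (D.graphOfGroups.coverTree D.R).dist a b
  have hrel : ∀ i < n, D.EdgeRel (p.getVert i) (p.getVert (i + 1)) := fun i hi =>
    ((D.coverTree_adj _ _).1 (p.adj_getVert_succ (by omega))).2
  have hpath := p.isPath_of_length_eq_dist hp
  rcases Nat.eq_zero_or_pos n with h0 | hpos
  · exact ((D.coverTree_preconnected a b).dist_eq_zero_iff).1 h0
  exfalso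
  classical
  let C : ℕ → T.Dart := fun i => if h : i < n then ⟨(D.proj (p.getVert i),
    D.proj (p.getVert (i + 1))), (hrel i h).adj⟩ else ⟨(D.proj (p.getVert 0),
    D.proj (p.getVert (0 + 1))), (hrel 0 hpos).adj⟩
  have hC : ∀ i (h : i < n), C i = ⟨(D.proj (p.getVert i),
    D.proj (p.getVert (i + 1))), (hrel i h).adj⟩ := fun i h => dif_pos h
  have := (dist_of_chain hT C (n - 1) (by
    intro i hi
    rw [hC i (by omega), hC (i + 1) (by omega)]
    refine ⟨rfl, fun h2 => ?_⟩
    have h2 : D.proj (p.getVert i) = D.proj (p.getVert (i + 2)) := h2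
    have h3 := (hrel i (by omega)).symm.eq_of_proj_eq (hrel (i + 1) (by omega)) h2
    have h4 := hpath.getVert_injOn (by simp; omega) (by simp; omega) h3
    omega)).2
  rw [hC 0 (by omega), hC (n - 1) (by omega)] at this
  simp only [Nat.sub_add_cancel hpos] at this
  rw [← hp, p.getVert_length, p.getVert_zero, hab, SimpleGraph.dist_self] at this
  omega

theorem exists_edgeRel_of_adj {a : D.Cover} {v : V} (h : T.Adj (D.proj a) v) :
    ∃ b, D.EdgeRel a b ∧ D.proj b = v := by
  obtain ⟨x, γ, rfl⟩ := D.exists_coset a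
  let d : T.Dart := ⟨(_, v), h⟩
  have hd : qEdge Γ (D.f (qEdge Γ d)) = qEdge Γ d := D.f_spec _
  obtain ⟨g, hg⟩ := Quotient.exact hd.symm
  simp only at hg
  obtain ⟨e, he⟩ : ∃ e, e = qEdge Γ d := ⟨_, rfl⟩
  rw [← he] at hd hg
  have hx : D.graph.src e = x := by
    rw [he]
    change qVertex Γ (D.toGroup γ • D.y x) = x
    conv_rhs => rw [← D.y_spec x]
    exact Quotient.sound ⟨D.toGroup γ, rfl⟩
  subst hx
  have hmem : (D.toGroup γ)⁻¹ * g * (D.k (D.graph.inv e))⁻¹ ∈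
      MulAction.stabilizer Γ (D.y (D.graph.src e)) := by
    rw [MulAction.mem_stabilizer_iff]
    nth_rewrite 1 [← D.k_spec']
    rw [smul_smul, inv_mul_cancel_right, mul_smul, ← smul_fst, hg, inv_smul_eq_iff]
    rfl
  obtain ⟨c, hc⟩ := D.exists_toGroup_vertexHom_eq hmem
  refine ⟨_, ⟨e, γ * D.graphOfGroups.vertexHom D.R _ c, ?_, rfl⟩, ?_⟩
  · rw [coset_eq]
    exact ⟨_, rfl⟩
  · have := (EdgeRel.proj_eq (D := D) e (γ * D.graphOfGroups.vertexHom D.R _ c) rfl rfl).2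
    rw [this, map_mul, hc]
    have : D.toGroup γ * ((D.toGroup γ)⁻¹ * g * (D.k (D.graph.inv e))⁻¹) *
      D.k (D.graph.inv e) = g := by group
    rw [this, hg]

theorem proj_surjective (hT : T.IsTree) : Function.Surjective D.proj := by
  have : Nonempty V := hT.connected.nonempty
  obtain ⟨v₀⟩ := this
  intro v
  obtain ⟨p⟩ := hT.connected (D.proj (D.coset (qVertex Γ v₀) 1)) v
  have key : ∀ {u w : V} (p : T.Walk u w) (a : D.Cover), D.proj a = u → ∃ b, D.proj b = w := by
    intro u w p
    induction p with
    | nil => exact fun a ha => ⟨a, ha⟩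
    | cons h p ih =>
      rintro a rfl
      obtain ⟨b, -, hb⟩ := D.exists_edgeRel_of_adj h
      exact ih b hb
  exact key p _ rfl

theorem toGroup_injective (hT : T.IsTree) : Function.Injective D.toGroup := by
  rw [injective_iff_map_eq_one]
  intro g hg
  have : Nonempty V := hT.connected.nonempty
  obtain ⟨v₀⟩ := this
  set x := qVertex Γ v₀
  have h1 : D.coset x 1 = D.coset x g := D.proj_injective hT (by
    rw [proj_coset, proj_coset, hg, map_one])
  obtain ⟨a, ha⟩ := (D.coset_eq _ _ _).1 h1
  rw [one_mul] at ha
  rw [ha, toGroup_vertexHom] at hg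
  have : a = 1 := Subtype.ext hg
  rw [ha, this, map_one]

theorem toGroup_surjective (hT : T.IsTree) : Function.Surjective D.toGroup := by
  intro g
  have : Nonempty V := hT.connected.nonempty
  obtain ⟨v₀⟩ := this
  set x := qVertex Γ v₀
  obtain ⟨a, ha⟩ := D.proj_surjective hT (g • D.y x)
  obtain ⟨x', γ, rfl⟩ := D.exists_coset a
  rw [proj_coset] at ha
  have hx : x' = x := by
    rw [← D.y_spec x', ← D.y_spec x]
    refine Quotient.sound ⟨(D.toGroup γ)⁻¹ * g, ?_⟩
    simp only
    rw [mul_smul, ← ha, inv_smul_smul]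
  subst hx
  have hmem : (D.toGroup γ)⁻¹ * g ∈ MulAction.stabilizer Γ (D.y x) := by
    rw [MulAction.mem_stabilizer_iff, mul_smul, ← ha, inv_smul_smul]
  obtain ⟨c, hc⟩ := D.exists_toGroup_vertexHom_eq hmem
  refine ⟨γ * D.graphOfGroups.vertexHom D.R x c, ?_⟩
  rw [map_mul, hc]
  exact mul_inv_cancel_left _ _

/-- The fundamental group of the quotient graph of groups is `Γ`. -/
def groupEquiv (hT : T.IsTree) : D.Pi ≃* Γ :=
  MulEquiv.ofBijective D.toGroup ⟨D.toGroup_injective hT, D.toGroup_surjective hT⟩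

/-- The universal covering tree of the quotient graph of groups is the given tree. -/
def coverIso (hT : T.IsTree) : D.graphOfGroups.coverTree D.R ≃g T where
  toEquiv := Equiv.ofBijective D.proj ⟨D.proj_injective hT, D.proj_surjective hT⟩
  map_rel_iff' := by
    intro a b
    rw [coverTree_adj]
    constructor
    · intro h
      obtain ⟨b', hb', hbb'⟩ := D.exists_edgeRel_of_adj h
      have hb : b' = b := D.proj_injective hT hbb'
      subst hb
      refine ⟨?_, hb'⟩
      rintro rfl
      exact h.ne rfl
    · rintro ⟨-, h⟩
      exact h.adj

theorem coverIso_smul (hT : T.IsTree) (g : D.Pi) (a : D.Cover) :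
    D.coverIso hT (g • a) = D.groupEquiv hT g • D.coverIso hT a := D.proj_smul g a

end QuotientChoice

/-! ### Primes of isomorphic actions -/

section Transport

variable {V V' G G' : Type*} [Group G] [Group G'] [MulAction G V] [MulAction G' V']

theorem translationLength_conj {T : SimpleGraph V}
    (hdist : ∀ (g : G) a b, T.dist (g • a) (g • b) = T.dist a b) (g h : G) :
    translationLength T (h * g * h⁻¹) = translationLength T g := by
  unfold translationLength
  congr 1
  ext n
  constructor
  · rintro ⟨x, rfl⟩
    refine ⟨h⁻¹ • x, ?_⟩
    simp only
    rw [← hdist h, smul_smul, smul_smul, smul_smul]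
    simp [mul_assoc]
  · rintro ⟨x, rfl⟩
    refine ⟨h • x, ?_⟩
    simp only
    rw [smul_smul, inv_mul_cancel_right, mul_smul, hdist]

theorem PrimitiveClass.length_eq {T : SimpleGraph V}
    (hdist : ∀ (g : G) a b, T.dist (g • a) (g • b) = T.dist a b) (c : PrimitiveClass V G) (g : G)
    (hg : ConjClasses.mk g = c.1) : c.length T = translationLength T g := by
  have h : ConjClasses.mk g = ConjClasses.mk (Quotient.out c.1) := by
    rw [hg]
    exact (Quotient.out_eq c.1).symm
  obtain ⟨x, hx⟩ := isConj_iff.1 (ConjClasses.mk_eq_mk_iff_isConj.1 h)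
  unfold PrimitiveClass.length
  rw [← hx, translationLength_conj hdist]

theorem isPrimitiveHyperbolic_iff (φ : G ≃* G') (ψ : V ≃ V') (hψ : ∀ g x, ψ (g • x) = φ g • ψ x)
    (g : G) : IsPrimitiveHyperbolic V' (φ g) ↔ IsPrimitiveHyperbolic V g := by
  unfold IsPrimitiveHyperbolic IsHyperbolic
  refine and_congr ?_ (not_congr ?_)
  · rw [← ψ.forall_congr_right]
    refine forall_congr' fun x => ?_
    rw [← hψ, ψ.injective.ne_iff]
  · constructor
    · rintro ⟨h, r, hr, he⟩
      exact ⟨φ.symm h, r, hr, by rw [← map_pow, ← he, φ.symm_apply_apply]⟩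
    · rintro ⟨h, r, hr, rfl⟩
      exact ⟨φ h, r, hr, map_pow _ _ _⟩

/-- Equivariantly isomorphic actions have the same primes, of the same lengths. -/
theorem exists_primitiveClass_equiv {T : SimpleGraph V} {T' : SimpleGraph V'} (φ : G ≃* G')
    (ψ : T ≃g T') (hψ : ∀ g x, ψ (g • x) = φ g • ψ x)
    (hdist : ∀ (g : G') a b, T'.dist (g • a) (g • b) = T'.dist a b) :
    ∃ Φ : PrimitiveClass V G ≃ PrimitiveClass V' G', ∀ c, (Φ c).length T' = c.length T := by
  have hdistG : ∀ (g : G) a b, T.dist (g • a) (g • b) = T.dist a b := fun g a b => by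
    rw [← dist_iso ψ, hψ, hψ, hdist, dist_iso]
  have hmap : ∀ (g : G), ConjClasses.map (φ : G →* G') (ConjClasses.mk g) = ConjClasses.mk (φ g) :=
    fun g => rfl
  let F : PrimitiveClass V G → PrimitiveClass V' G' := fun c =>
    ⟨ConjClasses.map (φ : G →* G') c.1, by
      obtain ⟨g, hg, hp⟩ := c.2
      exact ⟨φ g, by rw [← hg]; rfl, (isPrimitiveHyperbolic_iff φ ψ.toEquiv hψ g).2 hp⟩⟩
  have hF : Function.Bijective F := by
    constructor
    · intro c c' h
      obtain ⟨g, hg, hp⟩ := c.2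
      obtain ⟨g', hg', hp'⟩ := c'.2
      have h1 : ConjClasses.map (φ : G →* G') c.1 = ConjClasses.map (φ : G →* G') c'.1 :=
        congrArg Subtype.val h
      apply Subtype.ext
      rw [← hg, ← hg', hmap, hmap, ConjClasses.mk_eq_mk_iff_isConj, isConj_iff] at h1
      obtain ⟨x, hx⟩ := h1
      rw [← hg, ← hg', ConjClasses.mk_eq_mk_iff_isConj, isConj_iff]
      refine ⟨φ.symm x, φ.injective ?_⟩
      rw [map_mul, map_mul, map_inv, φ.apply_symm_apply, hx]
    · intro c
      obtain ⟨g, hg, hp⟩ := c.2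
      refine ⟨⟨ConjClasses.mk (φ.symm g), φ.symm g, rfl, ?_⟩, Subtype.ext ?_⟩
      · rw [← isPrimitiveHyperbolic_iff φ ψ.toEquiv hψ, φ.apply_symm_apply]
        exact hp
      · change ConjClasses.mk (φ (φ.symm g)) = c.1
        rw [φ.apply_symm_apply, hg]
  refine ⟨Equiv.ofBijective F hF, fun c => ?_⟩
  obtain ⟨g, hg, hp⟩ := c.2
  rw [PrimitiveClass.length_eq hdistG c g hg, PrimitiveClass.length_eq hdist _ (φ g) (by
    change _ = ConjClasses.map (φ : G →* G') c.1
    rw [← hg]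
    rfl)]
  unfold translationLength
  congr 1
  ext n
  constructor
  · rintro ⟨x, rfl⟩
    refine ⟨ψ.symm x, ?_⟩
    simp only
    rw [← dist_iso ψ, hψ, ψ.apply_symm_apply]
  · rintro ⟨x, rfl⟩
    exact ⟨ψ x, by simp only; rw [← hψ, dist_iso]⟩

end Transport

/-! ### Periodic sequences and cycles -/

section Words

variable {E : Type*}

/-- The list `e 0, …, e (n - 1)`. -/
def seqList (e : ℤ → E) (n : ℕ) : List E := (List.range n).map fun i : ℕ => e i

/-- `k` is a period of `e`. -/
def IsPeriod (e : ℤ → E) (k : ℤ) : Prop := ∀ i, e (i + k) = e i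

theorem length_seqList (e : ℤ → E) (n : ℕ) : (seqList e n).length = n := by
  simp [seqList]

theorem getElem_seqList (e : ℤ → E) (n : ℕ) (i : ℕ) (h : i < (seqList e n).length) :
    (seqList e n)[i] = e i := by
  simp [seqList]

theorem IsPeriod.mul {e : ℤ → E} {k : ℤ} (h : IsPeriod e k) (m : ℤ) : IsPeriod e (m * k) := by
  induction m using Int.induction_on with
  | zero => intro i; simp
  | succ m ih => intro i; rw [add_mul, one_mul, ← add_assoc, h, ih]
  | pred m ih =>
    intro i
    rw [sub_mul, one_mul, ← ih i, ← h (i + (-(m : ℤ) * k - k))]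
    congr 1
    ring

theorem IsPeriod.add {e : ℤ → E} {k m : ℤ} (h : IsPeriod e k) (h' : IsPeriod e m) :
    IsPeriod e (k + m) := fun i => by rw [← add_assoc, h', h]

theorem IsPeriod.gcd {e : ℤ → E} {k m : ℤ} (h : IsPeriod e k) (h' : IsPeriod e m) :
    IsPeriod e (Int.gcd k m) := by
  rw [Int.gcd_eq_gcd_ab, mul_comm k, mul_comm m]
  exact (h.mul _).add (h'.mul _)

theorem IsPeriod.emod {e : ℤ → E} {k : ℤ} (h : IsPeriod e k) (i : ℤ) : e (i % k) = e i := by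
  rw [Int.emod_def, ← h.mul (i / k) (i - k * (i / k))]
  congr 1
  ring

theorem IsPeriod.shift {e : ℤ → E} {k : ℤ} (h : IsPeriod e k) (j : ℤ) :
    IsPeriod (fun i => e (i + j)) k := fun i => by
  simp only
  rw [add_right_comm, h]

theorem exists_seqList_eq {L : List E} (hL : L ≠ []) :
    ∃ e : ℤ → E, IsPeriod e L.length ∧ seqList e L.length = L := by
  have hpos : 0 < L.length := List.length_pos_iff.2 hL
  have hlt : ∀ i : ℤ, (i % (L.length : ℤ)).toNat < L.length := fun i => by
    have h1 := Int.emod_nonneg i (show (L.length : ℤ) ≠ 0 by omega)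
    have h2 := Int.emod_lt_of_pos i (show (0 : ℤ) < L.length by omega)
    omega
  refine ⟨fun i => L[(i % (L.length : ℤ)).toNat]'(hlt i), fun i => ?_, ?_⟩
  · simp only [Int.add_emod_right]
  · refine List.ext_getElem (length_seqList _ _) fun i h1 h2 => ?_
    rw [getElem_seqList]
    congr 1
    rw [Int.emod_eq_of_lt (by omega) (by omega)]
    simp

theorem seqList_ext {e e' : ℤ → E} {n : ℕ} (hn : 1 ≤ n) (he : IsPeriod e n) (he' : IsPeriod e' n)
    (h : seqList e n = seqList e' n) : e = e' := by
  funext i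
  rw [← he.emod i, ← he'.emod i]
  have h1 := Int.emod_nonneg i (show (n : ℤ) ≠ 0 by omega)
  have h2 := Int.emod_lt_of_pos i (show (0 : ℤ) < n by omega)
  obtain ⟨k, hk⟩ : ∃ k : ℕ, i % (n : ℤ) = k := ⟨(i % (n : ℤ)).toNat, by omega⟩
  rw [hk, ← getElem_seqList e n k (by rw [length_seqList]; omega),
    ← getElem_seqList e' n k (by rw [length_seqList]; omega)]
  congr 1

theorem seqList_rotate {e : ℤ → E} {n : ℕ} (he : IsPeriod e n) (j : ℕ) :
    (seqList e n).rotate j = seqList (fun i => e (i + j)) n := by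
  refine List.ext_getElem (by simp [length_seqList]) fun i h1 h2 => ?_
  rw [List.getElem_rotate, getElem_seqList, getElem_seqList, length_seqList, Int.natCast_mod,
    he.emod]
  push_cast
  rfl

theorem seqList_isRotated_iff {e e' : ℤ → E} {n : ℕ} (hn : 1 ≤ n) (he : IsPeriod e n)
    (he' : IsPeriod e' n) : seqList e n ~r seqList e' n ↔ ∃ j, ∀ i, e' i = e (i + j) := by
  constructor
  · rintro ⟨j, hj⟩
    rw [seqList_rotate he] at hj
    exact ⟨j, fun i => (congrFun (seqList_ext hn (he.shift j) he' hj) i).symm⟩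
  · rintro ⟨j, hj⟩
    refine ⟨(j % n).toNat, ?_⟩
    rw [seqList_rotate he]
    congr 1
    funext i
    have h1 := Int.emod_nonneg j (show (n : ℤ) ≠ 0 by omega)
    rw [hj, Int.toNat_of_nonneg h1, Int.emod_def, ← he.mul (j / n)]
    congr 1
    ring

theorem seqList_mul {e : ℤ → E} {m : ℕ} (he : IsPeriod e m) (k : ℕ) :
    seqList e (k * m) = (List.replicate k (seqList e m)).flatten := by
  induction k with
  | zero => simp [seqList]
  | succ k ih =>
    rw [List.replicate_succ, List.flatten_cons, ← ih, add_mul, one_mul, add_comm]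
    unfold seqList
    rw [List.range_add, List.map_append, List.map_map]
    congr 1
    refine List.map_congr_left fun i _ => ?_
    simp only [Function.comp]
    push_cast
    rw [add_comm, he]

theorem isChain_seqList (r : E → E → Prop) (e : ℤ → E) (n : ℕ) :
    (seqList e (n + 1)).IsChain r ↔ ∀ i : ℕ, i < n → r (e i) (e (i + 1)) := by
  rw [List.isChain_iff_getElem]
  simp only [length_seqList, getElem_seqList]
  constructor
  · intro h i hi
    exact_mod_cast h i (by omega)
  · intro h i hi
    exact_mod_cast h i (by omega)

theorem isClosedPath_seqList {V : Type*} (X : OrientedGraph V E) {e : ℤ → E} {n : ℕ} (hn : 1 ≤ n)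
    (he : IsPeriod e n) : X.IsClosedPath (seqList e n : Cycle E) ↔
      ∀ i, X.tgt (e i) = X.src (e (i + 1)) := by
  have hne : (seqList e n : Cycle E) ≠ Cycle.nil := by
    rw [Ne, Cycle.coe_eq_nil, ← List.length_eq_zero_iff, length_seqList]
    omega
  have hchain : Cycle.Chain (fun e f => X.tgt e = X.src f) (seqList e n : Cycle E) ↔
      ∀ i : ℕ, i < n → X.tgt (e i) = X.src (e (i + 1)) := by
    rw [← isChain_seqList (fun a b => X.tgt a = X.src b)]
    obtain ⟨m, rfl⟩ := Nat.exists_eq_add_of_le' hn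
    have h1 : seqList e (m + 1 + 1) = seqList e (m + 1) ++ [e 0] := by
      unfold seqList
      rw [List.range_succ (n := m + 1), List.map_append]
      have := he 0
      rw [zero_add] at this
      rw [List.map_singleton, this]
    have h2 : seqList e (m + 1) = e 0 :: (List.range m).map fun i : ℕ => e ((i + 1 : ℕ) : ℤ) := by
      unfold seqList
      rw [List.range_succ_eq_map, List.map_cons, List.map_map]
      rfl
    rw [h1, h2, Cycle.chain_coe_cons, List.cons_append]
  rw [OrientedGraph.IsClosedPath, hchain]
  constructor
  · rintro ⟨-, h⟩ i
    have h1 := Int.emod_nonneg i (show (n : ℤ) ≠ 0 by omega)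
    have h2 := Int.emod_lt_of_pos i (show (0 : ℤ) < n by omega)
    have h3 := h (i % n).toNat (by omega)
    rw [Int.toNat_of_nonneg h1, he.emod] at h3
    rw [h3, Int.emod_def, ← he.mul (i / n) (i - n * (i / n) + 1)]
    congr 2
    ring
  · exact fun h => ⟨hne, fun i _ => h i⟩

/-- `e` is a bi-infinite unrolling of the cycle `C`. -/
def Unrolls (e : ℤ → E) (C : Cycle E) : Prop :=
  IsPeriod e C.length ∧ C = (seqList e C.length : Cycle E)

theorem exists_unrolls {C : Cycle E} (hC : C ≠ Cycle.nil) : ∃ e, Unrolls e C := by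
  induction C using Quotient.inductionOn' with
  | h L =>
    have hL : L ≠ [] := fun h => hC (by rw [h]; rfl)
    obtain ⟨e, he, heL⟩ := exists_seqList_eq hL
    exact ⟨e, he, congrArg _ heL.symm⟩

theorem length_pos_of_ne_nil {C : Cycle E} (hC : C ≠ Cycle.nil) : 1 ≤ C.length := by
  induction C using Quotient.inductionOn' with
  | h L =>
    have hL : L ≠ [] := fun h => hC (by rw [h]; rfl)
    exact List.length_pos_iff.2 hL

variable {V : Type*} {X : OrientedGraph V E}

/-- The length of a primitive cycle is the smallest period of its unrolling. -/
theorem Unrolls.dvd_of_isPeriod {e : ℤ → E} {C : Cycle E} (h : Unrolls e C)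
    (hC : X.IsPrimitiveCycle C) {k : ℤ} (hk : IsPeriod e k) : (C.length : ℤ) ∣ k := by
  have hn : 1 ≤ C.length := length_pos_of_ne_nil hC.1.1
  have hpath : ∀ i, X.tgt (e i) = X.src (e (i + 1)) := by
    rw [← isClosedPath_seqList X hn h.1, ← h.2]
    exact hC.1
  have hg := h.1.gcd hk
  set g := Int.gcd C.length k with hgdef
  have hgn : g ∣ C.length := Int.natCast_dvd_natCast.1 (Int.gcd_dvd_left _ _)
  have hgpos : 1 ≤ g := Nat.pos_of_dvd_of_pos hgn hn
  obtain ⟨s, hs⟩ := hgn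
  rcases Nat.lt_or_ge 1 s with h1 | h1
  · exfalso
    refine hC.2 ⟨seqList e g, s, (isClosedPath_seqList X hgpos hg).2 hpath, h1, ?_⟩
    rw [← seqList_mul hg, mul_comm, ← hs]
    exact h.2
  · have hs1 : s = 1 := by
      rcases Nat.eq_zero_or_pos s with rfl | h0
      · omega
      · omega
    rw [hs1, mul_one] at hs
    rw [hs]
    exact Int.gcd_dvd_right _ _

/-- Every periodic bi-infinite path unrolls a primitive cycle. -/
theorem exists_primitiveCycle {e : ℤ → E} {N : ℕ} (hN : 1 ≤ N) (he : IsPeriod e N)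
    (hpath : ∀ i, X.tgt (e i) = X.src (e (i + 1))) :
    ∃ C : Cycle E, X.IsPrimitiveCycle C ∧ Unrolls e C := by
  classical
  have hex : ∃ n : ℕ, 1 ≤ n ∧ IsPeriod e n := ⟨N, hN, he⟩
  obtain ⟨h1, h2⟩ := Nat.find_spec hex
  set n := Nat.find hex with hn
  have hlen : (seqList e n : Cycle E).length = n := length_seqList e n
  refine ⟨(seqList e n : Cycle E), ⟨(isClosedPath_seqList X h1 h2).2 hpath, ?_⟩, ?_⟩
  · rintro ⟨L, f, hL, hf, hCL⟩
    have hLne : L ≠ [] := fun h => hL.1 (by rw [h]; rfl)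
    have hLpos : 0 < L.length := List.length_pos_iff.2 hLne
    obtain ⟨e', he', heL⟩ := exists_seqList_eq hLne
    rw [← heL, ← seqList_mul he'] at hCL
    have hnf : n = f * L.length := by
      have := congrArg Cycle.length hCL
      rwa [hlen, Cycle.length_coe, length_seqList] at this
    rw [← hnf, Cycle.coe_eq_coe] at hCL
    have he'n : IsPeriod e' n := by
      rw [hnf]
      push_cast
      exact he'.mul f
    obtain ⟨j, hj⟩ := (seqList_isRotated_iff h1 h2 he'n).1 hCL
    have hper : IsPeriod e L.length := by
      intro i
      have h3 := he' (i - j)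
      rw [hj, hj] at h3
      convert h3 using 2 <;> ring
    refine Nat.find_min hex (m := L.length) ?_ ⟨hLpos, hper⟩
    rw [← hn, hnf]
    nlinarith
  · rw [Unrolls, hlen]
    exact ⟨h2, rfl⟩

theorem Unrolls.eq_of_shift {e e' : ℤ → E} {C C' : Cycle E} (h : Unrolls e C) (h' : Unrolls e' C')
    (hC : X.IsPrimitiveCycle C) (hC' : X.IsPrimitiveCycle C') {j : ℤ}
    (hj : ∀ i, e' i = e (i + j)) : C = C' := by
  have h1 : C.length ∣ C'.length := by
    refine Int.natCast_dvd_natCast.1 (h.dvd_of_isPeriod hC fun i => ?_)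
    have := h'.1 (i - j)
    rw [hj, hj] at this
    convert this using 2 <;> ring
  have h2 : C'.length ∣ C.length := by
    refine Int.natCast_dvd_natCast.1 (h'.dvd_of_isPeriod hC' fun i => ?_)
    rw [hj, hj, add_right_comm, h.1]
  have h3 := Nat.dvd_antisymm h1 h2
  rw [h.2, h'.2, ← h3, Cycle.coe_eq_coe,
    seqList_isRotated_iff (length_pos_of_ne_nil hC.1.1) h.1 (h3 ▸ h'.1)]
  exact ⟨j, hj⟩

theorem Unrolls.exists_shift {e e' : ℤ → E} {C : Cycle E} (hC : C ≠ Cycle.nil) (h : Unrolls e C)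
    (h' : Unrolls e' C) : ∃ j, ∀ i, e' i = e (i + j) := by
  have h1 := h.2.symm.trans h'.2
  rwa [Cycle.coe_eq_coe, seqList_isRotated_iff (length_pos_of_ne_nil hC) h.1 h'.1] at h1

theorem Unrolls.cycleWeight_eq (𝒢 : GraphOfGroups X) {e : ℤ → E} {C : Cycle E} (h : Unrolls e C) :
    𝒢.cycleWeight C = ∏ i ∈ Finset.range C.length, 𝒢.weight₂ (e i) (e (i + 1)) := by
  conv_lhs => rw [h.2]
  change 𝒢.listWeight (seqList e C.length) = _
  rw [GraphOfGroups.listWeight, seqList_rotate h.1, seqList, seqList, List.zipWith_map,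
    List.zipWith_self]
  rfl

end Words

/-! ### Weights as numbers of lifts -/

section SequenceCount

variable {α : Type*}

theorem card_sigma_of_card_eq {ι : Type*} [Finite ι] {F : ι → Type*} [∀ i, Finite (F i)] {k : ℕ}
    (h : ∀ i, Nat.card (F i) = k) : Nat.card (Σ i, F i) = Nat.card ι * k := by
  have : Fintype ι := Fintype.ofFinite ι
  rw [Nat.card_sigma, Finset.sum_congr rfl fun i _ => h i, Finset.sum_const, Finset.card_univ,
    smul_eq_mul, Nat.card_eq_fintype_card]

/-- Sequences of length `n` that start at `a` and whose `i`-th step lies in `S i`, continued by a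
constant. -/
def stepSeqs (S : ℕ → α → Set α) (a : α) (n : ℕ) : Set (ℕ → α) :=
  {x | x 0 = a ∧ (∀ i < n, x (i + 1) ∈ S i (x i)) ∧ ∀ i, n ≤ i → x i = x n}

/-- If the number of continuations depends on the position only, the number of sequences is the
product of these numbers. -/
theorem card_stepSeqs (S : ℕ → α → Set α) (c : ℕ → α → Prop) (a : α) (k : ℕ → ℕ) (ha : c 0 a)
    (hc : ∀ n b b', c n b → b' ∈ S n b → c (n + 1) b')
    (hfin : ∀ n b, c n b → (S n b).Finite) (hk : ∀ n b, c n b → (S n b).ncard = k n) (n : ℕ) :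
    (stepSeqs S a n).Finite ∧ (stepSeqs S a n).ncard = ∏ i ∈ Finset.range n, k i := by
  classical
  have hcx : ∀ n, ∀ x ∈ stepSeqs S a n, ∀ i ≤ n, c i (x i) := by
    rintro n x ⟨h0, h1, -⟩ i
    induction i with
    | zero => intro _; rwa [h0]
    | succ i ih => exact fun hi => hc i _ _ (ih (by omega)) (h1 i (by omega))
  induction n with
  | zero =>
    have : stepSeqs S a 0 = {fun _ => a} := by
      ext x
      constructor
      · rintro ⟨h0, -, h2⟩
        funext i
        rw [h2 i (Nat.zero_le i), h0]
      · rintro rfl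
        exact ⟨rfl, by simp, fun _ _ => rfl⟩
    rw [this]
    simp
  | succ n ih =>
    obtain ⟨ihfin, ihcard⟩ := ih
    have : Finite (stepSeqs S a n) := ihfin
    have hSfin : ∀ x : stepSeqs S a n, Finite (S n (x.1 n)) := fun x =>
      hfin n _ (hcx n x x.2 n le_rfl)
    let Ψ : (Σ x : stepSeqs S a n, S n (x.1 n)) → stepSeqs S a (n + 1) := fun p =>
      ⟨fun i => if i ≤ n then p.1.1 i else p.2, by
        obtain ⟨⟨x, h0, h1, h2⟩, b, hb⟩ := p
        refine ⟨by simpa using h0, fun i hi => ?_, fun i hi => ?_⟩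
        · rcases Nat.lt_succ_iff_lt_or_eq.1 hi with h | rfl
          · simp only [if_pos h.le, if_pos (Nat.succ_le_of_lt h)]
            exact h1 i h
          · simpa using hb
        · simp [show ¬ i ≤ n by omega]⟩
    have hΨ : Function.Bijective Ψ := by
      constructor
      · rintro ⟨⟨x, hx⟩, b, hb⟩ ⟨⟨x', hx'⟩, b', hb'⟩ h
        have h' : ∀ i, (if i ≤ n then x i else b) = (if i ≤ n then x' i else b') := fun i =>
          congrFun (congrArg Subtype.val h) i
        have hxx : x = x' := by
          funext i
          rcases Nat.lt_or_ge n i with hi | hi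
          · have := h' n
            rw [hx.2.2 i hi.le, hx'.2.2 i hi.le]
            simpa using this
          · simpa [hi] using h' i
        subst hxx
        have hbb : b = b' := by simpa using h' (n + 1)
        subst hbb
        rfl
      · rintro ⟨x, h0, h1, h2⟩
        refine ⟨⟨⟨fun i => x (min i n), by simpa using h0, fun i hi => ?_, fun i hi => ?_⟩,
          ⟨x (n + 1), ?_⟩⟩, Subtype.ext (funext fun i => ?_)⟩
        · simp only [min_eq_left hi.le, min_eq_left (Nat.succ_le_of_lt hi)]
          exact h1 i (by omega)
        · simp [hi]
        · simp only [min_self]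
          exact h1 n (by omega)
        · simp only [Ψ]
          split_ifs with hi
          · rw [min_eq_left hi]
          · exact (h2 i (by omega)).symm
    have hcard := Nat.card_congr (Equiv.ofBijective Ψ hΨ)
    constructor
    · exact Finite.of_surjective Ψ hΨ.2
    · rw [← Nat.card_coe_set_eq, ← hcard, Finset.prod_range_succ, ← ihcard,
        ← Nat.card_coe_set_eq]
      refine card_sigma_of_card_eq fun x => ?_
      rw [Nat.card_coe_set_eq]
      exact hk n _ (hcx n x x.2 n le_rfl)

end SequenceCount

section Weights

variable {V : Type u} {T : SimpleGraph V} {Γ : Subgroup (T ≃g T)} {hΓ : ActsWithoutInversions Γ}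
  (D : QuotientChoice Γ hΓ)

theorem qEdge_smul (g : Γ) (d : T.Dart) : qEdge Γ (g • d) = qEdge Γ d :=
  Quotient.sound ⟨g, rfl⟩

theorem qEdge_eq_iff {d d' : T.Dart} : qEdge Γ d = qEdge Γ d' ↔ ∃ g : Γ, g • d' = d :=
  Quotient.eq

theorem qVertex_eq_iff {x y : V} : qVertex Γ x = qVertex Γ y ↔ ∃ g : Γ, g • y = x :=
  Quotient.eq

theorem card_stabilizer_eq_of_orbit {α : Type*} [MulAction Γ α] {x y : α} {g : Γ} (h : g • y = x) :
    Nat.card (MulAction.stabilizer Γ x) = Nat.card (MulAction.stabilizer Γ y) :=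
  Nat.card_congr (MulAction.stabilizerEquivStabilizer h.symm).symm.toEquiv

/-- By the orbit-stabilizer theorem, the weight of an edge of the quotient graph is the number of
its lifts with a given origin. -/
theorem QuotientChoice.weight_eq (hfin : HasFiniteStabilizers Γ) (e : QEdge Γ) (v : V)
    (hv : qVertex Γ v = D.graph.src e) :
    {d : T.Dart | d.fst = v ∧ qEdge Γ d = e}.Finite ∧
      D.graphOfGroups.weight e = ({d : T.Dart | d.fst = v ∧ qEdge Γ d = e}.ncard : ℚ) := by
  have hsrc : D.graph.src e = qVertex Γ (D.f e).fst := by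
    conv_lhs => rw [← D.f_spec e]
    rfl
  obtain ⟨g, hg⟩ := qVertex_eq_iff.1 (hv.trans hsrc)
  set d₀ := g • D.f e with hd₀
  have hd₀v : d₀.fst = v := hg
  have hset : {d : T.Dart | d.fst = v ∧ qEdge Γ d = e} =
      MulAction.orbit (MulAction.stabilizer Γ v) d₀ := by
    ext d
    constructor
    · rintro ⟨h1, h2⟩
      have h3 : qEdge Γ d = qEdge Γ d₀ := by rw [h2, hd₀, qEdge_smul, D.f_spec]
      obtain ⟨h, hh⟩ := qEdge_eq_iff.1 h3
      have hmem : h ∈ MulAction.stabilizer Γ v := by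
        rw [MulAction.mem_stabilizer_iff]
        nth_rewrite 1 [← hd₀v]
        rw [← smul_fst, hh, h1]
      exact ⟨⟨h, hmem⟩, hh⟩
    · rintro ⟨⟨h, hmem⟩, rfl⟩
      refine ⟨?_, ?_⟩
      · change h • d₀.fst = v
        rw [hd₀v]
        exact hmem
      · change qEdge Γ (h • d₀) = e
        rw [qEdge_smul, hd₀, qEdge_smul, D.f_spec]
  have : Finite (MulAction.stabilizer Γ v) := hfin v
  rw [hset]
  refine ⟨Set.finite_range _, ?_⟩
  have h1 := (MulAction.stabilizer (MulAction.stabilizer Γ v) d₀).card_mul_index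
  rw [MulAction.index_stabilizer] at h1
  have h2 : Nat.card (MulAction.stabilizer (MulAction.stabilizer Γ v) d₀) =
      Nat.card (MulAction.stabilizer Γ (D.f e)) := by
    rw [← card_stabilizer_eq_of_orbit hd₀.symm]
    refine Nat.card_congr
      { toFun := fun h => ⟨h.1.1, h.2⟩
        invFun := fun h => ⟨⟨h.1, ?_⟩, h.2⟩
        left_inv := fun _ => rfl
        right_inv := fun _ => rfl }
    have h3 : h.1 • d₀ = d₀ := h.2
    have h4 := congrArg (fun d : T.Dart => d.fst) h3
    rw [MulAction.mem_stabilizer_iff]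
    simp only [smul_fst, hd₀v] at h4
    exact h4
  have h3 : Nat.card (D.graphOfGroups.Gv (D.graph.src e)) =
      Nat.card (MulAction.stabilizer Γ v) := by
    obtain ⟨g', hg'⟩ := qVertex_eq_iff.1 ((D.y_spec (D.graph.src e)).trans hv.symm)
    exact card_stabilizer_eq_of_orbit hg'
  have h4 : D.graphOfGroups.weight e = (Nat.card (MulAction.stabilizer Γ v) : ℚ) /
      (Nat.card (MulAction.stabilizer Γ (D.f e)) : ℚ) := by
    rw [← h3]
    rfl
  have : Finite (MulAction.stabilizer Γ (D.f e)) := finite_dart_stabilizer hfin _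
  rw [h4, ← h1, h2, div_eq_iff (Nat.cast_ne_zero.2 Nat.card_pos.ne')]
  push_cast
  ring

theorem graph_src_qEdge (d : T.Dart) : D.graph.src (qEdge Γ d) = qVertex Γ d.fst := rfl

theorem graph_tgt_qEdge (d : T.Dart) : D.graph.tgt (qEdge Γ d) = qVertex Γ d.snd := rfl

/-- The weight of a pair of consecutive edges is the number of continuations without backtracking
of a lift of the first edge to a lift of the pair. -/
theorem QuotientChoice.weight₂_eq (hfin : HasFiniteStabilizers Γ) (d : T.Dart) (e' : QEdge Γ)
    (h : D.graph.tgt (qEdge Γ d) = D.graph.src e') :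
    {d' : T.Dart | Succ d d' ∧ qEdge Γ d' = e'}.Finite ∧
      D.graphOfGroups.weight₂ (qEdge Γ d) e' =
        ({d' : T.Dart | Succ d d' ∧ qEdge Γ d' = e'}.ncard : ℚ) := by
  obtain ⟨hf, hw⟩ := D.weight_eq hfin e' d.snd h
  have hset : {d' : T.Dart | Succ d d' ∧ qEdge Γ d' = e'} =
      {d' : T.Dart | d'.fst = d.snd ∧ qEdge Γ d' = e'} \ {d.symm} := by
    ext d'
    simp only [succ_iff_ne_symm, Set.mem_ofPred_eq, Set.mem_sdiff, Set.mem_singleton_iff]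
    constructor
    · rintro ⟨⟨h1, h2⟩, h3⟩
      exact ⟨⟨h1.symm, h3⟩, h2⟩
    · rintro ⟨⟨h1, h2⟩, h3⟩
      exact ⟨⟨h1.symm, h3⟩, h2⟩
  rw [hset]
  refine ⟨hf.subset Set.sdiff_subset, ?_⟩
  rw [GraphOfGroups.weight₂]
  split_ifs with he
  · have hmem : d.symm ∈ {d' : T.Dart | d'.fst = d.snd ∧ qEdge Γ d' = e'} := ⟨rfl, he.symm⟩
    have := Set.ncard_sdiff_singleton_add_one hmem hf
    rw [hw, ← this]
    push_cast
    ring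
  · rw [Set.sdiff_singleton_eq_self, hw]
    rintro ⟨-, h2⟩
    exact he h2.symm

/-- The number of continuations without backtracking of a lift of `e` to a lift of `e, e'`. -/
def QuotientChoice.natWeight (e e' : QEdge Γ) : ℕ :=
  {d' : T.Dart | Succ (D.f e) d' ∧ qEdge Γ d' = e'}.ncard

theorem QuotientChoice.weight₂_eq_natWeight (hfin : HasFiniteStabilizers Γ) {e e' : QEdge Γ}
    (h : D.graph.tgt e = D.graph.src e') :
    D.graphOfGroups.weight₂ e e' = D.natWeight e e' := by
  have := (D.weight₂_eq hfin (D.f e) e' (by rwa [D.f_spec])).2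
  rwa [D.f_spec] at this

end Weights

/-! ### Counting group elements along a periodic path -/

section Returns

variable {V : Type u} {T : SimpleGraph V} {Γ : Subgroup (T ≃g T)} {hΓ : ActsWithoutInversions Γ}
  (D : QuotientChoice Γ hΓ)

/-- The elements of `Γ` that translate by `N` a line through `d` with projection `e` to the
quotient graph. -/
def translationsAlong (e : ℤ → QEdge Γ) (d : T.Dart) (N : ℕ) : Set Γ :=
  {g | ∃ L : ℤ → T.Dart, IsLine L ∧ L 0 = d ∧ Translates g L N ∧ ∀ i, qEdge Γ (L i) = e i}

theorem eq_of_translates (hT : T.IsTree) {L L' : ℤ → T.Dart} (hL : IsLine L) (hL' : IsLine L')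
    {g : Γ} {N N' : ℕ} (hN : 1 ≤ N) (hg : Translates g L N) (hN' : 1 ≤ N')
    (hg' : Translates g L' N')
    (h0 : L 0 = L' 0) : L = L' := by
  obtain ⟨j, hj⟩ := hg.exists_shift hT hL hL' hN hN' hg'
  have h1 := hj 0
  rw [← h0, zero_add] at h1
  have : (0 : ℤ) = j := hL.fst_injective hT (congrArg (fun d : T.Dart => d.fst) h1)
  funext i
  rw [hj, ← this, add_zero]

theorem card_setOf_smul_eq {d d' : T.Dart} (h : qEdge Γ d' = qEdge Γ d) :
    Nat.card {g : Γ | g • d = d'} = Nat.card (MulAction.stabilizer Γ d) := by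
  obtain ⟨g, hg⟩ := qEdge_eq_iff.1 h
  refine Nat.card_congr
    { toFun := fun h => ⟨g⁻¹ * h.1, ?_⟩
      invFun := fun h => ⟨g * h.1, ?_⟩
      left_inv := fun h => Subtype.ext (mul_inv_cancel_left _ _)
      right_inv := fun h => Subtype.ext (inv_mul_cancel_left _ _) }
  · rw [MulAction.mem_stabilizer_iff, mul_smul, inv_smul_eq_iff, hg]
    exact h.2
  · change (g * h.1) • d = d'
    rw [mul_smul, h.2, hg]

/-- The number of translations along the periodic path `e`, in terms of the weights. -/
theorem QuotientChoice.card_translationsAlong (hT : T.IsTree) (hfin : HasFiniteStabilizers Γ)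
    {e : ℤ → QEdge Γ} (hpath : ∀ i, D.graph.tgt (e i) = D.graph.src (e (i + 1))) {N : ℕ}
    (hN : 1 ≤ N) (he : IsPeriod e N) {d : T.Dart} (hd : qEdge Γ d = e 0) :
    (translationsAlong e d N).Finite ∧ (translationsAlong e d N).ncard =
      Nat.card (MulAction.stabilizer Γ d) *
        ∏ i ∈ Finset.range N, D.natWeight (e i) (e (i + 1)) := by
  classical
  set S : ℕ → T.Dart → Set T.Dart := fun i b => {b' | Succ b b' ∧ qEdge Γ b' = e (i + 1)} with hS
  have hcount := card_stepSeqs S (fun i b => qEdge Γ b = e i) d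
    (fun i => D.natWeight (e i) (e (i + 1))) hd
    (fun n b b' _ hb' => by rw [hb'.2]; push_cast; rfl)
    (fun n b hb => (D.weight₂_eq hfin b (e (n + 1)) (by rw [hb, hpath])).1)
    (fun n b hb => by
      have h1 := (D.weight₂_eq hfin b (e (n + 1)) (by rw [hb, hpath])).2
      rw [hb, D.weight₂_eq_natWeight hfin (hpath n)] at h1
      exact_mod_cast h1.symm) N
  obtain ⟨hSfin, hScard⟩ := hcount
  have : Finite (stepSeqs S d N) := hSfin
  have hcol : ∀ x ∈ stepSeqs S d N, ∀ i : ℕ, i ≤ N → qEdge Γ (x i) = e i := by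
    rintro x ⟨h0, h1, -⟩ i hi
    rcases i with _ | i
    · rw [h0, hd]; rfl
    · rw [(h1 i hi).2]; push_cast; rfl
  have heN : e N = e 0 := by
    have := he 0
    rwa [zero_add] at this
  have hcolN : ∀ x : stepSeqs S d N, qEdge Γ (x.1 N) = qEdge Γ d := fun x => by
    rw [hcol x x.2 N le_rfl, heN, hd]
  have hext : ∀ x : stepSeqs S d N, ∀ g : Γ, g • d = x.1 N → ∃ L : ℤ → T.Dart, IsLine L ∧
      L 0 = d ∧ Translates g L N ∧ (∀ i, qEdge Γ (L i) = e i) ∧ ∀ i : ℕ, i ≤ N → L i = x.1 i := by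
    intro x g hg
    obtain ⟨L, hL, hgL, hLx⟩ := exists_line_of_chain (g := g) hN x.1
      (fun i hi => (x.2.2.1 i hi).1) (by rw [x.2.1, hg])
    refine ⟨L, hL, ?_, hgL, fun i => ?_, hLx⟩
    · have := hLx 0 (Nat.zero_le _)
      rw [x.2.1] at this
      exact this
    · have h1 := Int.emod_nonneg i (show (N : ℤ) ≠ 0 by omega)
      have h2 := Int.emod_lt_of_pos i (show (0 : ℤ) < N by omega)
      have h3 : L i = g ^ (i / N) • L (i % N) := by
        rw [hgL.zpow, mul_comm, Int.emod_add_mul_ediv]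
      have h4 : L (i % N) = x.1 (i % N).toNat := by
        rw [← hLx _ (by omega), Int.toNat_of_nonneg h1]
      rw [h3, qEdge_smul, h4, hcol x x.2 _ (by omega), Int.toNat_of_nonneg h1, he.emod]
  -- A translation is determined by the lift of one period that it spans and by its choice among
  -- the elements moving the first edge of that lift to the last one.
  let Ψ : (Σ x : stepSeqs S d N, {g : Γ | g • d = x.1 N}) → translationsAlong e d N := fun p =>
    ⟨p.2.1, by
      obtain ⟨L, h1, h2, h3, h4, -⟩ := hext p.1 p.2.1 p.2.2
      exact ⟨L, h1, h2, h3, h4⟩⟩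
  have hΨ : Function.Bijective Ψ := by
    constructor
    · rintro ⟨x, g, hg⟩ ⟨x', g', hg'⟩ h
      obtain rfl : g = g' := congrArg Subtype.val h
      obtain ⟨L, h1, h2, h3, h4, h5⟩ := hext x g hg
      obtain ⟨L', h1', h2', h3', h4', h5'⟩ := hext x' g hg'
      obtain rfl := eq_of_translates hT h1 h1' hN h3 hN h3' (h2.trans h2'.symm)
      have hxx : x = x' := by
        refine Subtype.ext (funext fun i => ?_)
        rcases le_total i N with hi | hi
        · rw [← h5 i hi, ← h5' i hi]
        · rw [x.2.2.2 i hi, x'.2.2.2 i hi, ← h5 N le_rfl, ← h5' N le_rfl]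
      subst hxx
      rfl
    · rintro ⟨g, L, hL, hL0, hgL, hcolL⟩
      have hx : (fun i : ℕ => L (min i N : ℕ)) ∈ stepSeqs S d N := by
        refine ⟨by simpa using hL0, fun i hi => ?_, fun i hi => by simp [hi]⟩
        simp only [min_eq_left hi.le, min_eq_left (Nat.succ_le_of_lt hi)]
        push_cast
        exact ⟨hL i, hcolL _⟩
      refine ⟨⟨⟨_, hx⟩, ⟨g, ?_⟩⟩, rfl⟩
      change g • d = L (min N N : ℕ)
      rw [← hL0, hgL, min_self, zero_add]
  have hfing : ∀ x : stepSeqs S d N, Finite {g : Γ | g • d = x.1 N} := fun x => by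
    have : Finite (MulAction.stabilizer Γ d) := finite_dart_stabilizer hfin d
    apply Nat.finite_of_card_ne_zero
    rw [card_setOf_smul_eq (hcolN x)]
    exact Nat.card_pos.ne'
  constructor
  · exact Finite.of_surjective Ψ hΨ.2
  · rw [← Nat.card_coe_set_eq, ← Nat.card_congr (Equiv.ofBijective Ψ hΨ),
      card_sigma_of_card_eq fun x => card_setOf_smul_eq (hcolN x), ← hScard,
      ← Nat.card_coe_set_eq, mul_comm]

theorem IsPeriod.prod_range_mul {E M : Type*} [CommMonoid M] {e : ℤ → E} {m : ℕ}
    (he : IsPeriod e m) (F : E → E → M) (n : ℕ) :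
    ∏ i ∈ Finset.range (n * m), F (e i) (e (i + 1)) =
      (∏ i ∈ Finset.range m, F (e i) (e (i + 1))) ^ n := by
  induction n with
  | zero => simp
  | succ n ih =>
    rw [add_mul, one_mul, Finset.prod_range_add, ih, pow_succ]
    congr 1
    refine Finset.prod_congr rfl fun i _ => ?_
    have h := he.mul n
    push_cast
    have h1 := h i
    have h2 := h (i + 1)
    rw [add_comm, h1, add_right_comm, h2]

end Returns

/-! ### Primes over a primitive cycle -/

section Primes

variable {V : Type u} {T : SimpleGraph V} {Γ : Subgroup (T ≃g T)} {hΓ : ActsWithoutInversions Γ}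
  (D : QuotientChoice Γ hΓ)

theorem IsPrimitiveHyperbolic.conj {G : Type*} [Group G] [MulAction G V] {g : G}
    (hg : IsPrimitiveHyperbolic V g) (h : G) : IsPrimitiveHyperbolic V (h * g * h⁻¹) :=
  (isPrimitiveHyperbolic_iff (MulAut.conj h) (MulAction.toPerm h)
    (fun g x => by simp [mul_smul]) g).2 hg

theorem PrimitiveClass.isPrimitiveHyperbolic (c : PrimitiveClass V Γ) {g : Γ}
    (hg : ConjClasses.mk g = c.1) : IsPrimitiveHyperbolic V g := by
  obtain ⟨g', hg', hp⟩ := c.2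
  rw [← hg', ConjClasses.mk_eq_mk_iff_isConj] at hg
  obtain ⟨h, hh⟩ := isConj_iff.1 hg.symm
  rw [← hh]
  exact hp.conj h

theorem PrimitiveClass.length_eq_of_translates (hT : T.IsTree) (c : PrimitiveClass V Γ) {g : Γ}
    (hg : ConjClasses.mk g = c.1) {L : ℤ → T.Dart} (hL : IsLine L) {n : ℕ} (hn : 1 ≤ n)
    (h : Translates g L n) : c.length T = n := by
  rw [c.length_eq dist_smul_subgroup g hg, h.translationLength_eq hT hL hn]

theorem PrimitiveClass.exists_line (hT : T.IsTree) (hΓ : ActsWithoutInversions Γ)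
    (c : PrimitiveClass V Γ) : 1 ≤ c.length T ∧ ∃ (g : Γ) (L : ℤ → T.Dart),
      ConjClasses.mk g = c.1 ∧ IsLine L ∧ Translates g L (c.length T) := by
  obtain ⟨g, hg, hp⟩ := c.2
  rw [c.length_eq dist_smul_subgroup g hg]
  obtain ⟨h1, L, hL, hgL⟩ := hp.1.exists_line hT hΓ
  exact ⟨h1, g, L, hg, hL, hgL⟩

/-- If only the identity fixes an axis, the translations of an axis form an infinite cyclic group
generated by a primitive element. -/
theorem AxisFree.exists_generator (hT : T.IsTree) (hfree : AxisFree Γ) {L : ℤ → T.Dart}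
    (hL : IsLine L) {g : Γ} {n : ℕ} (hn : 1 ≤ n) (hg : Translates g L n) :
    ∃ (t : Γ) (m : ℕ), 1 ≤ m ∧ Translates t L m ∧ IsPrimitiveHyperbolic V t ∧
      ∀ (h : Γ) (j : ℤ), Translates h L j → ∃ k : ℤ, j = k * m ∧ h = t ^ k := by
  obtain ⟨t, m, hm, ht, hmin⟩ := exists_minimal_translation hn hg
  refine ⟨t, m, hm, ht, isPrimitiveHyperbolic_of_minimal hT hL hm ht hmin, fun h j hj => ?_⟩
  obtain ⟨k, rfl⟩ := hmin h j hj
  refine ⟨k, mul_comm _ _, ?_⟩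
  have := hj.mul (ht.zpow k).inv
  rw [show (m : ℤ) * k + -(k * m) = 0 by ring] at this
  exact mul_inv_eq_one.1 (hfree L hL g n hn hg _ this)

/-- If only the identity fixes an axis, a primitive element generates the translations of its
axis. -/
theorem AxisFree.eq_zpow (hT : T.IsTree) (hfree : AxisFree Γ) {L : ℤ → T.Dart}
    (hL : IsLine L) {g : Γ} {n : ℕ} (hn : 1 ≤ n) (hg : Translates g L n)
    (hprim : IsPrimitiveHyperbolic V g) {h : Γ} {j : ℤ} (hj : Translates h L j) :
    ∃ k : ℤ, j = k * n ∧ h = g ^ k := by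
  obtain ⟨t, m, hm, ht, -, hgen⟩ := hfree.exists_generator hT hL hn hg
  obtain ⟨r, hr, hgr⟩ := hgen g n hg
  have hr0 : 0 < r := by
    by_contra h0
    have : r * m ≤ 0 := mul_nonpos_of_nonpos_of_nonneg (by omega) (by omega)
    omega
  lift r to ℕ using hr0.le
  have hr1 : r = 1 := by
    by_contra h1
    refine hprim.2 ⟨t, r, by omega, ?_⟩
    rw [hgr, zpow_natCast]
  subst hr1
  rw [Nat.cast_one, one_mul] at hr
  rw [Nat.cast_one, zpow_one] at hgr
  rw [hgr, hr]
  exact hgen h j hj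

/-- The axis of an element of the class `c` projects to the path `e` in the quotient graph. -/
def IsOver (e : ℤ → QEdge Γ) (c : PrimitiveClass V Γ) : Prop :=
  ∃ (g : Γ) (L : ℤ → T.Dart), ConjClasses.mk g = c.1 ∧ IsLine L ∧ Translates g L (c.length T) ∧
    ∀ i, qEdge Γ (L i) = e i

theorem Translates.isPeriod {L : ℤ → T.Dart} {g : Γ} {n : ℤ} (h : Translates g L n) :
    IsPeriod (fun i => qEdge Γ (L i)) n := fun i => by
  simp only
  rw [← h, qEdge_smul]

theorem IsOver.isPeriod {e : ℤ → QEdge Γ} {c : PrimitiveClass V Γ} (h : IsOver e c) :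
    IsPeriod e (c.length T) := by
  obtain ⟨g, L, -, -, hg, he⟩ := h
  have := hg.isPeriod
  rwa [show (fun i => qEdge Γ (L i)) = e from funext he] at this

/-- The counting identity behind the theorem. Let `e` be a bi-infinite periodic path of the
quotient graph with smallest period `ℓ`, and `w` the product of the weights along a period. Every
translation by `n ℓ` along `e` through a fixed edge `d` is a power of exactly one primitive
translation. The conjugates of a primitive element of length `f ℓ` contribute `f` times the order
of the stabilizer of `d`, one coset for each of the `f` edges of a period of the axis lying over
the edge `e 0` of `e`, and the total number of translations is `w ^ n` times that order. -/
theorem QuotientChoice.sum_length_over (hT : T.IsTree) (hfin : HasFiniteStabilizers Γ)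
    (hfree : AxisFree Γ) {e : ℤ → QEdge Γ}
    (hpath : ∀ i, D.graph.tgt (e i) = D.graph.src (e (i + 1))) {l : ℕ} (hl : 1 ≤ l)
    (he : IsPeriod e l) (hmin : ∀ k, IsPeriod e k → (l : ℤ) ∣ k) {n : ℕ} (hn : 1 ≤ n) :
    ∃ s : Finset {c : PrimitiveClass V Γ // IsOver e c},
      (∀ c, c ∈ s ↔ c.1.length T / l ∣ n) ∧
      ∑ c ∈ s, c.1.length T / l = (∏ i ∈ Finset.range l, D.natWeight (e i) (e (i + 1))) ^ n := by
  classical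
  set P := {c : PrimitiveClass V Γ // IsOver e c} with hP
  set f : P → ℕ := fun c => c.1.length T / l with hf
  have hlen1 : ∀ c : P, 1 ≤ c.1.length T := fun c => (c.1.exists_line hT hΓ).1
  have hfl : ∀ c : P, f c * l = c.1.length T := fun c =>
    Nat.div_mul_cancel (Int.natCast_dvd_natCast.1 (hmin _ c.2.isPeriod))
  have hfpos : ∀ c : P, 1 ≤ f c := fun c => by
    rcases Nat.eq_zero_or_pos (f c) with h | h
    · have h1 := hfl c
      have h2 := hlen1 c
      rw [h] at h1
      omega
    · exact h
  set d := D.f (e 0) with hd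
  have hde : qEdge Γ d = e 0 := D.f_spec _
  have hN : 1 ≤ n * l := Nat.mul_pos hn hl
  obtain ⟨hHfin, hHcard⟩ := D.card_translationsAlong hT hfin hpath hN
    (by push_cast; exact he.mul n) hde
  have hBfin : Finite (MulAction.stabilizer Γ d) := finite_dart_stabilizer hfin d
  choose γ L hγ hL hγL hLe using fun c : P => c.2
  have hprim : ∀ c, IsPrimitiveHyperbolic V (γ c) := fun c => c.1.isPrimitiveHyperbolic (hγ c)
  have ha : ∀ (c : P) (i : ℕ), ∃ a : Γ, a • L c (i * l) = d := by
    intro c i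
    refine qEdge_eq_iff.1 ?_
    rw [hde, hLe]
    have := he.mul i 0
    rw [zero_add] at this
    exact this.symm
  choose a ha using ha
  -- For each of the `f c` edges of a period of the axis of `γ c` that lie over `e 0`, the elements
  -- `b * a c i` are those that move this edge to `d`; conjugating by them gives translations
  -- along `e` through `d`.
  have hM : ∀ (c : P) (i : ℕ) (b : MulAction.stabilizer Γ d) (k : ℕ),
      IsLine (fun j => ((b : Γ) * a c i) • L c (j + i * l)) ∧
      ((b : Γ) * a c i) • L c (0 + i * l) = d ∧
      Translates (((b : Γ) * a c i) * γ c ^ k * ((b : Γ) * a c i)⁻¹)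
        (fun j => ((b : Γ) * a c i) • L c (j + i * l)) (k * f c * l : ℕ) ∧
      ∀ j, qEdge Γ (((b : Γ) * a c i) • L c (j + i * l)) = e j := by
    intro c i b k
    refine ⟨((hL c).shift _).smul_subgroup _, ?_, ?_, fun j => ?_⟩
    · rw [zero_add, mul_smul, ha]
      exact b.2
    · have := (((hγL c).shift (i * l)).pow k).conj ((b : Γ) * a c i)
      rw [← hfl c] at this
      convert this using 1
      push_cast
      ring
    · rw [qEdge_smul, hLe, he.mul]
  let Ψ : (Σ c : {c : P // f c ∣ n}, Fin (f c.1) × MulAction.stabilizer Γ d) →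
      translationsAlong e d (n * l) := fun p =>
    ⟨((p.2.2 : Γ) * a p.1.1 p.2.1) * γ p.1.1 ^ (n / f p.1.1) * ((p.2.2 : Γ) * a p.1.1 p.2.1)⁻¹, by
      obtain ⟨h1, h2, h3, h4⟩ := hM p.1.1 p.2.1 p.2.2 (n / f p.1.1)
      rw [Nat.div_mul_cancel p.1.2] at h3
      exact ⟨_, h1, h2, h3, h4⟩⟩
  have hinj : Function.Injective Ψ := by
    rintro ⟨⟨c, hc⟩, i, b⟩ ⟨⟨c', hc'⟩, i', b'⟩ h
    have hg : ((b : Γ) * a c i) * γ c ^ (n / f c) * ((b : Γ) * a c i)⁻¹ =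
      ((b' : Γ) * a c' i') * γ c' ^ (n / f c') * ((b' : Γ) * a c' i')⁻¹ := congrArg Subtype.val h
    obtain ⟨h1, h2, h3, h4⟩ := hM c i b (n / f c)
    obtain ⟨h1', h2', h3', h4'⟩ := hM c' i' b' (n / f c')
    rw [← hg] at h3'
    rw [Nat.div_mul_cancel hc] at h3
    rw [Nat.div_mul_cancel hc'] at h3'
    have hMM := eq_of_translates hT h1 h1' hN h3 hN h3' (h2.trans h2'.symm)
    -- the two primitive roots generate the same group of translations
    obtain ⟨-, -, h5, -⟩ := hM c i b 1
    obtain ⟨-, -, h5', -⟩ := hM c' i' b' 1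
    rw [← hMM] at h5'
    rw [pow_one, one_mul] at h5 h5'
    obtain ⟨k, hk, hgk⟩ := hfree.eq_zpow hT h1 (Nat.mul_pos (hfpos c) hl) h5 ((hprim c).conj _) h5'
    obtain ⟨k', hk', -⟩ :=
      hfree.eq_zpow hT h1 (Nat.mul_pos (hfpos c') hl) h5' ((hprim c').conj _) h5
    have hff : f c * l = f c' * l :=
      Nat.dvd_antisymm (Int.natCast_dvd_natCast.1 ⟨k, by rw [hk]; ring⟩)
        (Int.natCast_dvd_natCast.1 ⟨k', by rw [hk']; ring⟩)
    have hfl0 : ((f c * l : ℕ) : ℤ) ≠ 0 := by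
      have := Nat.mul_pos (hfpos c) hl
      omega
    have hk1 : k = 1 := by
      rw [← hff] at hk
      exact (mul_right_cancel₀ hfl0 (by rw [one_mul]; exact hk)).symm
    rw [hk1, zpow_one] at hgk
    have hcc : c = c' := by
      refine Subtype.ext (Subtype.ext ?_)
      rw [← hγ c, ← hγ c', ConjClasses.mk_eq_mk_iff_isConj, isConj_iff]
      refine ⟨((b' : Γ) * a c' i')⁻¹ * ((b : Γ) * a c i), ?_⟩
      have h6 : ((b' : Γ) * a c' i')⁻¹ * ((b : Γ) * a c i) * γ c *
          (((b' : Γ) * a c' i')⁻¹ * ((b : Γ) * a c i))⁻¹ = ((b' : Γ) * a c' i')⁻¹ *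
          (((b : Γ) * a c i) * γ c * ((b : Γ) * a c i)⁻¹) * ((b' : Γ) * a c' i') := by group
      rw [h6, ← hgk]
      group
    subst hcc
    -- the two conjugators differ by a translation of the axis
    have hz : Translates (((b' : Γ) * a c i')⁻¹ * ((b : Γ) * a c i)) (L c)
        (((i' : ℕ) : ℤ) * l - ((i : ℕ) : ℤ) * l) := by
      intro j
      have h7 := congrFun hMM (j - i * l)
      simp only at h7
      rw [sub_add_cancel] at h7
      rw [mul_smul, inv_smul_eq_iff, h7]
      congr 2
      ring
    obtain ⟨m, hm, hzm⟩ := hfree.eq_zpow hT (hL c) (hlen1 c) (hγL c) (hprim c) hz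
    have hdvd : ((f c : ℕ) : ℤ) * l ∣ (((i' : ℕ) : ℤ) - ((i : ℕ) : ℤ)) * l := by
      refine ⟨m, ?_⟩
      rw [sub_mul, hm, ← hfl c]
      push_cast
      ring
    have hdvd' := Int.dvd_of_mul_dvd_mul_right (by omega) hdvd
    have hii : i = i' := by
      have h8 : (i : ℕ) < f c := i.2
      have h9 : (i' : ℕ) < f c := i'.2
      have h10 := Int.eq_zero_of_abs_lt_dvd hdvd' (by rw [abs_lt]; constructor <;> omega)
      exact Fin.ext (by omega)
    subst hii
    rw [sub_self] at hm
    have hm0 : m = 0 := by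
      rcases mul_eq_zero.1 hm.symm with h | h
      · exact h
      · have := hlen1 c
        omega
    rw [hm0, zpow_zero, inv_mul_eq_one] at hzm
    have hbb : b = b' := Subtype.ext (mul_right_cancel hzm).symm
    rw [hbb]
  have hsurj : Function.Surjective Ψ := by
    rintro ⟨g, M, hMl, hM0, hgM, hMe⟩
    obtain ⟨t, m, hm, ht, htprim, hgen⟩ := hfree.exists_generator hT hMl hN hgM
    obtain ⟨k, hk, hgk⟩ := hgen g _ hgM
    have hk0 : 0 < k := by
      by_contra h0
      have : k * m ≤ 0 := mul_nonpos_of_nonpos_of_nonneg (by omega) (by omega)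
      omega
    lift k to ℕ using hk0.le
    rw [zpow_natCast] at hgk
    have hk : n * l = k * m := by exact_mod_cast hk
    let c₀ : PrimitiveClass V Γ := ⟨ConjClasses.mk t, t, rfl, htprim⟩
    have hc₀ : c₀.length T = m := c₀.length_eq_of_translates hT rfl hMl hm ht
    let c : P := ⟨c₀, t, M, rfl, hMl, by rw [hc₀]; exact ht, hMe⟩
    have hfm : f c * l = m := (hfl c).trans hc₀
    have hfk : k * f c = n := by
      rw [← hfm, ← mul_assoc] at hk
      exact (Nat.eq_of_mul_eq_mul_right hl hk).symm
    have hfn : f c ∣ n := ⟨k, by rw [mul_comm, hfk]⟩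
    have hnf : n / f c = k := by
      rw [← hfk]
      exact Nat.mul_div_cancel _ (hfpos c)
    obtain ⟨h, hh⟩ := isConj_iff.1 (ConjClasses.mk_eq_mk_iff_isConj.1 (hγ c))
    -- compare the axis of `t` with the chosen axis of its class
    have h1 := (hγL c).conj h
    rw [hh] at h1
    obtain ⟨j, hj⟩ := ht.exists_shift hT hMl ((hL c).smul_subgroup h) hm (hlen1 c) h1
    have hjper : IsPeriod e j := by
      intro i
      rw [← hMe (i + j), ← hj i, qEdge_smul, hLe]
    obtain ⟨j', rfl⟩ := hmin j hjper
    have hf0 : ((f c : ℕ) : ℤ) ≠ 0 := by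
      have := hfpos c
      omega
    set i₀ : ℕ := ((-j') % (f c : ℤ)).toNat with hi₀
    have hi₀nn := Int.emod_nonneg (-j') hf0
    have hi₀lt := Int.emod_lt_of_pos (-j') (show (0 : ℤ) < f c by have := hfpos c; omega)
    have hi₀' : (i₀ : ℤ) = -j' - f c * (-j' / f c) := by
      rw [hi₀, Int.toNat_of_nonneg hi₀nn, Int.emod_def]
    set s : ℤ := -j' / f c with hs
    -- the element `b` fixes `d`
    have hMd : (h * γ c ^ s) • L c (i₀ * l) = d := by
      rw [mul_smul, (hγL c).zpow, hj, ← hM0]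
      congr 1
      rw [hi₀', ← hfl c]
      push_cast
      ring
    have hb : h * γ c ^ s * (a c i₀)⁻¹ ∈ MulAction.stabilizer Γ d := by
      rw [MulAction.mem_stabilizer_iff]
      nth_rewrite 1 [← ha c i₀]
      rw [smul_smul, inv_mul_cancel_right, hMd]
    have hi₀f : i₀ < f c := by omega
    refine ⟨⟨⟨c, hfn⟩, ⟨i₀, hi₀f⟩, ⟨_, hb⟩⟩, Subtype.ext ?_⟩
    simp only [Ψ]
    rw [hnf, inv_mul_cancel_right, hgk, ← hh, conj_pow]
    group
  have hfinI : Finite {c : P // f c ∣ n} := by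
    have : Finite (translationsAlong e d (n * l)) := hHfin
    have : Finite (Σ c : {c : P // f c ∣ n}, Fin (f c.1) × MulAction.stabilizer Γ d) :=
      Finite.of_injective Ψ hinj
    refine Finite.of_surjective (fun p : (Σ c : {c : P // f c ∣ n},
      Fin (f c.1) × MulAction.stabilizer Γ d) => p.1) fun c => ?_
    exact ⟨⟨c, ⟨0, hfpos c.1⟩, 1⟩, rfl⟩
  have hfinS : {c : P | f c ∣ n}.Finite := hfinI
  refine ⟨hfinS.toFinset, fun c => hfinS.mem_toFinset, ?_⟩
  have hcard := Nat.card_congr (Equiv.ofBijective Ψ ⟨hinj, hsurj⟩)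
  rw [Nat.card_coe_set_eq, hHcard, he.prod_range_mul D.natWeight n] at hcard
  have : Fintype {c : P // f c ∣ n} := Fintype.ofFinite _
  rw [Nat.card_sigma] at hcard
  simp_rw [Nat.card_prod, Nat.card_fin] at hcard
  rw [← Finset.sum_mul, mul_comm] at hcard
  have := Nat.eq_of_mul_eq_mul_left Nat.card_pos hcard
  rw [← this]
  exact Finset.sum_subtype _ (fun c => by simp) f

/-- An unrolling of a primitive cycle. -/
def unroll (C : GraphOfGroups.PrimeCycle D.graph) : ℤ → QEdge Γ :=
  (exists_unrolls C.2.1.1).choose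

theorem unroll_spec (C : GraphOfGroups.PrimeCycle D.graph) : Unrolls (unroll D C) C.1 :=
  (exists_unrolls C.2.1.1).choose_spec

/-- Every prime lies over exactly one primitive cycle. -/
theorem existsUnique_isOver_unroll (hT : T.IsTree) (c : PrimitiveClass V Γ) :
    ∃! C : GraphOfGroups.PrimeCycle D.graph, IsOver (unroll D C) c := by
  obtain ⟨hlen, g, L, hg, hL, hgL⟩ := c.exists_line hT hΓ
  obtain ⟨C, hC, hCL⟩ := exists_primitiveCycle (X := D.graph) hlen hgL.isPeriod (fun i => by
    rw [graph_tgt_qEdge, graph_src_qEdge, hL.snd_eq])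
  obtain ⟨j, hj⟩ := hCL.exists_shift hC.1.1 (unroll_spec D ⟨C, hC⟩)
  refine ⟨⟨C, hC⟩, ⟨g, _, hg, hL.shift j, hgL.shift j, fun i => (hj i).symm⟩, ?_⟩
  rintro ⟨C', hC'⟩ ⟨g', L', hg', hL', hgL', hLe'⟩
  obtain ⟨h, hh⟩ := isConj_iff.1 (ConjClasses.mk_eq_mk_iff_isConj.1 (hg.trans hg'.symm))
  have h1 := hgL.conj h
  rw [hh] at h1
  obtain ⟨j', hj'⟩ := Translates.exists_shift hT (hL.smul_subgroup h) hL' hlen h1 hlen hgL'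
  refine Subtype.ext (hCL.eq_of_shift (unroll_spec D ⟨C', hC'⟩) hC hC' (j := j') fun i => ?_).symm
  rw [← hLe', hj', qEdge_smul]

/-- The primes of `Γ`, sorted by the primitive cycles to which their axes project. -/
def primesEquiv (hT : T.IsTree) :
    (Σ C : GraphOfGroups.PrimeCycle D.graph, {c : PrimitiveClass V Γ // IsOver (unroll D C) c}) ≃
      PrimitiveClass V Γ :=
  Equiv.ofBijective (fun p => p.2.1) (by
    constructor
    · rintro ⟨C, c, hc⟩ ⟨C', c', hc'⟩ h
      obtain rfl : c = c' := h
      obtain rfl := (existsUnique_isOver_unroll D hT c).unique hc hc'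
      rfl
    · intro c
      obtain ⟨C, hC, -⟩ := existsUnique_isOver_unroll D hT c
      exact ⟨⟨C, c, hC⟩, rfl⟩)

theorem unroll_path (C : GraphOfGroups.PrimeCycle D.graph) (i : ℤ) :
    D.graph.tgt (unroll D C i) = D.graph.src (unroll D C (i + 1)) := by
  have h := unroll_spec D C
  refine (isClosedPath_seqList D.graph (length_pos_of_ne_nil C.2.1.1) h.1).1 ?_ i
  rw [← h.2]
  exact C.2.1

/-- The weight of a primitive cycle, as a natural number. -/
def natCycleWeight (C : GraphOfGroups.PrimeCycle D.graph) : ℕ :=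
  ∏ i ∈ Finset.range C.1.length, D.natWeight (unroll D C i) (unroll D C (i + 1))

theorem cycleWeight_eq_natCycleWeight (hfin : HasFiniteStabilizers Γ)
    (C : GraphOfGroups.PrimeCycle D.graph) :
    D.graphOfGroups.cycleWeight C.1 = natCycleWeight D C := by
  rw [(unroll_spec D C).cycleWeight_eq, natCycleWeight, Nat.cast_prod]
  exact Finset.prod_congr rfl fun i _ => D.weight₂_eq_natWeight hfin (unroll_path D C i)

end Primes

/-! ### Euler products of formal power series -/

/-- The divisor sums of the family `f` are the powers of `W`: for `n ≥ 1` there are finitely many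
`c` with `f c ∣ n`, and `∑_{f c ∣ n} f c = W ^ n`. -/
def HasDivisorSums {κ : Type*} (f : κ → ℕ) (W : ℕ) : Prop :=
  ∀ n, 1 ≤ n → ∃ s : Finset κ, (∀ c, c ∈ s ↔ f c ∣ n) ∧ ∑ c ∈ s, f c = W ^ n

section Formal

open PowerSeries Finset Filter

/-- The Euler factor `(1 - a X ^ k)⁻¹`. -/
def geomFactor (a : ℚ) (k : ℕ) : ℚ⟦X⟧ := (1 - C a * X ^ k)⁻¹

theorem formalEuler_eq_tprod {ι : Type*} (a : ι → ℚ) (ℓ : ι → ℕ) :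
    formalEuler a ℓ = ∏' i, geomFactor (a i) (ℓ i) := rfl

theorem geomFactor_eq_mk {a : ℚ} {k : ℕ} (hk : 1 ≤ k) :
    geomFactor a k = mk fun m => if k ∣ m then a ^ (m / k) else 0 := by
  have h0 : constantCoeff (1 - C a * X ^ k : ℚ⟦X⟧) ≠ 0 := by
    simp [show k ≠ 0 by omega]
  rw [geomFactor, PowerSeries.inv_eq_iff_mul_eq_one h0]
  ext m
  rw [mul_sub, mul_one, map_sub, ← mul_assoc, mul_comm _ (C a), mul_assoc, coeff_C_mul,
    coeff_mul_X_pow', coeff_mk, coeff_one]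
  rcases Nat.eq_zero_or_pos m with rfl | hm
  · simp [show k ≠ 0 by omega]
  by_cases hkm : k ≤ m
  · obtain ⟨j, rfl⟩ := Nat.exists_eq_add_of_le hkm
    rw [if_pos hkm, coeff_mk, if_neg hm.ne', Nat.add_sub_cancel_left]
    by_cases hj : k ∣ j
    · rw [if_pos hj, if_pos ((Nat.dvd_add_right (dvd_refl k)).2 hj),
        Nat.add_div_left _ hk, pow_succ]
      ring
    · rw [if_neg hj, if_neg (fun h => hj ((Nat.dvd_add_right (dvd_refl k)).1 h))]
      ring
  · rw [if_neg hkm, if_neg hm.ne', if_neg fun h => hkm (Nat.le_of_dvd hm h)]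
    ring

theorem coeff_geomFactor {a : ℚ} {k : ℕ} (hk : 1 ≤ k) (m : ℕ) :
    coeff m (geomFactor a k) = if k ∣ m then a ^ (m / k) else 0 := by
  rw [geomFactor_eq_mk hk, coeff_mk]

theorem coeff_zero_geomFactor {a : ℚ} {k : ℕ} (hk : 1 ≤ k) : coeff 0 (geomFactor a k) = 1 := by
  simp [coeff_geomFactor hk]

/-- The logarithmic derivative `X G' / G` of the Euler factor `G = (1 - a X ^ k)⁻¹`. -/
def geomLogDeriv (a : ℚ) (k : ℕ) : ℚ⟦X⟧ := geomFactor a k * C (a * k) * X ^ k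

theorem coeff_geomLogDeriv {a : ℚ} {k : ℕ} (hk : 1 ≤ k) {m : ℕ} (hm : 1 ≤ m) :
    coeff m (geomLogDeriv a k) = if k ∣ m then (k : ℚ) * a ^ (m / k) else 0 := by
  rw [geomLogDeriv, coeff_mul_X_pow', mul_comm _ (C _), coeff_C_mul]
  by_cases hkm : k ≤ m
  · obtain ⟨j, rfl⟩ := Nat.exists_eq_add_of_le hkm
    rw [if_pos hkm, Nat.add_sub_cancel_left, coeff_geomFactor hk]
    by_cases hj : k ∣ j
    · rw [if_pos hj, if_pos ((Nat.dvd_add_right (dvd_refl k)).2 hj),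
        Nat.add_div_left _ hk, pow_succ]
      ring
    · rw [if_neg hj, if_neg (fun h => hj ((Nat.dvd_add_right (dvd_refl k)).1 h))]
      ring
  · rw [if_neg hkm, if_neg fun h => hkm (Nat.le_of_dvd hm h)]

theorem coeff_zero_geomLogDeriv {a : ℚ} {k : ℕ} (hk : 1 ≤ k) :
    coeff 0 (geomLogDeriv a k) = 0 := by
  rw [geomLogDeriv, coeff_mul_X_pow', if_neg (by omega)]

theorem coeff_zero_prod_geomFactor {ι : Type*} {W : ι → ℚ} {ℓ : ι → ℕ} (hℓ : ∀ i, 1 ≤ ℓ i)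
    (s : Finset ι) : coeff 0 (∏ i ∈ s, geomFactor (W i) (ℓ i)) = 1 := by
  rw [coeff_zero_eq_constantCoeff_apply, map_prod]
  exact prod_eq_one fun i _ => by
    rw [← coeff_zero_eq_constantCoeff_apply, coeff_zero_geomFactor (hℓ i)]

theorem X_mul_derivative_geomFactor {a : ℚ} {k : ℕ} (hk : 1 ≤ k) :
    X * d⁄dX ℚ (geomFactor a k) = geomFactor a k * geomLogDeriv a k := by
  obtain ⟨k, rfl⟩ := Nat.exists_eq_add_of_le' hk
  have h : d⁄dX ℚ (1 - C a * X ^ (k + 1) : ℚ⟦X⟧) = -(C (a * (k + 1 : ℕ)) * X ^ k) := by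
    have h1 : d⁄dX ℚ (1 : ℚ⟦X⟧) = 0 := by simp
    rw [map_sub, h1, Derivation.leibniz, Derivation.leibniz_pow, derivative_C, derivative_X]
    simp
    ring
  rw [geomLogDeriv, geomFactor, derivative_inv', h]
  ring

theorem X_mul_derivative_prod {ι : Type*} (s : Finset ι) (g A : ι → ℚ⟦X⟧)
    (h : ∀ i ∈ s, X * d⁄dX ℚ (g i) = g i * A i) :
    X * d⁄dX ℚ (∏ i ∈ s, g i) = (∏ i ∈ s, g i) * ∑ i ∈ s, A i := by
  classical
  induction s using Finset.induction_on with
  | empty => simp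
  | insert a s ha ih =>
    rw [prod_insert ha, sum_insert ha, Derivation.leibniz, smul_eq_mul, smul_eq_mul, mul_add]
    have h1 := h a (mem_insert_self _ _)
    have h2 := ih fun i hi => h i (mem_insert_of_mem hi)
    linear_combination (∏ i ∈ s, g i) * h1 + g a * h2

/-- A power series with constant term `1` is determined up to degree `N` by its logarithmic
derivative up to degree `N`. -/
theorem coeff_eq_of_logDeriv_eq {g h A B : ℚ⟦X⟧} (hg : X * d⁄dX ℚ g = g * A)
    (hh : X * d⁄dX ℚ h = h * B) (hg0 : coeff 0 g = 1) (hh0 : coeff 0 h = 1)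
    (hA : coeff 0 A = 0) (hB : coeff 0 B = 0) {N : ℕ}
    (hAB : ∀ m, 1 ≤ m → m ≤ N → coeff m A = coeff m B) :
    ∀ m ≤ N, coeff m g = coeff m h := by
  intro m
  induction m using Nat.strong_induction_on with
  | _ m ih =>
    intro hm
    rcases m with _ | m
    · rw [hg0, hh0]
    have e1 := congrArg (coeff (m + 1)) hg
    have e2 := congrArg (coeff (m + 1)) hh
    rw [coeff_succ_X_mul, coeff_derivative, coeff_mul] at e1 e2
    have e3 : ∑ p ∈ antidiagonal (m + 1), coeff p.1 g * coeff p.2 A =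
        ∑ p ∈ antidiagonal (m + 1), coeff p.1 h * coeff p.2 B := by
      refine sum_congr rfl fun p hp => ?_
      rw [HasAntidiagonal.mem_antidiagonal] at hp
      rcases Nat.eq_zero_or_pos p.2 with h0 | h0
      · rw [h0, hA, hB, mul_zero, mul_zero]
      · rw [ih p.1 (by omega) (by omega), hAB p.2 h0 (by omega)]
    exact mul_right_cancel₀ (by positivity : (m : ℚ) + 1 ≠ 0) (e1.trans (e3.trans e2.symm))

/-- If the divisor sums of `f` are the powers of `W`, then the Euler product
`∏ (1 - X ^ {l f c})⁻¹` is `(1 - W X ^ l)⁻¹`: both sides have the same logarithmic derivative. -/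
theorem hasProd_geomFactor {κ : Type*} {f : κ → ℕ} {W l : ℕ} (hl : 1 ≤ l) (hf : ∀ c, 1 ≤ f c)
    (hcount : HasDivisorSums f W) :
    HasProd (fun c => geomFactor 1 (f c * l)) (geomFactor W l) := by
  classical
  have hfl : ∀ c, 1 ≤ f c * l := fun c => Nat.mul_pos (hf c) hl
  choose! S hS hSum using hcount
  rw [HasProd, WithPiTopology.tendsto_iff_coeff_tendsto]
  intro N
  refine tendsto_const_nhds.congr' ?_
  rw [SummationFilter.unconditional_filter]
  filter_upwards [eventually_ge_atTop ((Finset.Icc 1 N).biUnion S)] with s hs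
  refine (coeff_eq_of_logDeriv_eq (X_mul_derivative_prod s _ (fun c => geomLogDeriv 1 (f c * l))
    fun c _ => X_mul_derivative_geomFactor (hfl c)) (X_mul_derivative_geomFactor hl)
    (coeff_zero_prod_geomFactor hfl s) (coeff_zero_geomFactor hl) ?_
    (coeff_zero_geomLogDeriv hl) ?_ N le_rfl).symm
  · rw [map_sum]
    exact sum_eq_zero fun c _ => coeff_zero_geomLogDeriv (hfl c)
  · intro m hm1 hmN
    rw [map_sum, coeff_geomLogDeriv hl hm1, sum_congr rfl fun c _ =>
      coeff_geomLogDeriv (hfl c) hm1]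
    by_cases hlm : l ∣ m
    · obtain ⟨n, rfl⟩ := hlm
      have hn1 : 1 ≤ n := Nat.pos_of_mul_pos_left hm1
      have hnN : n ≤ N := (Nat.le_mul_of_pos_left n hl).trans hmN
      have hsub : S n ⊆ s := (subset_biUnion_of_mem S (mem_Icc.2 ⟨hn1, hnN⟩)).trans hs
      rw [if_pos (dvd_mul_right l n), Nat.mul_div_cancel_left _ hl, ← sum_subset hsub]
      · rw [← Nat.cast_pow, ← hSum n hn1, Nat.cast_sum, mul_sum]
        refine sum_congr rfl fun c hc => ?_
        rw [if_pos, one_pow, mul_one, Nat.cast_mul, mul_comm]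
        rw [mul_comm]
        exact Nat.mul_dvd_mul_left l ((hS n hn1 c).1 hc)
      · intro c _ hc
        rw [if_neg]
        intro h
        rw [mul_comm] at h
        exact hc ((hS n hn1 c).2 (Nat.dvd_of_mul_dvd_mul_left hl h))
    · rw [if_neg hlm]
      exact sum_eq_zero fun c _ => if_neg fun h => hlm ((dvd_mul_left l _).trans h)

theorem coeff_prod_geomFactor_nonneg {ι : Type*} {W ℓ : ι → ℕ} (hℓ : ∀ i, 1 ≤ ℓ i)
    (s : Finset ι) (n : ℕ) : 0 ≤ coeff n (∏ i ∈ s, geomFactor (W i) (ℓ i)) := by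
  classical
  induction s using Finset.induction_on generalizing n with
  | empty =>
    rw [prod_empty, coeff_one]
    split_ifs <;> simp
  | insert a s ha ih =>
    rw [prod_insert ha, coeff_mul]
    refine sum_nonneg fun p _ => mul_nonneg ?_ (ih _)
    rw [coeff_geomFactor (hℓ a)]
    split_ifs <;> positivity

/-- An Euler product with natural weights converges coefficientwise exactly if there are finitely
many factors of each degree: the coefficients of the partial products are nonnegative, so a new
factor of degree `n` raises the `n`-th coefficient by at least `1`. -/
theorem formalConverges_natCast_iff {ι : Type*} {W ℓ : ι → ℕ} (hℓ : ∀ i, 1 ≤ ℓ i) :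
    FormalConverges (fun i => (W i : ℚ)) ℓ ↔ ∀ n, {i | ℓ i = n ∧ W i ≠ 0}.Finite := by
  classical
  constructor
  · rintro ⟨P, hP⟩ n
    change Tendsto _ _ _ at hP
    rw [WithPiTopology.tendsto_iff_coeff_tendsto] at hP
    have h1 := (hP n).eventually (Metric.ball_mem_nhds _ (show (0 : ℝ) < 1 / 2 by norm_num))
    rw [SummationFilter.unconditional_filter] at h1
    obtain ⟨s, hs⟩ := eventually_atTop.1 h1
    refine s.finite_toSet.subset ?_
    rintro i ⟨hi, hW⟩
    by_contra his
    have his : i ∉ s := his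
    have d1 := hs s le_rfl
    have d2 := hs (insert i s) (Finset.subset_insert i s)
    have d3 : dist (coeff n (∏ j ∈ insert i s, geomFactor (W j) (ℓ j)))
        (coeff n (∏ j ∈ s, geomFactor (W j) (ℓ j))) < 1 := by
      refine (dist_triangle_right _ _ (coeff n P)).trans_lt ?_
      have := add_lt_add (Metric.mem_ball.1 d2) (Metric.mem_ball.1 d1)
      norm_num at this
      exact this
    have hn : 1 ≤ n := hi ▸ hℓ i
    have h2 : (W i : ℚ) + coeff n (∏ j ∈ s, geomFactor (W j) (ℓ j)) ≤
        coeff n (∏ j ∈ insert i s, geomFactor (W j) (ℓ j)) := by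
      rw [prod_insert his, coeff_mul]
      have hsub : ({(n, 0), (0, n)} : Finset (ℕ × ℕ)) ⊆ antidiagonal n := by
        intro p hp
        rw [mem_insert, mem_singleton] at hp
        rcases hp with rfl | rfl <;> simp
      refine le_trans (le_of_eq ?_) (sum_le_sum_of_subset_of_nonneg hsub fun p _ _ => ?_)
      · rw [sum_pair (by simp; omega), coeff_zero_geomFactor (hℓ i), one_mul,
          coeff_geomFactor (hℓ i), if_pos (by rw [hi]), hi, Nat.div_self hn, pow_one,
          coeff_zero_prod_geomFactor hℓ, mul_one]
      · refine mul_nonneg ?_ (coeff_prod_geomFactor_nonneg hℓ s _)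
        rw [coeff_geomFactor (hℓ i)]
        split_ifs <;> positivity
    have h3 : (1 : ℚ) ≤ W i := by exact_mod_cast Nat.one_le_iff_ne_zero.2 hW
    rw [Rat.dist_eq] at d3
    have h4 := (le_abs_self _).trans_lt d3
    have h5 : coeff n (∏ j ∈ insert i s, geomFactor (W j) (ℓ j)) -
        coeff n (∏ j ∈ s, geomFactor (W j) (ℓ j)) < 1 := by exact_mod_cast h4
    linarith
  · intro hfin
    have key : Multipliable fun i => 1 + (geomFactor (W i) (ℓ i) - 1) := by
      refine multipliable_one_add_of_summable_prod ?_
      refine (WithPiTopology.summable_iff_summable_coeff _).2 fun n =>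
        summable_of_hasFiniteSupport ?_
      have hF : (⋃ m ∈ Finset.range (n + 1), {i | ℓ i = m ∧ W i ≠ 0}).Finite :=
        Set.Finite.biUnion (Finset.finite_toSet _) fun m _ => hfin m
      refine (hF.toFinset.powerset.finite_toSet).subset fun s hs => ?_
      rw [mem_coe, mem_powerset]
      intro i hi
      have hdvd : geomFactor (W i) (ℓ i) - 1 ∣ ∏ j ∈ s, (geomFactor (W j) (ℓ j) - 1) :=
        dvd_prod_of_mem _ hi
      have hX : (X : ℚ⟦X⟧) ^ ℓ i ∣ geomFactor (W i) (ℓ i) - 1 := by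
        rw [X_pow_dvd_iff]
        intro m hm
        rw [map_sub, coeff_geomFactor (hℓ i), coeff_one]
        rcases Nat.eq_zero_or_pos m with rfl | h0
        · simp
        · rw [if_neg fun h => absurd (Nat.le_of_dvd h0 h) (by omega), if_neg h0.ne', sub_zero]
      rw [Set.Finite.mem_toFinset, Set.mem_iUnion₂]
      refine ⟨ℓ i, ?_, rfl, fun hW => hs ?_⟩
      · by_contra hle
        exact hs (X_pow_dvd_iff.1 (hX.trans hdvd) n (by
          rw [Finset.mem_range] at hle
          omega))
      · have h0 : geomFactor (W i) (ℓ i) - 1 = 0 := by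
          rw [geomFactor, hW]
          simp
        rw [h0] at hdvd
        change coeff n (∏ j ∈ s, (geomFactor (W j) (ℓ j) - 1)) = 0
        rw [zero_dvd_iff.1 hdvd, map_zero]
    refine key.congr fun i => ?_
    rw [add_sub_cancel, geomFactor]

/-- Separation needed for regrouping infinite products of formal power series. -/
instance instRegularSpacePowerSeries : RegularSpace ℚ⟦X⟧ := by
  unfold PowerSeries MvPowerSeries
  exact inferInstanceAs (RegularSpace ((Unit →₀ ℕ) → ℚ))

variable {ι : Type*} {κ : ι → Type*} {W ℓ : ι → ℕ} {f : ∀ i, κ i → ℕ}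

/-- Families of factors grouped over an index set: the formal Euler product over the total family
of the `(1 - X ^ {ℓ_i f_c})⁻¹` agrees with that of the `(1 - W_i X ^ ℓ_i)⁻¹`. -/
theorem formalConverges_sigma_iff (hℓ : ∀ i, 1 ≤ ℓ i) (hf : ∀ i c, 1 ≤ f i c)
    (hcount : ∀ i, HasDivisorSums (f i) (W i)) :
    FormalConverges (fun i => (W i : ℚ)) ℓ ↔
      FormalConverges (fun _ : Σ i, κ i => 1) (fun p => f p.1 p.2 * ℓ p.1) := by
  have h1 : FormalConverges (fun _ : Σ i, κ i => (1 : ℚ)) (fun p => f p.1 p.2 * ℓ p.1) ↔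
      FormalConverges (fun p : Σ i, κ i => (((fun _ => 1) p : ℕ) : ℚ))
        (fun p => f p.1 p.2 * ℓ p.1) := by simp
  have hfℓ : ∀ p : Σ i, κ i, 1 ≤ f p.1 p.2 * ℓ p.1 := fun p => Nat.mul_pos (hf p.1 p.2) (hℓ p.1)
  rw [h1, formalConverges_natCast_iff hℓ, formalConverges_natCast_iff hfℓ]
  choose S hS hSum using hcount
  constructor
  · intro h n
    rcases Nat.eq_zero_or_pos n with rfl | hn
    · refine Set.finite_empty.subset ?_
      rintro p ⟨hp, -⟩
      exact absurd hp (Nat.one_le_iff_ne_zero.1 (hfℓ p))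
    have hF : (⋃ m ∈ Finset.range (n + 1), {i | ℓ i = m ∧ W i ≠ 0}).Finite :=
      Set.Finite.biUnion (Finset.finite_toSet _) fun m _ => h m
    refine (Finset.finite_toSet (hF.toFinset.sigma fun i => S i n hn)).subset ?_
    rintro ⟨i, c⟩ ⟨hp, -⟩
    have hp : f i c * ℓ i = n := hp
    rw [mem_coe, mem_sigma, Set.Finite.mem_toFinset, Set.mem_iUnion₂]
    have hc : c ∈ S i n hn := (hS i n hn c).2 ⟨_, hp.symm⟩
    refine ⟨⟨ℓ i, ?_, rfl, fun hW => ?_⟩, hc⟩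
    · have := Nat.le_mul_of_pos_left (ℓ i) (hf i c)
      rw [Finset.mem_range]
      omega
    · have h2 := hSum i n hn
      rw [hW, zero_pow hn.ne'] at h2
      have := (Finset.sum_eq_zero_iff.1 h2) c hc
      have := hf i c
      omega
  · intro h n
    refine ((h n).image Sigma.fst).subset ?_
    rintro i ⟨hi, hW⟩
    have h2 := hSum i 1 le_rfl
    rw [pow_one] at h2
    obtain ⟨c, hc, -⟩ := Finset.exists_ne_zero_of_sum_ne_zero (h2 ▸ hW)
    have h3 : f i c = 1 := Nat.dvd_one.1 ((hS i 1 le_rfl c).1 hc)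
    exact ⟨⟨i, c⟩, ⟨by rw [h3, one_mul, hi], one_ne_zero⟩, rfl⟩

theorem formalEuler_sigma (hℓ : ∀ i, 1 ≤ ℓ i) (hf : ∀ i c, 1 ≤ f i c)
    (hcount : ∀ i, HasDivisorSums (f i) (W i))
    (h : FormalConverges (fun i => (W i : ℚ)) ℓ) :
    formalEuler (fun _ : Σ i, κ i => 1) (fun p => f p.1 p.2 * ℓ p.1) =
      formalEuler (fun i => (W i : ℚ)) ℓ := by
  have h1 : HasProd (fun p : Σ i, κ i => geomFactor 1 (f p.1 p.2 * ℓ p.1))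
      (formalEuler (fun _ : Σ i, κ i => 1) (fun p => f p.1 p.2 * ℓ p.1)) :=
    Multipliable.hasProd ((formalConverges_sigma_iff hℓ hf hcount).1 h)
  have h3 : ∀ i, HasProd (fun c : κ i => geomFactor 1 (f i c * ℓ i)) (geomFactor (W i) (ℓ i)) :=
    fun i => hasProd_geomFactor (hℓ i) (hf i) (hcount i)
  have h2 : HasProd (fun i => geomFactor (W i) (ℓ i)) _ :=
    HasProd.sigma (f := fun p : Σ i, κ i => geomFactor 1 (f p.1 p.2 * ℓ p.1))
      (g := fun i => geomFactor (W i) (ℓ i)) h1 h3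
  rw [formalEuler_eq_tprod (fun i => (W i : ℚ))]
  exact h2.tprod_eq.symm

end Formal

/-! ### Euler products at a complex number -/

section Analytic

open Finset Filter

theorem hasSum_pow_div_natCast {x : ℝ} (h : |x| < 1) :
    HasSum (fun n : ℕ => x ^ n / n) (-Real.log (1 - x)) := by
  have h1 := Real.hasSum_pow_div_log_of_abs_lt_one h
  have h2 : HasSum (fun n : ℕ => x ^ (n + 1) / ((n + 1 : ℕ) : ℝ)) (-Real.log (1 - x)) := by
    simpa using h1
  simpa using (hasSum_nat_add_iff (f := fun n : ℕ => x ^ n / n) 1).1 h2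

/-- The term `f z ^ n / n`, for `f ∣ n`, of the expansion of `-log (1 - z ^ f)` in powers of `z`. -/
def logTerm {K : Type*} [Field K] (z : K) (f n : ℕ) : K := if f ∣ n then f * (z ^ n / n) else 0

theorem norm_logTerm (z : ℂ) (f n : ℕ) : ‖logTerm z f n‖ = logTerm ‖z‖ f n := by
  unfold logTerm
  split_ifs <;> simp

theorem logTerm_nonneg {r : ℝ} (hr : 0 ≤ r) (f n : ℕ) : 0 ≤ logTerm r f n := by
  unfold logTerm
  split_ifs <;> positivity

theorem logTerm_self {K : Type*} [Field K] [CharZero K] (z : K) {f : ℕ} (hf : 1 ≤ f) :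
    logTerm z f f = z ^ f := by
  rw [logTerm, if_pos (dvd_refl f)]
  exact mul_div_cancel₀ _ (Nat.cast_ne_zero.2 (by omega))

theorem hasSum_logTerm_iff {K : Type*} [NormedField K] [CharZero K] {z a : K} {f : ℕ}
    (hf : 1 ≤ f) : HasSum (logTerm z f) a ↔ HasSum (fun n : ℕ => (z ^ f) ^ n / n) a := by
  have hinj : Function.Injective fun n : ℕ => f * n := fun a b h => Nat.eq_of_mul_eq_mul_left hf h
  rw [← hinj.hasSum_iff]
  · refine iff_of_eq (congrArg (fun F => HasSum F a) (funext fun n => ?_))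
    have h0 : (f : K) ≠ 0 := Nat.cast_ne_zero.2 (by omega)
    simp only [Function.comp_apply, logTerm, if_pos (dvd_mul_right f n), pow_mul, Nat.cast_mul]
    rw [← mul_div_assoc, mul_div_mul_left _ _ h0]
  · intro n hn
    rw [logTerm, if_neg]
    rintro ⟨k, rfl⟩
    exact hn ⟨k, rfl⟩

theorem neg_log_one_sub_le {x : ℝ} (hx : x < 1) : -Real.log (1 - x) ≤ x / (1 - x) := by
  have h1 : 0 < 1 - x := by linarith
  have h2 := Real.one_sub_inv_le_log_of_pos h1
  have h3 : x / (1 - x) = (1 - x)⁻¹ - 1 := by field_simp; ring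
  linarith

section Fibre

variable {κ : Type*} {f : κ → ℕ} {W : ℕ}

theorem hasSum_logTerm_fibre {K : Type*} [NormedField K]
    (hcount : HasDivisorSums f W) (z : K) (n : ℕ) :
    HasSum (fun c => logTerm z (f c) n) ((W * z) ^ n / n) := by
  rcases Nat.eq_zero_or_pos n with rfl | hn
  · simp [logTerm]
  obtain ⟨s, hs, hsum⟩ := hcount n hn
  have h : ((W * z) ^ n / n : K) = ∑ c ∈ s, logTerm z (f c) n := by
    rw [mul_pow, ← Nat.cast_pow, ← hsum, Nat.cast_sum, mul_div_assoc, sum_mul]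
    exact sum_congr rfl fun c hc => by rw [logTerm, if_pos ((hs c).1 hc)]
  rw [h]
  exact hasSum_sum_of_ne_finset_zero fun c hc => if_neg fun hd => hc ((hs c).2 hd)

theorem one_le_of_fibre (hcount : HasDivisorSums f W) (hf : ∀ c, 1 ≤ f c) (c : κ) : 1 ≤ W := by
  obtain ⟨s, hs, hsum⟩ := hcount (f c) (hf c)
  have h1 : f c ≤ ∑ c ∈ s, f c :=
    single_le_sum (f := f) (fun _ _ => Nat.zero_le _) ((hs c).2 dvd_rfl)
  by_contra hW
  have hW : W = 0 := by omega
  have := hf c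
  rw [hsum, hW, zero_pow (by omega)] at h1
  omega

theorem summable_logTerm_of_lt_one (hcount : HasDivisorSums f W) {r : ℝ} (hr : 0 ≤ r)
    (h : W * r < 1) :
    Summable fun p : ℕ × κ => logTerm r (f p.2) p.1 := by
  refine (summable_prod_of_nonneg fun p => logTerm_nonneg hr _ _).2
    ⟨fun n => (hasSum_logTerm_fibre hcount r n).summable, ?_⟩
  refine (hasSum_pow_div_natCast ?_).summable.congr fun n =>
    (hasSum_logTerm_fibre hcount r n).tsum_eq.symm
  rwa [abs_of_nonneg (by positivity)]

/-- The terms `r ^ f c` are among the terms `f c r ^ n / n` of the double sum, at `n = f c`. -/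
theorem summable_pow_fibre (hcount : HasDivisorSums f W) (hf : ∀ c, 1 ≤ f c) {r : ℝ}
    (hr : 0 ≤ r) (h : W * r < 1) :
    Summable (fun c => r ^ f c) ∧ ∑' c, r ^ f c ≤ -Real.log (1 - W * r) := by
  have hs := summable_logTerm_of_lt_one hcount hr h
  have hinj : Function.Injective fun c : κ => ((f c, c) : ℕ × κ) := fun a b hab =>
    congrArg Prod.snd hab
  have hcomp : (fun c => r ^ f c) = (fun p : ℕ × κ => logTerm r (f p.2) p.1) ∘
      fun c : κ => ((f c, c) : ℕ × κ) := funext fun c => (logTerm_self r (hf c)).symm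
  have h1 := hs.hasSum.prod_fiberwise fun n => hasSum_logTerm_fibre hcount r n
  have h2 := hasSum_pow_div_natCast (x := W * r) (by rwa [abs_of_nonneg (by positivity)])
  rw [h2.unique h1, hcomp]
  exact ⟨hs.comp_injective hinj,
    tsum_comp_le_tsum_of_inj hs (fun p => logTerm_nonneg hr _ _) hinj⟩

/-- The fibres of the Euler product have the expected value: both sides are the exponential of the
double sum of the terms `f c z ^ n / n` with `f c ∣ n`. -/
theorem hasProd_one_sub_pow_inv (hcount : HasDivisorSums f W) (hf : ∀ c, 1 ≤ f c) {z : ℂ}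
    (h : W * ‖z‖ < 1) :
    HasProd (fun c => (1 - z ^ f c)⁻¹) (1 - W * z)⁻¹ := by
  have hs : Summable fun p : ℕ × κ => logTerm z (f p.2) p.1 := by
    refine Summable.of_norm ?_
    simpa only [norm_logTerm] using summable_logTerm_of_lt_one hcount (norm_nonneg z) h
  have hz : ‖(W : ℂ) * z‖ < 1 := by simpa using h
  have hne : ∀ {x : ℂ}, ‖x‖ < 1 → Complex.exp (-Complex.log (1 - x)) = (1 - x)⁻¹ := by
    intro x hx
    rw [Complex.exp_neg, Complex.exp_log]
    rintro h0
    rw [sub_eq_zero] at h0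
    simp [← h0] at hx
  have hzc : ∀ c, ‖z ^ f c‖ < 1 := by
    intro c
    rw [norm_pow]
    refine pow_lt_one₀ (norm_nonneg z) (lt_of_le_of_lt ?_ h) (by have := hf c; omega)
    exact le_mul_of_one_le_left (norm_nonneg z) (by exact_mod_cast one_le_of_fibre hcount hf c)
  have h1 := hs.hasSum.prod_fiberwise fun n => hasSum_logTerm_fibre hcount z n
  have h2 := (Complex.hasSum_taylorSeries_neg_log hz).unique h1
  have h3 : HasSum (fun c => -Complex.log (1 - z ^ f c)) (-Complex.log (1 - W * z)) := by
    rw [h2]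
    refine (((Equiv.prodComm κ ℕ).hasSum_iff).2 hs.hasSum).prod_fiberwise fun c => ?_
    exact (hasSum_logTerm_iff (hf c)).2 (Complex.hasSum_taylorSeries_neg_log (hzc c))
  have h4 := h3.cexp
  rw [hne hz] at h4
  exact h4.congr fun s => prod_congr rfl fun c _ => hne (hzc c)

/-- There are `W` indices with `f c = 1`. -/
theorem mul_le_tsum_pow_fibre (hcount : HasDivisorSums f W) {r : ℝ} (hr : 0 ≤ r)
    (hs : Summable fun c => r ^ f c) :
    W * r ≤ ∑' c, r ^ f c := by
  obtain ⟨s, hmem, hsum⟩ := hcount 1 le_rfl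
  refine le_trans (le_of_eq ?_) (hs.sum_le_tsum s fun _ _ => by positivity)
  have h1 : ∀ c ∈ s, f c = 1 := fun c hc => Nat.dvd_one.1 ((hmem c).1 hc)
  rw [← pow_one W, ← hsum, Nat.cast_sum, sum_mul]
  exact sum_congr rfl fun c hc => by rw [h1 c hc, Nat.cast_one, one_mul, pow_one]

/-- Conversely, convergence of `∑ r ^ f c` forces `W r < 1`: otherwise the double sum of the
terms `f c r ^ n / n` would dominate the harmonic series. -/
theorem mul_lt_one_of_summable_pow (hcount : HasDivisorSums f W) (hf : ∀ c, 1 ≤ f c) {r : ℝ}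
    (hr : 0 ≤ r) (hr1 : r < 1)
    (hs : Summable fun c => r ^ f c) : W * r < 1 := by
  have hrc : ∀ c, r ^ f c ≤ r := fun c => pow_le_of_le_one hr hr1.le (by have := hf c; omega)
  have hsum : ∀ c, HasSum (logTerm r (f c)) (-Real.log (1 - r ^ f c)) := fun c =>
    (hasSum_logTerm_iff (hf c)).2 (hasSum_pow_div_natCast (by
      rw [abs_of_nonneg (by positivity)]
      exact (hrc c).trans_lt hr1))
  have h1 : Summable fun p : κ × ℕ => logTerm r (f p.1) p.2 := by
    refine (summable_prod_of_nonneg fun p => logTerm_nonneg hr _ _).2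
      ⟨fun c => (hsum c).summable, ?_⟩
    refine Summable.of_nonneg_of_le (fun c => tsum_nonneg fun n => logTerm_nonneg hr _ _)
      (fun c => ?_) (hs.mul_right (1 - r)⁻¹)
    rw [(hsum c).tsum_eq]
    refine (neg_log_one_sub_le ((hrc c).trans_lt hr1)).trans ?_
    rw [div_eq_mul_inv]
    have h3 : 0 < 1 - r := by linarith
    have := hrc c
    gcongr
  have h2 : Summable fun p : ℕ × κ => logTerm r (f p.2) p.1 :=
    ((Equiv.prodComm ℕ κ).summable_iff (f := fun p : κ × ℕ => logTerm r (f p.1) p.2)).2 h1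
  have h3 := ((summable_prod_of_nonneg fun p => logTerm_nonneg hr _ _).1 h2).2
  by_contra hW
  rw [not_lt] at hW
  refine Real.not_summable_one_div_natCast (Summable.of_nonneg_of_le (fun n => by positivity)
    (fun n => ?_) h3)
  dsimp only
  rw [(hasSum_logTerm_fibre hcount r n).tsum_eq]
  gcongr
  exact one_le_pow₀ hW

end Fibre

/-- An absolutely convergent Euler product is the exponential of the sum of the logarithms of its
factors, so it does converge. -/
theorem AbsConverges.hasProd {ι : Type*} {a : ι → ℚ} {ℓ : ι → ℕ} {u : ℂ}
    (h : AbsConverges a ℓ u) :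
    HasProd (fun i => (1 - (a i : ℂ) * u ^ ℓ i)⁻¹) (eulerValue a ℓ u) := by
  have h1 : Summable fun i => -((a i : ℂ) * u ^ ℓ i) := h.2.of_norm.neg
  have h2 := (Complex.summable_log_one_add_of_summable h1).neg.hasSum.cexp
  refine Multipliable.hasProd (Multipliable.congr h2.multipliable fun i => ?_)
  rw [Function.comp_apply, ← sub_eq_add_neg, Complex.exp_neg, Complex.exp_log]
  intro h0
  rw [sub_eq_zero] at h0
  have := h.1 i
  rw [← h0, norm_one] at this
  exact lt_irrefl _ this

variable {ι : Type*} {κ : ι → Type*} {W ℓ : ι → ℕ} {f : ∀ i, κ i → ℕ}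

theorem absConverges_sigma_iff (hf : ∀ i c, 1 ≤ f i c)
    (hcount : ∀ i, HasDivisorSums (f i) (W i)) (u : ℂ) :
    AbsConverges (fun i => (W i : ℚ)) ℓ u ↔
      AbsConverges (fun _ : Σ i, κ i => 1) (fun p => f p.1 p.2 * ℓ p.1) u := by
  have e1 : ∀ i, ‖((W i : ℚ) : ℂ) * u ^ ℓ i‖ = W i * ‖u‖ ^ ℓ i := fun i => by simp
  have e2 : ∀ p : Σ i, κ i, ‖((1 : ℚ) : ℂ) * u ^ (f p.1 p.2 * ℓ p.1)‖ =
      (‖u‖ ^ ℓ p.1) ^ f p.1 p.2 := fun p => by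
    rw [Rat.cast_one, one_mul, norm_pow, mul_comm, pow_mul]
  have hr : ∀ i, 0 ≤ ‖u‖ ^ ℓ i := fun i => by positivity
  simp only [AbsConverges, e1, e2]
  rw [summable_sigma_of_nonneg fun p => pow_nonneg (hr _) _]
  constructor
  · rintro ⟨hlt, hsum⟩
    refine ⟨fun ⟨i, c⟩ => pow_lt_one₀ (hr i) (lt_of_le_of_lt ?_ (hlt i))
        (by have := hf i c; dsimp only; omega),
      fun i => (summable_pow_fibre (hcount i) (hf i) (hr i) (hlt i)).1, ?_⟩
    · exact le_mul_of_one_le_left (hr i)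
        (by exact_mod_cast one_le_of_fibre (hcount i) (hf i) c)
    · have h1 := (Real.summable_log_one_add_of_summable hsum.neg).neg
      refine Summable.of_nonneg_of_le (fun i => tsum_nonneg fun c => pow_nonneg (hr _) _)
        (fun i => (summable_pow_fibre (hcount i) (hf i) (hr i) (hlt i)).2) ?_
      simpa only [sub_eq_add_neg] using h1
  · rintro ⟨hlt, hsum, hsum'⟩
    refine ⟨fun i => ?_, Summable.of_nonneg_of_le (fun i => mul_nonneg (Nat.cast_nonneg _) (hr i))
      (fun i => mul_le_tsum_pow_fibre (hcount i) (hr i) (hsum i)) hsum'⟩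
    rcases isEmpty_or_nonempty (κ i) with hκ | ⟨⟨c⟩⟩
    · have := mul_le_tsum_pow_fibre (hcount i) (hr i) (hsum i)
      rw [tsum_empty] at this
      linarith
    · refine mul_lt_one_of_summable_pow (hcount i) (hf i) (hr i) ?_ (hsum i)
      exact (pow_lt_one_iff_of_nonneg (hr i) (Nat.one_le_iff_ne_zero.1 (hf i c))).1 (hlt ⟨i, c⟩)

theorem eulerValue_sigma (hf : ∀ i c, 1 ≤ f i c)
    (hcount : ∀ i, HasDivisorSums (f i) (W i)) {u : ℂ}
    (h : AbsConverges (fun i => (W i : ℚ)) ℓ u) :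
    eulerValue (fun _ : Σ i, κ i => 1) (fun p => f p.1 p.2 * ℓ p.1) u =
      eulerValue (fun i => (W i : ℚ)) ℓ u := by
  have h1 := ((absConverges_sigma_iff hf hcount u).1 h).hasProd
  have h2 : HasProd (fun i => (1 - ((W i : ℚ) : ℂ) * u ^ ℓ i)⁻¹) _ := h1.sigma fun i => by
    have h3 := hasProd_one_sub_pow_inv (hcount i) (hf i) (z := u ^ ℓ i) (by simpa using h.1 i)
    simpa [pow_mul, mul_comm] using h3
  exact h2.tprod_eq.symm

end Analytic

/-! ### Comparison of the two zeta functions -/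

section Reindex

variable {ι ι' : Type*} (e : ι ≃ ι') {a : ι → ℚ} {ℓ : ι → ℕ} {a' : ι' → ℚ} {ℓ' : ι' → ℕ}

theorem formalConverges_iff_of_equiv (ha : ∀ i, a' (e i) = a i) (hℓ : ∀ i, ℓ' (e i) = ℓ i) :
    FormalConverges a ℓ ↔ FormalConverges a' ℓ' := by
  unfold FormalConverges
  rw [← e.multipliable_iff]
  simp only [Function.comp_def, ha, hℓ]

theorem formalEuler_eq_of_equiv (ha : ∀ i, a' (e i) = a i) (hℓ : ∀ i, ℓ' (e i) = ℓ i) :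
    formalEuler a ℓ = formalEuler a' ℓ' := by
  unfold formalEuler
  rw [← e.tprod_eq]
  simp only [ha, hℓ]

theorem absConverges_iff_of_equiv (ha : ∀ i, a' (e i) = a i) (hℓ : ∀ i, ℓ' (e i) = ℓ i) (u : ℂ) :
    AbsConverges a ℓ u ↔ AbsConverges a' ℓ' u := by
  unfold AbsConverges
  rw [← e.summable_iff, ← e.forall_congr_right]
  simp only [Function.comp_def, ha, hℓ]

theorem eulerValue_eq_of_equiv (ha : ∀ i, a' (e i) = a i) (hℓ : ∀ i, ℓ' (e i) = ℓ i) (u : ℂ) :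
    eulerValue a ℓ u = eulerValue a' ℓ' u := by
  unfold eulerValue
  rw [← e.tprod_eq]
  simp only [ha, hℓ]

end Reindex

section Compare

variable {V : Type u} {T : SimpleGraph V} {Γ : Subgroup (T ≃g T)} {hΓ : ActsWithoutInversions Γ}
  (D : QuotientChoice Γ hΓ)

/-- The winding number of a prime `c` over a primitive cycle `C`: its length in units of the length
of `C`. -/
def windingNumber (C : GraphOfGroups.PrimeCycle D.graph)
    (c : {c : PrimitiveClass V Γ // IsOver (unroll D C) c}) : ℕ :=
  c.1.length T / C.1.length

theorem windingNumber_mul_length (C : GraphOfGroups.PrimeCycle D.graph)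
    (c : {c : PrimitiveClass V Γ // IsOver (unroll D C) c}) :
    windingNumber D C c * C.1.length = c.1.length T :=
  Nat.div_mul_cancel
    (Int.natCast_dvd_natCast.1 ((unroll_spec D C).dvd_of_isPeriod C.2 c.2.isPeriod))

theorem one_le_windingNumber (hT : T.IsTree) (C : GraphOfGroups.PrimeCycle D.graph)
    (c : {c : PrimitiveClass V Γ // IsOver (unroll D C) c}) : 1 ≤ windingNumber D C c := by
  have h := (c.1.exists_line hT hΓ).1
  rw [← windingNumber_mul_length] at h
  exact Nat.pos_of_mul_pos_right h

theorem hasDivisorSums_windingNumber (hT : T.IsTree) (hfin : HasFiniteStabilizers Γ)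
    (hfree : AxisFree Γ) (C : GraphOfGroups.PrimeCycle D.graph) :
    HasDivisorSums (windingNumber D C) (natCycleWeight D C) := fun _ hn =>
  D.sum_length_over hT hfin hfree (unroll_path D C) (length_pos_of_ne_nil C.2.1.1)
    (unroll_spec D C).1 (fun _ hk => (unroll_spec D C).dvd_of_isPeriod C.2 hk) hn

/-- The primes of `π₁` are grouped by the primitive cycles that they wind around. -/
theorem exists_primePi1_equiv (hT : T.IsTree) :
    ∃ Φ : D.graphOfGroups.PrimePi1 D.R ≃ Σ C : GraphOfGroups.PrimeCycle D.graph,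
        {c : PrimitiveClass V Γ // IsOver (unroll D C) c},
      ∀ c, windingNumber D (Φ c).1 (Φ c).2 * (Φ c).1.1.length =
        D.graphOfGroups.primeLength D.R c := by
  obtain ⟨Φ, hΦ⟩ := exists_primitiveClass_equiv (D.groupEquiv hT) (D.coverIso hT)
    (D.coverIso_smul hT) dist_smul_subgroup
  refine ⟨Φ.trans (primesEquiv D hT).symm, fun c => ?_⟩
  rw [windingNumber_mul_length]
  have h : (((Φ.trans (primesEquiv D hT).symm) c).2.1 : PrimitiveClass V Γ) = Φ c :=
    (primesEquiv D hT).apply_symm_apply (Φ c)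
  rw [h, hΦ]
  rfl

/-- If pointwise stabilizers of axes are trivial, the two zeta functions agree. -/
theorem AxisFree.selberg_eq_bassIhara (hT : T.IsTree) (hfin : HasFiniteStabilizers Γ)
    (hfree : AxisFree Γ) :
    ((D.graphOfGroups.BassIharaFormalConverges ↔ D.graphOfGroups.SelbergFormalConverges D.R) ∧
      (D.graphOfGroups.BassIharaFormalConverges →
        D.graphOfGroups.selbergZetaFormal D.R = D.graphOfGroups.bassIharaZetaFormal)) ∧
    ∀ u : ℂ,
      (D.graphOfGroups.BassIharaAbsConverges u ↔ D.graphOfGroups.SelbergAbsConverges D.R u) ∧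
      (D.graphOfGroups.BassIharaAbsConverges u →
        D.graphOfGroups.selbergZeta D.R u = D.graphOfGroups.bassIharaZeta u) := by
  obtain ⟨Φ, hΦ⟩ := exists_primePi1_equiv D hT
  have hW : (fun C : GraphOfGroups.PrimeCycle D.graph => D.graphOfGroups.cycleWeight C.1) =
      fun C => (natCycleWeight D C : ℚ) := funext (cycleWeight_eq_natCycleWeight D hfin)
  have hℓ : ∀ C : GraphOfGroups.PrimeCycle D.graph, 1 ≤ C.1.length := fun C =>
    length_pos_of_ne_nil C.2.1.1
  have hf := one_le_windingNumber D hT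
  have hcount := hasDivisorSums_windingNumber D hT hfin hfree
  -- The weights and lengths of the primes, grouped by the cycles that they wind around.
  let a' : (Σ C : GraphOfGroups.PrimeCycle D.graph,
    {c : PrimitiveClass V Γ // IsOver (unroll D C) c}) → ℚ := fun _ => 1
  let ℓ' : (Σ C : GraphOfGroups.PrimeCycle D.graph,
    {c : PrimitiveClass V Γ // IsOver (unroll D C) c}) → ℕ := fun p =>
      windingNumber D p.1 p.2 * p.1.1.length
  have hone : ∀ c, a' (Φ c) = 1 := fun _ => rfl
  have hlen : ∀ c, ℓ' (Φ c) = D.graphOfGroups.primeLength D.R c := hΦ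
  unfold GraphOfGroups.BassIharaFormalConverges GraphOfGroups.SelbergFormalConverges
    GraphOfGroups.BassIharaAbsConverges GraphOfGroups.SelbergAbsConverges
    GraphOfGroups.bassIharaZeta GraphOfGroups.bassIharaZetaFormal
    GraphOfGroups.selbergZeta GraphOfGroups.selbergZetaFormal
  rw [hW, formalConverges_iff_of_equiv Φ hone hlen, formalEuler_eq_of_equiv Φ hone hlen]
  refine ⟨⟨formalConverges_sigma_iff hℓ hf hcount, formalEuler_sigma hℓ hf hcount⟩, fun u => ?_⟩
  rw [absConverges_iff_of_equiv Φ hone hlen, eulerValue_eq_of_equiv Φ hone hlen]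
  exact ⟨absConverges_sigma_iff hf hcount u, eulerValue_sigma hf hcount⟩

theorem isEmpty_primePi1 (hT : T.IsTree) (h : ∀ g : Γ, ¬ IsHyperbolic V g) :
    IsEmpty (D.graphOfGroups.PrimePi1 D.R) := by
  obtain ⟨Φ, -⟩ := exists_primitiveClass_equiv (D.groupEquiv hT) (D.coverIso hT)
    (D.coverIso_smul hT) dist_smul_subgroup
  refine ⟨fun c => ?_⟩
  obtain ⟨g, -, hg⟩ := (Φ c).2
  exact h g hg.1

end Compare

end TreeZeta

end

theorem mainTheorem1 {V : Type*} (q : ℕ) (T : SimpleGraph V) [T.LocallyFinite]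
    (hT : T.IsTree) (hreg : T.IsRegularOfDegree (q + 1))
    (Γ : Subgroup (T ≃g T)) (hinv : TreeZeta.ActsWithoutInversions Γ)
    (hfin : TreeZeta.HasFiniteStabilizers Γ)
    (c : ℕ) (hc : TreeZeta.IsCentrallyRigid Γ T c)
    (hlat : TreeZeta.IsTreeLattice Γ ∨ c = 1)
    (D : TreeZeta.QuotientChoice Γ hinv) :
    ((D.graphOfGroups.BassIharaFormalConverges ↔ D.graphOfGroups.SelbergFormalConverges D.R) ∧
      (D.graphOfGroups.BassIharaFormalConverges →
        D.graphOfGroups.selbergZetaFormal D.R = D.graphOfGroups.bassIharaZetaFormal ^ c)) ∧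
    ∀ u : ℂ,
      (D.graphOfGroups.BassIharaAbsConverges u ↔ D.graphOfGroups.SelbergAbsConverges D.R u) ∧
      (D.graphOfGroups.BassIharaAbsConverges u →
        D.graphOfGroups.selbergZeta D.R u = D.graphOfGroups.bassIharaZeta u ^ c) := by
  by_cases hyp : ∃ g : Γ, TreeZeta.IsHyperbolic V g
  · obtain ⟨g, hg⟩ := hyp
    obtain ⟨hn, L, hL, hgL⟩ := hg.exists_line hT hinv
    have hc1 : c = 1 := by
      rcases hlat with hlat | hc1
      · obtain ⟨L', g', N, hL', hN, hg', htriv⟩ := hlat.exists_trivial_fixator hT hreg hL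
        exact TreeZeta.eq_one_of_trivial_fixator hT hc hL' hN hg' htriv
      · exact hc1
    subst hc1
    simp only [pow_one]
    exact (TreeZeta.axisFree_of_isCentrallyRigid_one hT hfin hc).selberg_eq_bassIhara D hT hfin
  · -- Without hyperbolic elements both products are `1`, whatever the constant `c` is.
    push Not at hyp
    have hfree : TreeZeta.AxisFree Γ := fun L hL g n hn hg =>
      absurd (hg.isHyperbolic hT hL hn) (hyp g)
    have hempty := TreeZeta.isEmpty_primePi1 D hT hyp
    obtain ⟨⟨h1, h2⟩, h3⟩ := hfree.selberg_eq_bassIhara D hT hfin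
    refine ⟨⟨h1, fun h => ?_⟩, fun u => ⟨(h3 u).1, fun h => ?_⟩⟩
    · have h4 : D.graphOfGroups.selbergZetaFormal D.R = 1 := tprod_empty
      rw [← h2 h, h4, one_pow]
    · have h4 : D.graphOfGroups.selbergZeta D.R u = 1 := tprod_empty
      rw [← (h3 u).2 h, h4, one_pow]
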